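/- Let $(W,S)$ be a Coxeter system with $S$ finite, length function $\ell$ and $m_{s,t}$ the order of $st$. Let $R$ be the localisation of $\mathbb Z[q]$ at the multiplicative set of polynomials with constant term $1$. For $I\subseteq S$ let $W_I=\langle I\rangle$; let $\Lambda$ be the set of finitary subsets $I\subseteq S$ (those with $W_I$ finite), and for $I\in\Lambda$ let $w_I$ be the longest element of $W_I$ and $\pi(I)=\sum_{w\in W_I}q^{\ell(w)}$, a unit of $R$. Write $I\sqsubset J$ if $I\subset J$ and $|I|=|J|-1$. Let $H_q$ be the Hecke algebra of $(W,S)$ over $\mathbb Z[q]$, with generators $T_s$ ($s\in S$), relations $T_s^2=(q-1)T_s+q$ and the braid relations $T_sT_tT_s\cdots=T_tT_sT_t\cdots$ ($m_{s,t}<\infty$ factors on each side), and elements $T_w=T_{s_1}\cdots T_{s_l}$ for a reduced expression $w=s_1\cdots s_l$. Put $x_s=T_s+1$, $x_I=\sum_{w\in W_I}T_w$ for $I\in\Lambda$, $E_q(W)=\mathrm{End}_{H_q}\big(\bigoplus_{I\in\Lambda}x_IH_q\big)$ (right modules) and $RE_q(W)=R\otimes_{\mathbb Z[q]}E_q(W)$.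 In path algebras, $\alpha\beta$ denotes the path $\beta$ followed by $\alpha$, and is $0$ if $\alpha$ does not start where $\beta$ ends. Let $Q$ be the quiver with vertex set $\Lambda$ and arrows $\upsilon_I:I\to\emptyset$, $\delta_I:\emptyset\to I$ for $\emptyset\ne I\in\Lambda$; let $e_I\in RQ$ be the trivial path at $I$ and $\tau_s=(1+q)\upsilon_{\{s\}}\delta_{\{s\}}-e_\emptyset$. Let $\mathcal J$ consist of the braid relations on the $\tau_s$ ($s\in S$) and of the relations $\upsilon_I\delta_I=\frac1{\pi(I)}\sum_{w\in W_I}\tau_w$ and $\delta_I\upsilon_I=e_I$ for all $\emptyset\neq I\in\Lambda$, where $\tau_w=\tau_{s_1}\cdots\tau_{s_l}$ for a fixed reduced expression $w=s_1\cdots s_l$, and $\tau_1=e_\emptyset$. Let $\tilde Q$ be the Hasse quiver, with vertex set $\Lambda$ and arrows $\tilde\upsilon_{I,J}:J\to I$ and $\tilde\delta_{J,I}:I\to J$ for all $I\sqsubset J$ in $\Lambda$; let $\tilde e_I$ be the trivial path at $I$ and $\tilde\chi_s=(q+1)\tilde\upsilon_{\emptyset,\{s\}}\tilde\delta_{\{s\},\emptyset}\in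 R\tilde Q$. For a sequence $\underline y=(t_1,\dots,t_k)$ in $S$ put $x_{\underline y}=x_{t_1}\cdots x_{t_k}$ and $\tilde\chi_{\underline y}=\tilde\chi_{t_1}\cdots\tilde\chi_{t_k}$, with $\tilde\chi_{()}=\tilde e_\emptyset$ for the empty sequence. For every $I\in\Lambda$ and every ordering $I_\bullet:\emptyset=I_0\sqsubset I_1\sqsubset\cdots\sqsubset I_m=I$ there are a reduced expression $\underline w=(s_l,\dots,s_1)$ of $w_I$ of which, for each $i$, some final segment $(s_{j_i},\dots,s_1)$ is a reduced expression of $w_{I_i}$, and polynomials $a_{\underline y}\in\mathbb Z[q]$, indexed by the proper subsequences $\underline y$ of $\underline w$, such that $x_I=x_{\underline w}+q\sum_{\underline y}a_{\underline y}x_{\underline y}$. Fix any such choice for each $I_\bullet$ and put $$\tilde\chi_{I_\bullet}=\tilde\chi_{\underline w}+q\sum_{\underline y}a_{\underline y}\tilde\chi_{\underline y},\qquad \tilde\rho_{I_\bullet}=\frac{\tilde\chi_{I_\bullet}}{\pi(I)}.$$ Let $\tilde{\mathcal J}$ consist of the following relations in $R\tilde Q$: 1. (idempotent relations) $\tilde\delta_{J,I}\tilde\upsilon_{I,J}=\tilde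 e_J$ for all $I\sqsubset J$ in $\Lambda$; 2. (sandwich relations) $\tilde\upsilon_{I,J}\tilde\upsilon_{J,K}=\tilde\upsilon_{I,J'}\tilde\upsilon_{J',K}$ and $\tilde\delta_{K,J}\tilde\delta_{J,I}=\tilde\delta_{K,J'}\tilde\delta_{J',I}$ for all $I\sqsubset J\sqsubset K$ and $I\sqsubset J'\sqsubset K$ in $\Lambda$; 3. (extended braid relations) $\tilde\upsilon_{\emptyset,I_1}\cdots\tilde\upsilon_{I_{m-1},I}\,\tilde\delta_{I,I_{m-1}}\cdots\tilde\delta_{I_1,\emptyset}=\tilde\rho_{I_\bullet}$ for all $I\in\Lambda$ with $|I|>1$ and all orderings $I_\bullet$ of $I$. Then, as $R$-algebras, $RE_q(W)\cong RQ/\langle\mathcal J\rangle\cong R\tilde Q/\langle\tilde{\mathcal J}\rangle$. -/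

import Mathlib

open scoped Polynomial DirectSum TensorProduct

noncomputable section

/-! ### Path algebras -/

/-- An oriented path of a quiver, bundled with its starting and ending vertex. -/
structure QuiverPath (V : Type*) [Quiver V] where
  src : V
  tgt : V
  path : Quiver.Path src tgt

/-- The path algebra `RQ`: the free `R`-module on the set of all paths of the quiver. -/
def PathAlgebra (R : Type*) [CommRing R] (V : Type*) [Quiver V] : Type _ :=
  QuiverPath V →₀ R

namespace PathAlgebra

variable (R : Type*) [CommRing R] {V : Type*} [Quiver V]

instance : AddCommGroup (PathAlgebra R V) := inferInstanceAs (AddCommGroup (QuiverPath V →₀ R))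

instance : Module R (PathAlgebra R V) := inferInstanceAs (Module R (QuiverPath V →₀ R))

/-- A path as a basis element of the path algebra. -/
def ofPath (p : QuiverPath V) : PathAlgebra R V := Finsupp.single p (1 : R)

/-- The trivial path at a vertex. -/
def vertex (a : V) : PathAlgebra R V := ofPath R ⟨a, a, Quiver.Path.nil⟩

/-- An arrow as a path of length one. -/
def arrow {a b : V} (f : a ⟶ b) : PathAlgebra R V := ofPath R ⟨a, b, f.toPath⟩

open Classical in
/-- The product `p q` of two paths: first `q`, then `p`, if `p` starts where `q` ends;
otherwise zero. -/
def concat (p q : QuiverPath V) : PathAlgebra R V :=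
  if h : q.tgt = p.src then ofPath R ⟨q.src, p.tgt, (q.path.cast rfl h).comp p.path⟩ else 0

/-- The bilinear extension of `concat`. -/
def mulLin : PathAlgebra R V →ₗ[R] PathAlgebra R V →ₗ[R] PathAlgebra R V :=
  Finsupp.lift (PathAlgebra R V →ₗ[R] PathAlgebra R V) R (QuiverPath V) fun p =>
    Finsupp.lift (PathAlgebra R V) R (QuiverPath V) fun q => concat R p q

instance : Mul (PathAlgebra R V) := ⟨fun x y => mulLin R x y⟩

instance [Finite V] : One (PathAlgebra R V) :=
  ⟨∑ a ∈ (Set.toFinite (Set.univ : Set V)).toFinset, vertex R a⟩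

variable {R}

theorem mul_def (x y : PathAlgebra R V) : x * y = mulLin R x y := rfl

theorem one_def [Finite V] : (1 : PathAlgebra R V) =
    ∑ a ∈ (Set.toFinite (Set.univ : Set V)).toFinset, vertex R a := rfl

theorem ofPath_mul_ofPath (p q : QuiverPath V) : ofPath R p * ofPath R q = concat R p q := by
  have h : mulLin R (ofPath R p) =
      Finsupp.lift (PathAlgebra R V) R (QuiverPath V) fun q => concat R p q := by
    unfold mulLin ofPath
    exact (Finsupp.sum_single_index (by simp)).trans (one_smul R _)
  rw [mul_def, h]
  unfold ofPath
  exact (Finsupp.sum_single_index (by simp)).trans (one_smul R _)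

theorem concat_comp {a b c : V} (p : Quiver.Path b c) (q : Quiver.Path a b) :
    concat R ⟨b, c, p⟩ ⟨a, b, q⟩ = ofPath R ⟨a, c, q.comp p⟩ := by
  simp [concat]

theorem concat_of_ne {p q : QuiverPath V} (h : q.tgt ≠ p.src) : concat R p q = 0 := by
  simp [concat, h]

theorem induction {P : PathAlgebra R V → Prop} (x : PathAlgebra R V) (h0 : P 0)
    (hadd : ∀ x y, P x → P y → P (x + y)) (hp : ∀ (r : R) p, P (r • ofPath R p)) : P x := by
  refine Finsupp.induction_linear x h0 (fun f g => hadd f g) fun p r => ?_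
  have : (Finsupp.single p r : QuiverPath V →₀ R) = r • Finsupp.single p (1 : R) := by simp
  rw [this]
  exact hp r p

theorem mul_assoc_ofPath (p q r : QuiverPath V) :
    ofPath R p * ofPath R q * ofPath R r = ofPath R p * (ofPath R q * ofPath R r) := by
  have zl : ∀ x : PathAlgebra R V, 0 * x = 0 := fun x => by simp [mul_def]
  have zr : ∀ x : PathAlgebra R V, x * 0 = 0 := fun x => by simp [mul_def]
  obtain ⟨a, b, p⟩ := p
  obtain ⟨c, d, q⟩ := q
  obtain ⟨e, f, r⟩ := r
  simp only [ofPath_mul_ofPath]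
  by_cases h1 : d = a
  · subst h1
    by_cases h2 : f = c
    · subst h2
      simp only [concat_comp, ofPath_mul_ofPath, Quiver.Path.comp_assoc]
    · rw [concat_comp, ofPath_mul_ofPath, concat_of_ne (p := ⟨c, d, q⟩) h2, zr,
        concat_of_ne (by exact h2)]
  · rw [concat_of_ne (by exact h1), zl]
    by_cases h2 : f = c
    · subst h2
      rw [concat_comp, ofPath_mul_ofPath, concat_of_ne (by exact h1)]
    · rw [concat_of_ne (p := ⟨c, d, q⟩) h2, zr]

instance : NonUnitalRing (PathAlgebra R V) where
  left_distrib x y z := by simp [mul_def]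
  right_distrib x y z := by simp [mul_def]
  zero_mul x := by simp [mul_def]
  mul_zero x := by simp [mul_def]
  mul_assoc x y z := by
    have add1 : ∀ x y z : PathAlgebra R V, x * (y + z) = x * y + x * z :=
      fun x y z => by simp [mul_def]
    have add2 : ∀ x y z : PathAlgebra R V, (x + y) * z = x * z + y * z :=
      fun x y z => by simp [mul_def]
    have sm1 : ∀ (r : R) (x y : PathAlgebra R V), (r • x) * y = r • (x * y) :=
      fun r x y => by simp [mul_def]
    have sm2 : ∀ (r : R) (x y : PathAlgebra R V), x * (r • y) = r • (x * y) :=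
      fun r x y => by simp [mul_def]
    refine induction (P := fun x => x * y * z = x * (y * z)) x (by simp [mul_def]) (fun a b ha hb => by simp only [add2, ha, hb])
      fun r p => ?_
    refine induction (P := fun y => _ * y * z = _ * (y * z)) y (by simp [mul_def]) (fun a b ha hb => by simp only [add1, add2, ha, hb])
      fun s q => ?_
    refine induction (P := fun z => _ * _ * z = _ * (_ * z)) z (by simp [mul_def]) (fun a b ha hb => by simp only [add1, ha, hb])
      fun t u => ?_
    simp only [sm1, sm2, mul_assoc_ofPath]

theorem vertex_mul_ofPath (a : V) (p : QuiverPath V) [Decidable (p.tgt = a)] :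
    vertex R a * ofPath R p = if p.tgt = a then ofPath R p else 0 := by
  obtain ⟨b, c, p⟩ := p
  rw [vertex, ofPath_mul_ofPath]
  split_ifs with h
  · subst h
    rw [concat_comp, Quiver.Path.comp_nil]
  · exact concat_of_ne h

theorem ofPath_mul_vertex (a : V) (p : QuiverPath V) [Decidable (p.src = a)] :
    ofPath R p * vertex R a = if p.src = a then ofPath R p else 0 := by
  obtain ⟨b, c, p⟩ := p
  rw [vertex, ofPath_mul_ofPath]
  split_ifs with h
  · subst h
    rw [concat_comp, Quiver.Path.nil_comp]
  · exact concat_of_ne (Ne.symm h)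

theorem smul_mul (r : R) (x y : PathAlgebra R V) : r • x * y = r • (x * y) := by
  simp [mul_def]

theorem mul_smul' (r : R) (x y : PathAlgebra R V) : x * r • y = r • (x * y) := by
  simp [mul_def]

/-- For finitely many vertices the path algebra is unital, the unit being the sum of the
trivial paths. -/
instance [Finite V] : Ring (PathAlgebra R V) where
  __ := (inferInstance : NonUnitalRing (PathAlgebra R V))
  __ := (inferInstance : One (PathAlgebra R V))
  one_mul x := by
    classical
    refine induction (P := fun x => 1 * x = x) x (mul_zero _) (fun a b ha hb => by rw [mul_add, ha, hb]) fun r p => ?_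
    simp [one_def, Finset.sum_mul, vertex_mul_ofPath, mul_smul']
  mul_one x := by
    classical
    refine induction (P := fun x => x * 1 = x) x (zero_mul _) (fun a b ha hb => by rw [add_mul, ha, hb]) fun r p => ?_
    simp [one_def, Finset.mul_sum, ofPath_mul_vertex, smul_mul]

instance [Finite V] : Algebra R (PathAlgebra R V) :=
  Algebra.ofModule smul_mul mul_smul'

end PathAlgebra

namespace HeckeEndo

/-! ### The ground rings -/

/-- The multiplicative set of the integral polynomials with constant term `1`. -/
def unitConst : Submonoid ℤ[X] where
  carrier := {f | f.coeff 0 = 1}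
  one_mem' := by simp
  mul_mem' {f g} hf hg := by
    simp only [Set.mem_ofPred_eq] at hf hg ⊢
    simp [Polynomial.mul_coeff_zero, hf, hg]

/-- The ring `R`, the localisation of `ℤ[q]` at the polynomials with constant term `1`. -/
abbrev LocRing : Type := Localization unitConst

/-- The polynomial variable. -/
abbrev q : ℤ[X] := Polynomial.X

/-- The polynomial variable in `R`. -/
def qR : LocRing := algebraMap ℤ[X] LocRing q

variable {B W : Type*} [Group W] {M : CoxeterMatrix B} (cs : CoxeterSystem M W)

/-! ### Finitary subsets -/

/-- The parabolic subgroup generated by a set of simple reflections. -/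
def parabolic (I : Finset B) : Subgroup W :=
  Subgroup.closure (cs.simple '' (I : Set B))

/-- The set `Λ` of the finitary subsets of `S` (a subset of `S` with finite parabolic subgroup
is itself finite). -/
def Finitary : Type _ := {I : Finset B // Finite (parabolic cs I)}

variable {cs}

instance (I : Finitary cs) : Fintype (parabolic cs I.1) :=
  @Fintype.ofFinite _ I.2

instance [Finite B] : Finite (Finitary cs) := by
  unfold Finitary
  infer_instance

variable (cs) in
/-- The empty set as a finitary subset. -/
def emptySet : Finitary cs :=
  ⟨∅, by simp only [parabolic, Finset.coe_empty, Set.image_empty, Subgroup.closure_empty]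
         infer_instance⟩

theorem singleton_finite (s : B) : Finite (parabolic cs {s}) := by
  rw [parabolic, Finset.coe_singleton, Set.image_singleton, ← Subgroup.zpowers_eq_closure]
  refine finite_zpowers.2 (isOfFinOrder_iff_pow_eq_one.2 ⟨2, by norm_num, ?_⟩)
  rw [pow_two, cs.simple_mul_simple_self]

variable (cs) in
/-- A singleton as a finitary subset. -/
def singletonSet (s : B) : Finitary cs := ⟨{s}, singleton_finite s⟩

/-- `I ⊏ J`: `I` is contained in `J` and has exactly one element less. -/
def Covers (I J : Finitary cs) : Prop := I.1 ⊆ J.1 ∧ I.1.card + 1 = J.1.card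

theorem covers_singleton (s : B) : Covers (emptySet cs) (singletonSet cs s) := by
  simp [Covers, emptySet, singletonSet]

/-- The Poincaré polynomial of a finitary subset. -/
def poincare (I : Finitary cs) : ℤ[X] := ∑ w : parabolic cs I.1, q ^ cs.length w.1

theorem poincare_mem (I : Finitary cs) : poincare I ∈ unitConst := by
  classical
  change (poincare I).coeff 0 = 1
  rw [poincare, Polynomial.finsetSum_coeff, Finset.sum_eq_single (1 : parabolic cs I.1)]
  · simp
  · intro w _ hw
    have h : cs.length (w : W) ≠ 0 := by
      rw [Ne, cs.length_eq_zero_iff]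
      exact fun h => hw (Subtype.ext h)
    rw [Polynomial.coeff_X_pow, if_neg (Ne.symm h)]
  · simp

/-- The element `1 / π(I)` of `R`. -/
def invPoincare (I : Finitary cs) : LocRing := Localization.mk 1 ⟨poincare I, poincare_mem I⟩

/-! ### The Hecke algebra -/

variable (M) in
/-- The braid relation for `s, t` says that the products over the two alternating words of length
`m_{s,t}` in `s` and `t` agree. An infinite `m_{s,t}` is encoded as `0`, and then (as for `s = t`)
the relation is trivial. -/
def braidWord (s t : B) : List B := CoxeterSystem.alternatingWord s t (M s t)

variable (M) in
/-- The Hecke relations. -/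
inductive HeckeRel : FreeAlgebra ℤ[X] B → FreeAlgebra ℤ[X] B → Prop
  | quadratic (s : B) : HeckeRel (FreeAlgebra.ι ℤ[X] s * FreeAlgebra.ι ℤ[X] s)
      ((q - 1) • FreeAlgebra.ι ℤ[X] s + q • 1)
  | braid (s t : B) : HeckeRel ((braidWord M s t).map (FreeAlgebra.ι ℤ[X])).prod
      ((braidWord M t s).map (FreeAlgebra.ι ℤ[X])).prod

/-- The Hecke algebra over `ℤ[q]`. -/
def Hecke (_ : CoxeterSystem M W) : Type _ := RingQuot (HeckeRel M)

instance : Ring (Hecke cs) := inferInstanceAs (Ring (RingQuot (HeckeRel M)))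

instance : Algebra ℤ[X] (Hecke cs) := inferInstanceAs (Algebra ℤ[X] (RingQuot (HeckeRel M)))

variable (cs) in
/-- The generator `T_s`. -/
def heckeT (s : B) : Hecke cs := RingQuot.mkAlgHom ℤ[X] (HeckeRel M) (FreeAlgebra.ι ℤ[X] s)

variable (cs) in
/-- A fixed reduced expression of each element of `W`. -/
def redWord (w : W) : List B := (cs.exists_isReduced w).choose

variable (cs) in
/-- The element `T_w`, the product of the `T_s` over a reduced expression of `w`. -/
def heckeTw (w : W) : Hecke cs := ((redWord cs w).map (heckeT cs)).prod

/-- The element `x_I`, the sum of the `T_w` over the parabolic subgroup. -/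
def xI (I : Finitary cs) : Hecke cs := ∑ w : parabolic cs I.1, heckeTw cs w.1

variable (cs) in
/-- The product `x_{s_1} ⋯ x_{s_l}` of Kazhdan--Lusztig generators `x_s = T_s + 1`. -/
def xWord (ω : List B) : Hecke cs := (ω.map fun s => heckeT cs s + 1).prod

/-! ### The Hecke endomorphism algebra -/

/-- The right ideal `x_I H`. -/
def xIdeal (I : Finitary cs) : Submodule (Hecke cs)ᵐᵒᵖ (Hecke cs) :=
  Submodule.span (Hecke cs)ᵐᵒᵖ {xI I}

variable (cs) in
/-- The Hecke endomorphism algebra: endomorphisms of the right module `⨁ x_I H`. -/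
abbrev HeckeEnd : Type _ := Module.End (Hecke cs)ᵐᵒᵖ (⨁ I : Finitary cs, xIdeal I)

variable (cs) in
/-- The base change `R ⊗ E_q(W)`. -/
abbrev LocHeckeEnd : Type _ := LocRing ⊗[ℤ[X]] HeckeEnd cs

/-! ### The quiver `Q` with arrows to and from the empty set -/

/-- The product `t_{s_1} ⋯ t_{s_l}` in a corner ring with unit `e`, so that the empty product
is `e`. -/
def cornerProd {A : Type*} [Ring A] (e : A) (t : B → A) (ω : List B) : A := e * (ω.map t).prod

/-- The element `p_I = x_I / π(I)` with each `T_s` replaced by `t_s`, in a corner ring with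
unit `e`. -/
def pSubst {A : Type*} [Ring A] [Algebra LocRing A] (e : A) (t : B → A) (I : Finitary cs) : A :=
  invPoincare I • ∑ w : parabolic cs I.1, cornerProd e t (redWord cs w.1)

variable (cs) in
/-- The vertex set of `Q`. -/
structure StarQuiver where
  set : Finitary cs

instance [Finite B] : Finite (StarQuiver cs) :=
  Finite.of_injective StarQuiver.set fun ⟨_⟩ ⟨_⟩ h => congrArg _ h

/-- The arrows `υ_I` from `I` to the empty set and `δ_I` from the empty set to `I`, for nonempty
finitary `I`. -/
inductive StarArrow : Finitary cs → Finitary cs → Type _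
  | up (I : Finitary cs) (h : I.1.Nonempty) : StarArrow I (emptySet cs)
  | down (I : Finitary cs) (h : I.1.Nonempty) : StarArrow (emptySet cs) I

instance : Quiver (StarQuiver cs) := ⟨fun I J => StarArrow I.set J.set⟩

variable (cs) in
/-- The path algebra `RQ`. -/
abbrev StarPathAlgebra : Type _ := PathAlgebra LocRing (StarQuiver cs)

/-- The trivial path `e_I` in `RQ`. -/
def starE (I : Finitary cs) : StarPathAlgebra cs :=
  PathAlgebra.vertex LocRing (⟨I⟩ : StarQuiver cs)

/-- The arrow `υ_I` in `RQ`. -/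
def starUp (I : Finitary cs) (h : I.1.Nonempty) : StarPathAlgebra cs :=
  PathAlgebra.arrow LocRing (a := (⟨I⟩ : StarQuiver cs)) (b := ⟨emptySet cs⟩) (StarArrow.up I h)

/-- The arrow `δ_I` in `RQ`. -/
def starDown (I : Finitary cs) (h : I.1.Nonempty) : StarPathAlgebra cs :=
  PathAlgebra.arrow LocRing (a := (⟨emptySet cs⟩ : StarQuiver cs)) (b := ⟨I⟩) (StarArrow.down I h)

variable (cs) in
/-- The element `τ_s = (1 + q) υ_s δ_s - e_∅`. -/
def starTau (s : B) : StarPathAlgebra cs :=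
  (1 + qR) • (starUp (singletonSet cs s) (Finset.singleton_nonempty s) *
    starDown (singletonSet cs s) (Finset.singleton_nonempty s)) - starE (emptySet cs)

variable (cs) in
/-- The relations `𝒥` on `RQ`. -/
inductive StarRel [Finite B] : StarPathAlgebra cs → StarPathAlgebra cs → Prop
  | braid (s t : B) : StarRel
      (cornerProd (starE (emptySet cs)) (starTau cs) (braidWord M s t))
      (cornerProd (starE (emptySet cs)) (starTau cs) (braidWord M t s))
  | hook (I : Finitary cs) (h : I.1.Nonempty) : StarRel (starUp I h * starDown I h)
      (pSubst (starE (emptySet cs)) (starTau cs) I)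
  | idem (I : Finitary cs) (h : I.1.Nonempty) : StarRel (starDown I h * starUp I h) (starE I)

variable (cs) in
/-- The algebra `RQ / ⟨𝒥⟩`. -/
abbrev StarAlgebra [Finite B] : Type _ := RingQuot (StarRel cs)

/-! ### The Hasse quiver -/

variable (cs) in
/-- The vertex set of the Hasse quiver. -/
structure HasseQuiver where
  set : Finitary cs

instance [Finite B] : Finite (HasseQuiver cs) :=
  Finite.of_injective HasseQuiver.set fun ⟨_⟩ ⟨_⟩ h => congrArg _ h

/-- The arrows `υ_{I,J}` from `J` to `I` and `δ_{J,I}` from `I` to `J`, for `I ⊏ J`. -/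
inductive HasseArrow : Finitary cs → Finitary cs → Type _
  | up {I J : Finitary cs} (h : Covers I J) : HasseArrow J I
  | down {I J : Finitary cs} (h : Covers I J) : HasseArrow I J

instance : Quiver (HasseQuiver cs) := ⟨fun I J => HasseArrow I.set J.set⟩

variable (cs) in
/-- The path algebra of the Hasse quiver. -/
abbrev HassePathAlgebra : Type _ := PathAlgebra LocRing (HasseQuiver cs)

/-- The trivial path at `I` in the Hasse quiver. -/
def hasseE (I : Finitary cs) : HassePathAlgebra cs :=
  PathAlgebra.vertex LocRing (⟨I⟩ : HasseQuiver cs)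

/-- The arrow `υ_{I,J}` of the Hasse quiver. -/
def hasseUp {I J : Finitary cs} (h : Covers I J) : HassePathAlgebra cs :=
  PathAlgebra.arrow LocRing (a := (⟨J⟩ : HasseQuiver cs)) (b := ⟨I⟩) (HasseArrow.up h)

/-- The arrow `δ_{J,I}` of the Hasse quiver. -/
def hasseDown {I J : Finitary cs} (h : Covers I J) : HassePathAlgebra cs :=
  PathAlgebra.arrow LocRing (a := (⟨I⟩ : HasseQuiver cs)) (b := ⟨J⟩) (HasseArrow.down h)

/-- A total ordering `I_•` of `I`, as a chain `∅ = I_0 ⊏ I_1 ⊏ ⋯ ⊏ I_m = I`. -/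
inductive ChainTo : Finitary cs → Type _
  | nil : ChainTo (emptySet cs)
  | cons {I J : Finitary cs} (F : ChainTo I) (h : Covers I J) : ChainTo J

/-- The product `υ_{∅,I_1} ⋯ υ_{I_{m-1},I}`. -/
def upPath : {I : Finitary cs} → ChainTo I → HassePathAlgebra cs
  | _, .nil => hasseE (emptySet cs)
  | _, .cons F h => upPath F * hasseUp h

/-- The product `δ_{I,I_{m-1}} ⋯ δ_{I_1,∅}`. -/
def downPath : {I : Finitary cs} → ChainTo I → HassePathAlgebra cs
  | _, .nil => hasseE (emptySet cs)
  | _, .cons F h => hasseDown h * downPath F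

variable (cs) in
/-- `w` is the longest element of the parabolic subgroup of `I`. -/
def IsLongest (I : Finitary cs) (w : W) : Prop :=
  w ∈ parabolic cs I.1 ∧ ∀ v ∈ parabolic cs I.1, cs.length v ≤ cs.length w

/-- `ω = (s_l, …, s_1)` is a reduced expression of the longest element of the parabolic subgroup
of `I` that has, for each member `I_i` of the chain, a final segment `(s_j, …, s_1)` that is a
reduced expression of the longest element of the parabolic subgroup of `I_i`. -/
def Adapted : {I : Finitary cs} → ChainTo I → List B → Prop
  | _, .nil, ω => ω = []
  | J, .cons F _, ω => cs.IsReduced ω ∧ IsLongest cs J (cs.wordProd ω) ∧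
      ∃ ω' : List B, ω' <:+ ω ∧ Adapted F ω'

/-- An expression of `x_I` in the Kazhdan--Lusztig generators attached to an ordering of `I`:
an adapted reduced expression `ω` and polynomials `a_y`, indexed by the proper subsequences `y`
of `ω`, with `x_I = x_ω + q ∑ a_y x_y`. -/
structure Expression {I : Finitary cs} (F : ChainTo I) where
  word : List B
  adapted : Adapted F word
  coeff : List B →₀ ℤ[X]
  proper : ∀ y ∈ coeff.support, y.Sublist word ∧ y ≠ word
  eq : xI I = xWord cs word + q • coeff.sum fun y a => a • xWord cs y

variable (cs) in
/-- The element `χ_s = (q + 1) υ_{∅,s} δ_{s,∅}`. -/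
def hasseChi (s : B) : HassePathAlgebra cs :=
  (qR + 1) • (hasseUp (covers_singleton (cs := cs) s) * hasseDown (covers_singleton (cs := cs) s))

variable (cs) in
/-- The product of the `χ_s` over a word; the empty product is the trivial path at `∅`. -/
def chiWord [Finite B] (ω : List B) : HassePathAlgebra cs :=
  cornerProd (hasseE (emptySet cs)) (hasseChi cs) ω

/-- The element `χ_{I_•} = χ_ω + q ∑ a_y χ_y`. -/
def chi [Finite B] {I : Finitary cs} {F : ChainTo I} (E : Expression F) : HassePathAlgebra cs :=
  chiWord cs E.word +
    qR • E.coeff.sum fun y a => algebraMap ℤ[X] LocRing a • chiWord cs y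

/-- The element `ρ_{I_•} = χ_{I_•} / π(I)`. -/
def rho [Finite B] {I : Finitary cs} {F : ChainTo I} (E : Expression F) : HassePathAlgebra cs :=
  invPoincare I • chi E

/-- The relations on the path algebra of the Hasse quiver, for a fixed choice of an expression of
`x_I` for each finitary `I` and each ordering of `I`. -/
inductive HasseRel [Finite B] (E : ∀ (I : Finitary cs) (F : ChainTo I), Expression F) :
    HassePathAlgebra cs → HassePathAlgebra cs → Prop
  | idem {I J : Finitary cs} (h : Covers I J) : HasseRel E (hasseDown h * hasseUp h) (hasseE J)
  | sandwichUp {I J J' K : Finitary cs} (h₁ : Covers I J) (h₂ : Covers J K)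
      (h₁' : Covers I J') (h₂' : Covers J' K) :
      HasseRel E (hasseUp h₁ * hasseUp h₂) (hasseUp h₁' * hasseUp h₂')
  | sandwichDown {I J J' K : Finitary cs} (h₁ : Covers I J) (h₂ : Covers J K)
      (h₁' : Covers I J') (h₂' : Covers J' K) :
      HasseRel E (hasseDown h₂ * hasseDown h₁) (hasseDown h₂' * hasseDown h₁')
  | extendedBraid (I : Finitary cs) (hI : 1 < I.1.card) (F : ChainTo I) :
      HasseRel E (upPath F * downPath F) (rho (E I F))

/-- The path algebra of the Hasse quiver modulo the three families of relations. -/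
abbrev HasseAlgebra [Finite B] (E : ∀ (I : Finitary cs) (F : ChainTo I), Expression F) : Type _ :=
  RingQuot (HasseRel E)

end HeckeEndo

end

/-! ### Coxeter groups: exchange, orders of products, reduced words, longest elements. -/

noncomputable section

namespace CoxeterSystem

variable {B W : Type*} [Group W] {M : CoxeterMatrix B} (cs : CoxeterSystem M W)

/-! ### The exchange condition -/

/-! Over $R$ every $\pi(I)$ is invertible, so $p_I=x_I/\pi(I)$ is an idempotent, and $RE_q(W)$ is
the algebra of matrices with entries in the spaces $p_J\,RH_q\,p_I$. It is generated by the
projections to the summands, the inclusions $x_IH\to H$, the projections $p_I:H\to x_IH$ and the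
action of $H$ on the summand of $\emptyset$. The relations that matter are `down * up = e_I`, `up *
down = x_I / π(I)` and those of $H$.

This is abstracted in `HookSystem`: an algebra with elements that satisfy these relations. Since
$x_Iy=\pi(I)y$ on $x_IH$, an endomorphism $f$ is given on $x_IH$ by left multiplication with
$f(x_I)/\pi(I)$. Hence every hook system in $A$ yields a homomorphism `psiHom` from $RE_q(W)$ to
$A$, without any basis of $H$. A homomorphism back that takes the hook elements to the canonical
ones composes with it to the identity of $RE_q(W)$ (`comp_psiHom`); the other composite is checked
on vertices and arrows. It remains to find hook systems in both quotients of path algebras.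

For $Q$ the relations are almost literally those of a hook system. The only issue is that the
$\tau_s$ live in the corner of $e_\emptyset$, whereas a unital homomorphism from $H$ to the whole
algebra is wanted; on the complement of the corner $T_s$ acts by $-1$.

For the Hasse quiver the sandwich relations make products of arrows along a chain independent of the
chain (`hasseMk_path_eq`), which defines `up` and `down`. The braid relations must be extracted from
the extended ones in rank two (`hasseMk_braid`). There the two orderings of $\{s,t\}$ give two
expressions with the same value. Each is the product of the $\chi_a-1$ over an alternating word of
length $m_{s,t}$ plus a combination of shorter alternating products. In $H$ both equal
$x_{\{s,t\}}$, so by linear independence of the $T_w$ (`linearIndependent_heckeTw`) the shorter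
terms have the same coefficients, whatever the chosen $a_{\underline y}$ are; cancelling them leaves
the braid relation (`Expression.mul_prod_eq`).

The existence of the expressions (`nonempty_expression`) comes from multiplying out $x_{\underline
w}$: modulo $q$ it is the sum of $T_v$ over all products $v$ of subwords of $\underline w$, and for
a reduced word of $w_I$ these exhaust $W_I$. -/

open Classical in
/-- The permutation `(x, ε) ↦ (s x s, ε + [x = s])` of `W × ℤ/2`. -/
def reflPerm (i : B) : Equiv.Perm (W × ZMod 2) :=
  Function.Involutive.toPerm
    (fun p => (cs.simple i * p.1 * cs.simple i, p.2 + if p.1 = cs.simple i then 1 else 0)) <| by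
    rintro ⟨x, ε⟩
    have h2 : (1 : ZMod 2) + 1 = 0 := by decide
    have h : cs.simple i * x * cs.simple i = cs.simple i ↔ x = cs.simple i := by
      constructor
      · intro h
        have := congrArg (fun y => cs.simple i * y * cs.simple i) h
        simpa [mul_assoc] using this
      · rintro rfl
        simp
    simp only [h]
    by_cases hx : x = cs.simple i <;> simp [hx, mul_assoc, add_assoc, h2]

open Classical in
theorem reflPerm_apply (i : B) (x : W) (ε : ZMod 2) :
    cs.reflPerm i (x, ε) =
      (cs.simple i * x * cs.simple i, ε + if x = cs.simple i then 1 else 0) := rfl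

-- The sign component records the parity of the number of occurrences of `x` in the right inversion
-- sequence. Once these permutations are known to define an action of `W`, this parity depends on
-- the group element alone.
open Classical in
theorem reflPerm_prod_apply (ω : List B) (x : W) (ε : ZMod 2) :
    (ω.map cs.reflPerm).prod (x, ε) =
      (cs.wordProd ω * x * (cs.wordProd ω)⁻¹, ε + ((cs.rightInvSeq ω).count x : ZMod 2)) := by
  induction ω with
  | nil => simp
  | cons i ω ih =>
    rw [List.map_cons, List.prod_cons, Equiv.Perm.mul_apply, ih]
    have h : cs.wordProd ω * x * (cs.wordProd ω)⁻¹ = cs.simple i ↔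
        (cs.wordProd ω)⁻¹ * cs.simple i * cs.wordProd ω = x := by
      constructor
      · intro h
        rw [← h]
        group
      · rintro rfl
        group
    simp only [reflPerm_apply, h, wordProd_cons, rightInvSeq,
      List.count_cons, beq_iff_eq, mul_inv_rev, inv_simple, Nat.cast_add, Nat.cast_ite,
      Nat.cast_one, Nat.cast_zero, add_assoc]
    simp only [mul_assoc]

theorem reverse_alternatingWord_two_mul (i j : B) (m : ℕ) :
    (alternatingWord i j (2 * m)).reverse = alternatingWord j i (2 * m) := by
  apply List.ext_getElem
  · simp
  · intro k h₁ h₂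
    simp only [List.length_reverse, length_alternatingWord] at h₁ h₂
    rw [List.getElem_reverse, getElem_alternatingWord _ _ _ _ h₂]
    simp only [length_alternatingWord]
    rw [getElem_alternatingWord _ _ _ _ (by omega)]
    have : Even (2 * m + (2 * m - 1 - k)) ↔ ¬ Even (2 * m + k) := by
      simp only [Nat.even_iff]
      omega
    by_cases h : Even (2 * m + k) <;> simp [this, h]

theorem map_alternatingWord_two_mul_prod {G : Type*} [Monoid G] (f : B → G) (i j : B) (m : ℕ) :
    ((alternatingWord i j (2 * m)).map f).prod = (f i * f j) ^ m := by
  induction m with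
  | zero => simp [alternatingWord]
  | succ m ih =>
    rw [mul_add, mul_one, alternatingWord_succ, alternatingWord_succ]
    simp [ih, pow_succ]

/-- The inversion sequence of the word $(ij)^m$ with $m=m_{i,j}$ has period $m$, because
$(s_is_j)^m=1$. Its second half repeats the first, so every reflection occurs an even number of
times and no sign changes. -/
theorem reflPerm_isLiftable : M.IsLiftable cs.reflPerm := by
  classical
  intro i j
  rw [← map_alternatingWord_two_mul_prod]
  ext1 ⟨x, ε⟩
  rw [reflPerm_prod_apply]
  have h1 : cs.wordProd (alternatingWord i j (2 * M i j)) = 1 := by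
    rw [wordProd, map_alternatingWord_two_mul_prod, simple_mul_simple_pow]
  have h2 : cs.rightInvSeq (alternatingWord i j (2 * M i j)) =
      (cs.leftInvSeq (alternatingWord j i (2 * M i j))).reverse := by
    rw [← rightInvSeq_reverse, reverse_alternatingWord_two_mul]
  set L := cs.leftInvSeq (alternatingWord j i (2 * M i j)) with hL
  have hlen : L.length = 2 * M i j := by simp [hL]
  have h3 : L.drop (M i j) = L.take (M i j) := by
    apply List.ext_getElem
    · simp [hlen]
      omega
    · intro k h₁ h₂
      simp only [List.length_drop, List.length_take, hlen] at h₁ h₂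
      rw [List.getElem_drop, List.getElem_take]
      simp only [hL]
      rw [getElem_leftInvSeq_alternatingWord _ _ _ _ _ (by omega),
        getElem_leftInvSeq_alternatingWord _ _ _ _ _ (by omega),
        prod_alternatingWord_eq_mul_pow, prod_alternatingWord_eq_mul_pow]
      have e1 : (2 * (M i j + k) + 1) / 2 = M i j + k := by omega
      have e2 : (2 * k + 1) / 2 = k := by omega
      rw [e1, e2, pow_add, simple_mul_simple_pow, one_mul]
      simp [parity_simps]
  rw [h1, h2, List.count_reverse, ← List.take_append_drop (M i j) L, h3, List.count_append]
  have : ∀ a : ZMod 2, a + a = 0 := by decide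
  simp [this]

open Classical in
theorem count_rightInvSeq_eq {ω ω' : List B} (h : cs.wordProd ω = cs.wordProd ω') (x : W) :
    ((cs.rightInvSeq ω).count x : ZMod 2) = (cs.rightInvSeq ω').count x := by
  have key (η : List B) : cs.lift ⟨_, cs.reflPerm_isLiftable⟩ (cs.wordProd η) =
      (η.map cs.reflPerm).prod := by
    rw [wordProd, map_list_prod, List.map_map]
    congr 2
    ext1 i
    exact cs.lift_apply_simple _ i
  have h1 := congrArg (fun p => (p (x, 0)).2) ((key ω).symm.trans ((congrArg _ h).trans (key ω')))
  simpa [reflPerm_prod_apply] using h1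

/-- The exchange condition for right descents. -/
theorem exists_eraseIdx_of_isRightDescent {ω : List B} {i : B}
    (h : cs.IsRightDescent (cs.wordProd ω) i) :
    ∃ j < ω.length, cs.wordProd ω * cs.simple i = cs.wordProd (ω.eraseIdx j) := by
  classical
  suffices hmem : cs.simple i ∈ cs.rightInvSeq ω by
    obtain ⟨j, hj, hj'⟩ := List.mem_iff_getElem.mp hmem
    refine ⟨j, by simpa using hj, ?_⟩
    rw [← wordProd_mul_getD_rightInvSeq, List.getD_eq_getElem _ _ hj, hj']
  by_contra hmem
  -- If $s_i$ does not occur, compare with the word `η ++ [i]` of the same element, `η` being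
  -- reduced. There $s_i$ occurs exactly once, as the last entry: an earlier occurrence would make
  -- `i` a descent of $ws_i$. The parities 0 and 1 contradict each other.
  obtain ⟨η, hη, hη'⟩ := cs.exists_isReduced (cs.wordProd ω * cs.simple i)
  have h1 : cs.wordProd ω = cs.wordProd (η ++ [i]) := by
    rw [wordProd_append, ← hη', wordProd_singleton, simple_mul_simple_cancel_right]
  have h2 := cs.count_rightInvSeq_eq h1 (cs.simple i)
  rw [List.count_eq_zero_of_not_mem hmem, ← List.concat_eq_append, rightInvSeq_concat,
    List.concat_eq_append, List.count_append, List.count_singleton_self] at h2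
  have h3 : cs.simple i ∉ cs.rightInvSeq η := by
    intro h3
    have := (cs.isRightInversion_of_mem_rightInvSeq hη h3).2
    rw [← hη', simple_mul_simple_cancel_right] at this
    exact absurd h (not_lt.2 this.le)
  have h4 : cs.simple i ∉ (cs.rightInvSeq η).map (MulAut.conj (cs.simple i)) := by
    intro h4
    obtain ⟨x, hx, hx'⟩ := List.mem_map.1 h4
    have : x = cs.simple i := by
      have := congrArg (fun y => cs.simple i * y * cs.simple i) hx'
      simpa [mul_assoc] using this
    exact h3 (this ▸ hx)
  rw [List.count_eq_zero_of_not_mem h4] at h2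
  simp at h2

/-- The exchange condition for left descents. -/
theorem exists_eraseIdx_of_isLeftDescent {ω : List B} {i : B}
    (h : cs.IsLeftDescent (cs.wordProd ω) i) :
    ∃ j < ω.length, cs.simple i * cs.wordProd ω = cs.wordProd (ω.eraseIdx j) := by
  rw [← isRightDescent_inv_iff, ← wordProd_reverse] at h
  obtain ⟨j, hj, hj'⟩ := cs.exists_eraseIdx_of_isRightDescent h
  rw [List.length_reverse] at hj
  refine ⟨ω.length - 1 - j, by omega, ?_⟩
  have h1 := congrArg (·⁻¹) hj'
  simp only [wordProd_reverse, mul_inv_rev, inv_simple, inv_inv] at h1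
  rw [h1, ← wordProd_reverse]
  congr 1
  rw [List.eraseIdx_eq_take_drop_succ, List.eraseIdx_eq_take_drop_succ, List.reverse_append,
    List.take_reverse, List.drop_reverse, List.reverse_reverse, List.reverse_reverse]
  congr 2 <;> omega

end CoxeterSystem

end

noncomputable section

/-! ### The geometric representation and the order of a product of two simple reflections -/

namespace CoxeterMatrix

open Polynomial.Chebyshev Module

variable {B : Type*} (M : CoxeterMatrix B)

/-- The linear form on the free real vector space on `B` with value `-2 cos (π / m_{i,j})` at the
basis vector of `j`. -/
def geomForm (i : B) : Dual ℝ (B →₀ ℝ) :=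
  -- An infinite $m_{i,j}$ is encoded as 0, and division by zero gives $\cos 0=1$, hence the value
  -- $-2$, which is the correct one for an infinite bond.
  Finsupp.linearCombination ℝ fun j => -2 * Real.cos (Real.pi / M i j)

theorem geomForm_single (i j : B) :
    M.geomForm i (Finsupp.single j 1) = -2 * Real.cos (Real.pi / M i j) := by
  simp [geomForm]

theorem geomForm_single_self (i : B) : M.geomForm i (Finsupp.single i 1) = 2 := by
  simp [geomForm_single]

/-- The reflection of the geometric representation. -/
def geomReflection (i : B) : (B →₀ ℝ) ≃ₗ[ℝ] (B →₀ ℝ) :=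
  Module.reflection (M.geomForm_single_self i)

/-- With $t=2\cos(2\pi/m)$ the product of the two off-diagonal entries is $t+2$. At this $t$ the
Chebyshev polynomials `S` give the coefficients of the powers of a product of two reflections. -/
theorem geomForm_mul_geomForm (i j : B) :
    2 * Real.cos (2 * Real.pi / M i j) =
      M.geomForm i (Finsupp.single j 1) * M.geomForm j (Finsupp.single i 1) - 2 := by
  rw [geomForm_single, geomForm_single, M.symmetric j i, mul_div_assoc, Real.cos_two_mul]
  ring

theorem sin_two_pi_div_pos {m : ℕ} (hm : 3 ≤ m) : 0 < Real.sin (2 * Real.pi / m) := by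
  have hm' : (3 : ℝ) ≤ m := by exact_mod_cast hm
  apply Real.sin_pos_of_pos_of_lt_pi
  · positivity
  · rw [div_lt_iff₀ (by positivity)]
    nlinarith [Real.pi_pos]

/-- With $\theta=2\pi/m$ one has $S_n(2\cos\theta)\sin\theta=\sin((n+1)\theta)$. In the formula for
the $m$-th power each correction term contains $S_{m/2-1}$ for even $m$, which vanishes, or
$S_k+S_{k-1}$ with $m=2k+1$, which vanishes by $\sin(2\pi-x)=-\sin x$. -/
theorem geomReflection_isLiftable : M.IsLiftable M.geomReflection := by
  intro i j
  rcases eq_or_ne i j with rfl | hij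
  · rw [M.diagonal, pow_one]
    ext1 z
    exact Module.involutive_reflection (M.geomForm_single_self i) z
  have h1 := M.off_diagonal i j hij
  -- The case $m=2$ is separate because $\sin(2\pi/m)=0$ there and cannot be cancelled.
  obtain h0 | h2 | h3 : M i j = 0 ∨ M i j = 2 ∨ 3 ≤ M i j := by omega
  · rw [h0, pow_zero]
  · rw [h2]
    apply LinearEquiv.ext
    intro z
    have ha : M.geomForm i (Finsupp.single j 1) = 0 := by simp [geomForm_single, h2]
    have hb : M.geomForm j (Finsupp.single i 1) = 0 := by
      simp [geomForm_single, M.symmetric j i, h2]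
    simp only [pow_two, LinearEquiv.mul_apply, geomReflection, Module.reflection_apply, map_sub,
      map_smul, ha, hb, geomForm_single_self, LinearEquiv.coe_one, id]
    module
  · apply LinearEquiv.ext
    intro z
    have hs := (sin_two_pi_div_pos h3).ne'
    have hS := fun n : ℤ => S_two_mul_real_cos (2 * Real.pi / M i j) n
    have hm : (M i j : ℝ) ≠ 0 := by
      have : M i j ≠ 0 := by omega
      exact_mod_cast this
    rw [geomReflection, geomReflection, Module.reflection_mul_reflection_pow_apply _ _ _ _ _
      (M.geomForm_mul_geomForm i j)]
    rcases Nat.even_or_odd' (M i j) with ⟨k, hk | hk⟩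
    · have e1 : ((M i j : ℤ) - 2) / 2 = k - 1 := by omega
      have e2 : ((M i j : ℤ) - 1) / 2 = k - 1 := by omega
      have h0 : (S ℝ ((k : ℤ) - 1)).eval (2 * Real.cos (2 * Real.pi / M i j)) = 0 := by
        have := hS (k - 1)
        have e : (((k - 1 : ℤ) : ℝ) + 1) * (2 * Real.pi / M i j) = Real.pi := by
          have : (M i j : ℝ) = 2 * k := by exact_mod_cast hk
          have hk0 : (k : ℝ) ≠ 0 := by
            rintro h
            simp [this, h] at hm
          push_cast
          rw [this]
          field_simp
          ring
        rw [e, Real.sin_pi] at this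
        exact (mul_eq_zero.1 this).resolve_right hs
      rw [e1, e2, h0]
      simp
    · have e1 : ((M i j : ℤ) - 2) / 2 = k - 1 := by omega
      have e2 : ((M i j : ℤ) - 1) / 2 = k := by omega
      have e3 : ((M i j : ℤ) - 3) / 2 = k - 1 := by omega
      have e4 : (M i j : ℤ) / 2 = k := by omega
      have h0 : (S ℝ (k : ℤ)).eval (2 * Real.cos (2 * Real.pi / M i j)) +
          (S ℝ ((k : ℤ) - 1)).eval (2 * Real.cos (2 * Real.pi / M i j)) = 0 := by
        have ha := hS k
        have hb := hS (k - 1)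
        have e : ((k : ℤ) + 1 : ℝ) * (2 * Real.pi / M i j) =
            2 * Real.pi - (((k - 1 : ℤ) : ℝ) + 1) * (2 * Real.pi / M i j) := by
          have : (M i j : ℝ) = 2 * k + 1 := by exact_mod_cast hk
          push_cast
          rw [this] at hm ⊢
          field_simp
          ring
        rw [e, Real.sin_two_pi_sub] at ha
        refine (mul_eq_zero.1 ?_).resolve_right hs
        rw [add_mul, ha, hb]
        ring
      rw [e1, e2, e3, e4, h0]
      simp

/-- Compare coefficients at the basis vector of `i`. For $m\ge3$ they give $S_{k-1}=0$ and $S_k=1$,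
that is $\sin k\theta=0$ and $\cos k\theta=1$ for $\theta=2\pi/m$, so $m\mid k$. For infinite $m$
the value $S_{k-1}(2)=k$ must vanish; for $m=2$ the values at $-2$ force $k$ to be even. -/
theorem dvd_of_geomReflection_pow {i j : B} {k : ℕ}
    (h : (M.geomReflection i * M.geomReflection j) ^ k = 1) : M i j ∣ k := by
  rcases eq_or_ne i j with rfl | hij
  · simp
  have h1 := M.off_diagonal i j hij
  have key := congrArg (fun g : (B →₀ ℝ) ≃ₗ[ℝ] (B →₀ ℝ) => g (Finsupp.single i 1)) h
  simp only [geomReflection] at key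
  rw [Module.reflection_mul_reflection_pow_apply_self _ _ _ _ (M.geomForm_mul_geomForm i j)] at key
  have ki := congrArg (fun v : B →₀ ℝ => v i) key
  have kj := congrArg (fun v : B →₀ ℝ => v j) key
  simp [hij, hij.symm, geomForm_single, M.symmetric j i] at ki kj
  obtain h0 | h2 | h3 : M i j = 0 ∨ M i j = 2 ∨ 3 ≤ M i j := by omega
  · simp [h0, S_eval_two] at kj
    simp [h0, kj]
  · simp [h2, S_eval_neg_two] at ki
    rw [h2]
    rcases Nat.even_or_odd' k with ⟨n, rfl | rfl⟩
    · exact dvd_mul_right 2 n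
    · have e : (((2 * n + 1 : ℕ) : ℤ) - 1).natAbs = 2 * n := by omega
      rw [e, pow_succ, pow_mul] at ki
      push_cast at ki
      norm_num at ki
      linarith
  · have hs := (sin_two_pi_div_pos h3).ne'
    have hm : (M i j : ℝ) ≠ 0 := by
      have : M i j ≠ 0 := by omega
      exact_mod_cast this
    have hc : Real.cos (Real.pi / M i j) ≠ 0 := by
      have hm' : (3 : ℝ) ≤ M i j := by exact_mod_cast h3
      apply (Real.cos_pos_of_mem_Ioo ⟨?_, ?_⟩).ne'
      · have : 0 < Real.pi / M i j := by positivity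
        linarith [Real.pi_pos]
      · rw [div_lt_iff₀ (by positivity)]
        nlinarith [Real.pi_pos]
    have hS := fun n : ℤ => S_two_mul_real_cos (2 * Real.pi / M i j) n
    have h0 := kj.resolve_right hc
    rw [h0, add_zero] at ki
    have ha := hS (k - 1)
    have hb := hS k
    rw [h0] at ha
    rw [ki] at hb
    push_cast at ha hb
    rw [add_mul, Real.sin_add] at hb
    simp only [zero_mul, sub_add_cancel] at ha
    rw [← ha] at hb
    simp only [one_mul, zero_mul, zero_add] at hb
    have hcos : Real.cos (k * (2 * Real.pi / M i j)) = 1 := by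
      field_simp at hb ⊢
      linarith
    obtain ⟨n, hn⟩ := (Real.cos_eq_one_iff _).1 hcos
    have : (n : ℝ) * M i j = k := by
      field_simp at hn
      linarith
    have : n * M i j = (k : ℤ) := by exact_mod_cast this
    exact Int.natCast_dvd_natCast.1 ⟨n, by rw [← this, mul_comm]⟩

end CoxeterMatrix

namespace CoxeterSystem

variable {B W : Type*} [Group W] {M : CoxeterMatrix B} (cs : CoxeterSystem M W)

theorem dvd_of_simple_mul_simple_pow {i j : B} {k : ℕ}
    (h : (cs.simple i * cs.simple j) ^ k = 1) : M i j ∣ k := by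
  apply M.dvd_of_geomReflection_pow
  have := congrArg (cs.lift ⟨_, M.geomReflection_isLiftable⟩) h
  simpa [map_pow, map_mul, cs.lift_apply_simple] using this

theorem simple_injective : Function.Injective cs.simple := by
  intro i j h
  by_contra hij
  have := cs.dvd_of_simple_mul_simple_pow (i := i) (j := j) (k := 1) (by rw [h]; simp)
  exact M.off_diagonal i j hij (Nat.dvd_one.1 this)

end CoxeterSystem

end

noncomputable section

namespace CoxeterSystem

variable {B W : Type*} [Group W] {M : CoxeterMatrix B} (cs : CoxeterSystem M W)

/-! ### Reduced words -/

variable {cs} in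
theorem isReduced_cons_iff {i : B} {ω : List B} :
    cs.IsReduced (i :: ω) ↔ cs.IsReduced ω ∧ ¬ cs.IsLeftDescent (cs.wordProd ω) i := by
  constructor
  · intro h
    have h' : cs.IsReduced ω := h.drop 1
    refine ⟨h', ?_⟩
    have := h.eq
    rw [wordProd_cons] at this
    rw [not_isLeftDescent_iff, this, h'.eq, List.length_cons]
  · rintro ⟨h, h'⟩
    rw [not_isLeftDescent_iff] at h'
    rw [IsReduced, wordProd_cons, h', h.eq, List.length_cons]

variable {cs} in
theorem isReduced_append_singleton_iff {i : B} {ω : List B} :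
    cs.IsReduced (ω ++ [i]) ↔ cs.IsReduced ω ∧ ¬ cs.IsRightDescent (cs.wordProd ω) i := by
  rw [← isReduced_reverse_iff, List.reverse_append, List.reverse_singleton, List.singleton_append,
    isReduced_cons_iff, isReduced_reverse_iff, wordProd_reverse, isLeftDescent_inv_iff]

variable {cs} in
theorem IsReduced.of_append_left {ω ω' : List B} (h : cs.IsReduced (ω ++ ω')) :
    cs.IsReduced ω := by
  simpa using h.take ω.length

variable {cs} in
theorem IsReduced.of_append_right {ω ω' : List B} (h : cs.IsReduced (ω ++ ω')) :
    cs.IsReduced ω' := by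
  simpa using h.drop ω.length

/-- The deletion condition. -/
theorem exists_sublist_isReduced (ω : List B) :
    ∃ η : List B, η.Sublist ω ∧ cs.IsReduced η ∧ cs.wordProd η = cs.wordProd ω := by
  induction ω with
  | nil => exact ⟨[], List.Sublist.refl _, by simp [IsReduced], rfl⟩
  | cons i ω ih =>
    obtain ⟨η, h1, h2, h3⟩ := ih
    by_cases hd : cs.IsLeftDescent (cs.wordProd η) i
    · obtain ⟨j, hj, hj'⟩ := cs.exists_eraseIdx_of_isLeftDescent hd
      refine ⟨η.eraseIdx j, ((List.eraseIdx_sublist _ _).trans h1).cons _, ?_, ?_⟩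
      · rw [isLeftDescent_iff, h2.eq] at hd
        rw [IsReduced, ← hj', List.length_eraseIdx_of_lt hj]
        omega
      · rw [← hj', h3, wordProd_cons]
    · exact ⟨i :: η, h1.cons_cons _, isReduced_cons_iff.2 ⟨h2, hd⟩, by
        rw [wordProd_cons, wordProd_cons, h3]⟩

/-- Every entry of a repetition-free inversion sequence occurs with odd parity, hence occurs also in
the sequence of a reduced word of the same element. That word is therefore at least as long. -/
theorem isReduced_of_nodup_leftInvSeq {ω : List B} (h : (cs.leftInvSeq ω).Nodup) :
    cs.IsReduced ω := by
  classical
  rw [← isReduced_reverse_iff]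
  replace h : (cs.rightInvSeq ω.reverse).Nodup := by
    rwa [rightInvSeq_reverse, List.nodup_reverse]
  generalize ω.reverse = ω at h
  obtain ⟨η, h1, h2⟩ := cs.exists_isReduced (cs.wordProd ω)
  have hsub : cs.rightInvSeq ω ⊆ cs.rightInvSeq η := by
    intro x hx
    have := cs.count_rightInvSeq_eq h2 x
    rw [List.count_eq_one_of_mem h hx] at this
    by_contra hx'
    rw [List.count_eq_zero_of_not_mem hx'] at this
    simp at this
  have hle := (h.subperm hsub).length_le
  rw [length_rightInvSeq, length_rightInvSeq] at hle
  refine le_antisymm (cs.length_wordProd_le ω) ?_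
  rwa [h2, h1.eq]

/-- The entries of the left inversion sequence are $s_i(s_js_i)^c$ for $c<k$ (or the same with `i`
and `j` exchanged), and they are distinct since the order of $s_is_j$ is exactly $m_{i,j}$. The word
is treated as an initial segment of one of even length; the parity of `k` decides with which letter
that one starts. -/
theorem isReduced_alternatingWord {i j : B} {k : ℕ} (hk : M i j = 0 ∨ k ≤ M i j) :
    cs.IsReduced (alternatingWord i j k) := by
  have key (i j : B) (hk : M i j = 0 ∨ k ≤ M i j) :
      cs.IsReduced ((alternatingWord i j (2 * (k + 1))).take k) := by
    apply cs.isReduced_of_nodup_leftInvSeq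
    rw [leftInvSeq_take, List.nodup_iff_injective_get]
    intro a b hab
    have ha := a.2
    have hb := b.2
    simp only [List.length_take, length_leftInvSeq, length_alternatingWord] at ha hb
    have hg (c : Fin ((cs.leftInvSeq (alternatingWord i j (2 * (k + 1)))).take k).length) :
        ((cs.leftInvSeq (alternatingWord i j (2 * (k + 1)))).take k).get c =
          cs.simple i * (cs.simple j * cs.simple i) ^ (c : ℕ) := by
      have hc := c.2
      simp only [List.length_take, length_leftInvSeq, length_alternatingWord] at hc
      rw [List.get_eq_getElem, List.getElem_take,
        getElem_leftInvSeq_alternatingWord _ _ _ _ _ (by omega), prod_alternatingWord_eq_mul_pow,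
        if_neg (by simp [parity_simps]), show (2 * (c : ℕ) + 1) / 2 = c by omega]
    rw [hg, hg, mul_right_inj] at hab
    have aux {a b : ℕ} (hlt : a ≤ b) (hb : b < k)
        (hab : (cs.simple j * cs.simple i) ^ a = (cs.simple j * cs.simple i) ^ b) : a = b := by
      obtain ⟨c, rfl⟩ := Nat.exists_eq_add_of_le hlt
      rw [pow_add, left_eq_mul] at hab
      have hd := cs.dvd_of_simple_mul_simple_pow hab
      rw [M.symmetric] at hd
      rcases hk with hk | hk
      · rw [hk, Nat.zero_dvd] at hd
        omega
      · rcases Nat.eq_zero_or_pos c with rfl | hc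
        · rfl
        · have := Nat.le_of_dvd hc hd
          omega
    apply Fin.ext
    rcases le_total (a : ℕ) b with h | h
    · exact aux h (by omega) hab
    · exact (aux h (by omega) hab.symm).symm
  by_cases he : Even k
  · have := key i j hk
    rwa [listTake_alternatingWord _ _ _ _ (by omega), if_pos he] at this
  · have := key j i (by rwa [M.symmetric])
    rwa [listTake_alternatingWord _ _ _ _ (by omega), if_neg he] at this

/-! ### Matsumoto's theorem -/

theorem alternatingWord_succ_append (i j : B) (k : ℕ) :
    alternatingWord i j (k + 1) = alternatingWord j i k ++ [j] := by
  rw [alternatingWord_succ, List.concat_eq_append]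

/-- Exchange with the descent that is not the last letter lengthens the alternating tail by one
letter. The deleted letter cannot lie in the tail, for the tail with the new letter appended is
still reduced as long as its length is at most $m_{i,j}$. -/
theorem exists_append_alternatingWord {w : W} {i j : B} (hi : cs.IsRightDescent w i)
    (hj : cs.IsRightDescent w j) (k : ℕ) (hk : M i j = 0 ∨ k ≤ M i j) :
    ∃ c : List B, cs.IsReduced (c ++ alternatingWord i j k) ∧
      cs.wordProd (c ++ alternatingWord i j k) = w := by
  induction k generalizing i j with
  | zero =>
    obtain ⟨c, h1, h2⟩ := cs.exists_isReduced w
    exact ⟨c, by simpa [alternatingWord] using h1, by simp [alternatingWord, h2]⟩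
  | succ k ih =>
    obtain ⟨c, h1, h2⟩ := ih hj hi (by rw [M.symmetric]; omega)
    have hj' := hj
    rw [← h2] at hj'
    obtain ⟨p, hp, hp'⟩ := cs.exists_eraseIdx_of_isRightDescent hj'
    rcases lt_or_ge p c.length with hpc | hpc
    · rw [List.eraseIdx_append_of_lt_length hpc] at hp'
      have hw : cs.wordProd (c.eraseIdx p ++ alternatingWord i j (k + 1)) = w := by
        rw [alternatingWord_succ_append, ← List.append_assoc, wordProd_append _ _ [j], ← hp',
          wordProd_singleton, simple_mul_simple_cancel_right, h2]
      refine ⟨c.eraseIdx p, ?_, hw⟩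
      rw [IsReduced, hw, ← h2, h1.eq]
      simp only [List.length_append, length_alternatingWord, List.length_eraseIdx_of_lt hpc]
      omega
    · exfalso
      rw [List.eraseIdx_append_of_length_le hpc, wordProd_append, wordProd_append, mul_assoc,
        mul_right_inj, ← wordProd_singleton, ← wordProd_append, ← alternatingWord_succ_append] at hp'
      have h3 := (cs.isReduced_alternatingWord hk).eq
      rw [hp'] at h3
      have h4 := cs.length_wordProd_le ((alternatingWord j i k).eraseIdx (p - c.length))
      rw [List.length_append, length_alternatingWord] at hp
      rw [List.length_eraseIdx_of_lt (by rw [length_alternatingWord]; omega),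
        length_alternatingWord] at h4
      rw [length_alternatingWord] at h3
      omega

theorem coxeterMatrix_ne_zero_of_isRightDescent {w : W} {i j : B} (hi : cs.IsRightDescent w i)
    (hj : cs.IsRightDescent w j) : M i j ≠ 0 := by
  intro h0
  obtain ⟨c, h1, h2⟩ := cs.exists_append_alternatingWord hi hj (cs.length w + 1) (Or.inl h0)
  have := h1.eq
  rw [h2, List.length_append, length_alternatingWord] at this
  omega

/-- Matsumoto's theorem: a family of elements of a monoid that satisfies the braid relations has
the same product over any two reduced words of the same element. -/
theorem prod_map_eq_of_isReduced {G : Type*} [Monoid G] {f : B → G}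
    (hf : ∀ i j, ((alternatingWord i j (M i j)).map f).prod =
      ((alternatingWord j i (M i j)).map f).prod)
    {ω ω' : List B} (hω : cs.IsReduced ω) (hω' : cs.IsReduced ω')
    (h : cs.wordProd ω = cs.wordProd ω') : (ω.map f).prod = (ω'.map f).prod := by
  induction hn : ω.length generalizing ω ω' with
  | zero =>
    have h' : ω'.length = 0 := by rw [← hω'.eq, ← h, hω.eq, hn]
    rw [List.length_eq_zero_iff] at hn h'
    rw [hn, h']
  | succ n ih =>
    have h' : ω'.length = n + 1 := by rw [← hω'.eq, ← h, hω.eq, hn]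
    obtain ⟨ω₁, i, rfl⟩ : ∃ ω₁ i, ω = ω₁ ++ [i] :=
      ⟨_, _, (List.dropLast_append_getLast (List.ne_nil_of_length_eq_add_one hn)).symm⟩
    obtain ⟨ω₂, j, rfl⟩ : ∃ ω₁ i, ω' = ω₁ ++ [i] :=
      ⟨_, _, (List.dropLast_append_getLast (List.ne_nil_of_length_eq_add_one h')).symm⟩
    simp only [List.length_append, List.length_singleton, Nat.add_right_cancel_iff] at hn h'
    have key (η η' : List B) (a : B) (hη : cs.IsReduced (η ++ [a])) (hη' : cs.IsReduced (η' ++ [a]))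
        (h : cs.wordProd (η ++ [a]) = cs.wordProd (η' ++ [a])) (hn : η.length = n) :
        ((η ++ [a]).map f).prod = ((η' ++ [a]).map f).prod := by
      rw [wordProd_append, wordProd_append, mul_left_inj] at h
      rw [List.map_append, List.prod_append, List.map_append, List.prod_append,
        ih hη.of_append_left hη'.of_append_left h hn]
    rcases eq_or_ne i j with rfl | hij
    · exact key _ _ _ hω hω' h hn
    have hdesc (η : List B) (a : B) (hη : cs.IsReduced (η ++ [a])) :
        cs.IsRightDescent (cs.wordProd (η ++ [a])) a := by
      rw [isRightDescent_iff_not_isRightDescent_mul, wordProd_append, wordProd_singleton,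
        simple_mul_simple_cancel_right]
      exact (isReduced_append_singleton_iff.1 hη).2
    have di := hdesc ω₁ i hω
    have dj := hdesc ω₂ j hω'
    rw [← h] at dj
    obtain ⟨m, hm⟩ : ∃ m, M i j = m + 1 :=
      Nat.exists_eq_succ_of_ne_zero (cs.coxeterMatrix_ne_zero_of_isRightDescent di dj)
    -- Words that end in different letters are compared through two reduced words with the common
    -- beginning `c` and the two alternating tails of length $m_{i,j}$. Each of these shares its
    -- last letter with one of the given words, so the induction applies, and the tails are
    -- exchanged by the braid relation.
    obtain ⟨c, h1, h2⟩ := cs.exists_append_alternatingWord di dj (M i j) (Or.inr le_rfl)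
    have hb : cs.wordProd (alternatingWord i j (M i j)) = cs.wordProd (alternatingWord j i (M i j)) := by
      have := cs.wordProd_braidWord_eq i j
      rwa [braidWord, braidWord, M.symmetric j i] at this
    have h2' : cs.wordProd (c ++ alternatingWord j i (M i j)) = cs.wordProd (ω₁ ++ [i]) := by
      rw [← h2, wordProd_append, wordProd_append, hb]
    have h1' : cs.IsReduced (c ++ alternatingWord j i (M i j)) := by
      rw [IsReduced, h2', ← h2, h1.eq]
      simp
    have hff := hf i j
    have e1 : ((ω₁ ++ [i]).map f).prod = ((c ++ alternatingWord j i (M i j)).map f).prod := by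
      rw [hm, alternatingWord_succ_append, ← List.append_assoc] at h1' h2' ⊢
      exact key _ _ _ hω h1' h2'.symm hn
    have e2 : ((ω₂ ++ [j]).map f).prod = ((c ++ alternatingWord i j (M i j)).map f).prod := by
      rw [hm, alternatingWord_succ_append, ← List.append_assoc] at h1 h2 ⊢
      exact key _ _ _ hω' h1 (h.symm.trans h2.symm) h'
    rw [e1, e2, List.map_append, List.prod_append, List.map_append, List.prod_append, hff]

/-! ### Products of subwords -/

/-- The set of the products of all sublists of a word. -/
def subwordProds (ω : List B) : Set W := {w | ∃ η : List B, η.Sublist ω ∧ cs.wordProd η = w}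

theorem one_mem_subwordProds (ω : List B) : 1 ∈ cs.subwordProds ω :=
  ⟨[], List.nil_sublist ω, cs.wordProd_nil⟩

theorem mem_subwordProds_iff {ω : List B} {w : W} : w ∈ cs.subwordProds ω ↔
    ∃ η : List B, η.Sublist ω ∧ cs.IsReduced η ∧ cs.wordProd η = w := by
  constructor
  · rintro ⟨η, h1, rfl⟩
    obtain ⟨η', h2, h3, h4⟩ := cs.exists_sublist_isReduced η
    exact ⟨η', h2.trans h1, h3, h4⟩
  · rintro ⟨η, h1, -, h2⟩
    exact ⟨η, h1, h2⟩

theorem mem_subwordProds_cons {i : B} {ω : List B} {w : W} : w ∈ cs.subwordProds (i :: ω) ↔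
    w ∈ cs.subwordProds ω ∨ cs.simple i * w ∈ cs.subwordProds ω := by
  constructor
  · rintro ⟨η, h, rfl⟩
    cases h with
    | cons _ h => exact Or.inl ⟨η, h, rfl⟩
    | cons_cons _ h => exact Or.inr ⟨_, h, by rw [wordProd_cons, simple_mul_simple_cancel_left]⟩
  · rintro (⟨η, h, rfl⟩ | ⟨η, h, hw⟩)
    · exact ⟨η, h.cons _, rfl⟩
    · exact ⟨i :: η, h.cons_cons _, by rw [wordProd_cons, hw, simple_mul_simple_cancel_left]⟩

theorem simple_mul_mem_subwordProds_cons {i : B} {ω : List B} {w : W}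
    (h : w ∈ cs.subwordProds (i :: ω)) : cs.simple i * w ∈ cs.subwordProds (i :: ω) := by
  rw [mem_subwordProds_cons] at h ⊢
  rw [simple_mul_simple_cancel_left]
  exact h.symm

theorem simple_mul_mem_subwordProds {i : B} {ω : List B} {w : W} (h : w ∈ cs.subwordProds ω)
    (hd : cs.IsLeftDescent w i) : cs.simple i * w ∈ cs.subwordProds ω := by
  obtain ⟨η, h1, rfl⟩ := h
  obtain ⟨j, -, hj⟩ := cs.exists_eraseIdx_of_isLeftDescent hd
  exact ⟨η.eraseIdx j, (List.eraseIdx_sublist _ _).trans h1, hj.symm⟩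

-- Writing the set of subword products as a product in the monoid of subsets of `W` makes
-- Matsumoto's theorem applicable to it. The braid relation for the factors $\{1,s_i\}$ holds
-- because both sides are the whole dihedral subgroup. This makes the set independent of the reduced
-- word (`subwordProds_eq_of_isReduced`).
open scoped Pointwise in
theorem prod_map_pair_eq (ω : List B) :
    (ω.map fun i => ({1, cs.simple i} : Set W)).prod = cs.subwordProds ω := by
  induction ω with
  | nil =>
    ext w
    simp [subwordProds, eq_comm]
  | cons i ω ih =>
    ext w
    rw [List.map_cons, List.prod_cons, ih, mem_subwordProds_cons, Set.mem_mul]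
    constructor
    · rintro ⟨a, rfl | rfl, b, hb, rfl⟩
      · simpa using Or.inl hb
      · right
        simpa using hb
    · rintro (h | h)
      · exact ⟨1, by simp, w, h, by simp⟩
      · exact ⟨cs.simple i, by simp, _, h, by simp⟩

/-- The elements of a dihedral parabolic subgroup, as products of alternating words. -/
def dihedralSet (i j : B) : Set W :=
  {w | ∃ k ≤ M i j, w = cs.wordProd (alternatingWord i j k) ∨ w = cs.wordProd (alternatingWord j i k)}

theorem dihedralSet_comm (i j : B) : cs.dihedralSet i j = cs.dihedralSet j i := by
  ext w
  simp only [dihedralSet, M.symmetric j i, Set.mem_ofPred_eq, or_comm]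

theorem mul_simple_mem_dihedralSet {i j : B} (h0 : M i j ≠ 0) {w : W}
    (hw : w ∈ cs.dihedralSet i j) : w * cs.simple j ∈ cs.dihedralSet i j := by
  have hb : cs.wordProd (alternatingWord i j (M i j)) =
      cs.wordProd (alternatingWord j i (M i j)) := by
    have := cs.wordProd_braidWord_eq i j
    rwa [braidWord, braidWord, M.symmetric j i] at this
  have succ (k : ℕ) : cs.wordProd (alternatingWord i j (k + 1)) =
      cs.wordProd (alternatingWord j i k) * cs.simple j := by
    rw [alternatingWord_succ_append, wordProd_append, wordProd_singleton]
  have key (k : ℕ) (hk : k ≤ M i j) :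
      cs.wordProd (alternatingWord i j k) * cs.simple j ∈ cs.dihedralSet i j := by
    cases k with
    | zero => exact ⟨1, by omega, Or.inl (by simp [alternatingWord])⟩
    | succ k => exact ⟨k, by omega, Or.inr (by rw [succ, simple_mul_simple_cancel_right])⟩
  obtain ⟨k, hk, rfl | rfl⟩ := hw
  · exact key k hk
  · rcases hk.lt_or_eq with hk | rfl
    · exact ⟨k + 1, hk, Or.inl (succ k).symm⟩
    · rw [← hb]
      exact key _ le_rfl

theorem wordProd_mem_dihedralSet {i j : B} (h0 : M i j ≠ 0) {ω : List B}
    (hω : ∀ a ∈ ω, a = i ∨ a = j) : cs.wordProd ω ∈ cs.dihedralSet i j := by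
  induction ω using List.reverseRecOn with
  | nil => exact ⟨0, by simp, Or.inl (by simp [alternatingWord])⟩
  | append_singleton ω a ih =>
    rw [wordProd_append, wordProd_singleton]
    have ih' := ih fun b hb => hω b (by simp [hb])
    rcases hω a (by simp) with rfl | rfl
    · rw [dihedralSet_comm] at ih' ⊢
      exact cs.mul_simple_mem_dihedralSet (by rwa [M.symmetric]) ih'
    · exact cs.mul_simple_mem_dihedralSet h0 ih'

theorem mem_alternatingWord {i j a : B} {k : ℕ} (h : a ∈ alternatingWord i j k) :
    a = i ∨ a = j := by
  induction k generalizing i j with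
  | zero => simp [alternatingWord] at h
  | succ k ih =>
    rw [alternatingWord_succ_append, List.mem_append, List.mem_singleton] at h
    rcases h with h | h
    · exact (ih h).symm
    · exact Or.inr h

theorem alternatingWord_suffix (i j : B) {k l : ℕ} (h : k ≤ l) :
    alternatingWord i j k <:+ alternatingWord i j l := by
  induction l, h using Nat.le_induction with
  | base => exact List.suffix_rfl
  | succ l _ ih =>
    rw [alternatingWord_succ']
    exact ih.trans (List.suffix_cons _ _)

theorem subwordProds_alternatingWord {i j : B} (h0 : M i j ≠ 0) :
    cs.subwordProds (alternatingWord i j (M i j)) = cs.dihedralSet i j := by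
  ext w
  constructor
  · rintro ⟨η, h, rfl⟩
    exact cs.wordProd_mem_dihedralSet h0 fun a ha => mem_alternatingWord (h.subset ha)
  · rintro ⟨k, hk, rfl | rfl⟩
    · exact ⟨_, (alternatingWord_suffix i j hk).sublist, rfl⟩
    · rcases hk.lt_or_eq with hk | rfl
      · refine ⟨_, List.Sublist.trans ?_ (alternatingWord_suffix i j hk).sublist, rfl⟩
        rw [Nat.succ_eq_add_one, alternatingWord_succ_append]
        exact List.sublist_append_left _ _
      · refine ⟨_, List.Sublist.refl _, ?_⟩
        have := cs.wordProd_braidWord_eq i j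
        rwa [braidWord, braidWord, M.symmetric j i] at this

theorem subwordProds_eq_of_isReduced {ω ω' : List B} (hω : cs.IsReduced ω)
    (hω' : cs.IsReduced ω') (h : cs.wordProd ω = cs.wordProd ω') :
    cs.subwordProds ω = cs.subwordProds ω' := by
  open scoped Pointwise in
  rw [← prod_map_pair_eq, ← prod_map_pair_eq]
  refine cs.prod_map_eq_of_isReduced (fun i j => ?_) hω hω' h
  rw [prod_map_pair_eq, prod_map_pair_eq]
  by_cases h0 : M i j = 0
  · simp [h0, alternatingWord]
  · rw [cs.subwordProds_alternatingWord h0, dihedralSet_comm, M.symmetric,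
      cs.subwordProds_alternatingWord (by rwa [M.symmetric])]

end CoxeterSystem

end

noncomputable section

namespace HeckeEndo

open CoxeterSystem

variable {B W : Type*} [Group W] {M : CoxeterMatrix B} {cs : CoxeterSystem M W}

/-! ### Parabolic subgroups -/

theorem simple_mem_parabolic {I : Finset B} {i : B} (hi : i ∈ I) :
    cs.simple i ∈ parabolic cs I :=
  Subgroup.subset_closure ⟨i, hi, rfl⟩

theorem wordProd_mem_parabolic {I : Finset B} {ω : List B} (h : ∀ a ∈ ω, a ∈ I) :
    cs.wordProd ω ∈ parabolic cs I := by
  induction ω with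
  | nil => simp [one_mem]
  | cons i ω ih =>
    rw [wordProd_cons]
    exact mul_mem (simple_mem_parabolic (h i (by simp))) (ih fun a ha => h a (by simp [ha]))

theorem exists_isReduced_of_mem_parabolic {I : Finset B} {w : W} (hw : w ∈ parabolic cs I) :
    ∃ ω : List B, cs.IsReduced ω ∧ (∀ a ∈ ω, a ∈ I) ∧ cs.wordProd ω = w := by
  suffices h : ∃ ω : List B, (∀ a ∈ ω, a ∈ I) ∧ cs.wordProd ω = w by
    obtain ⟨ω, h1, rfl⟩ := h
    obtain ⟨η, h2, h3, h4⟩ := cs.exists_sublist_isReduced ω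
    exact ⟨η, h3, fun a ha => h1 a (h2.subset ha), h4⟩
  induction hw using Subgroup.closure_induction with
  | mem x hx =>
    obtain ⟨i, hi, rfl⟩ := hx
    exact ⟨[i], by simpa using hi, by simp⟩
  | one => exact ⟨[], by simp, by simp⟩
  | mul x y _ _ hx hy =>
    obtain ⟨ω, h1, rfl⟩ := hx
    obtain ⟨η, h2, rfl⟩ := hy
    refine ⟨ω ++ η, fun a ha => ?_, by rw [wordProd_append]⟩
    rcases List.mem_append.1 ha with ha | ha
    · exact h1 a ha
    · exact h2 a ha
  | inv x _ hx =>
    obtain ⟨ω, h1, rfl⟩ := hx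
    exact ⟨ω.reverse, by simpa using h1, by rw [wordProd_reverse]⟩

theorem parabolic_mono {I J : Finset B} (h : I ⊆ J) : parabolic cs I ≤ parabolic cs J :=
  Subgroup.closure_mono (Set.image_mono (by exact_mod_cast h))

theorem mem_of_simple_mem_parabolic {I : Finset B} {i : B} (h : cs.simple i ∈ parabolic cs I) :
    i ∈ I := by
  obtain ⟨ω, h1, h2, h3⟩ := exists_isReduced_of_mem_parabolic h
  have hlen := h1.eq
  rw [h3, length_simple] at hlen
  obtain ⟨j, rfl⟩ := List.length_eq_one_iff.1 hlen.symm
  rw [wordProd_singleton] at h3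
  rw [← cs.simple_injective h3]
  exact h2 j (by simp)

/-- The letters of a reduced word of an element of a parabolic subgroup are among its
generators. -/
theorem mem_of_isReduced_of_mem_parabolic {I : Finset B} {ω : List B} (hω : cs.IsReduced ω)
    (h : cs.wordProd ω ∈ parabolic cs I) : ∀ a ∈ ω, a ∈ I := by
  induction ω with
  | nil => simp
  | cons i ω ih =>
    obtain ⟨η, h1, h2, h3⟩ := exists_isReduced_of_mem_parabolic h
    have hd : cs.IsLeftDescent (cs.wordProd η) i := by
      rw [h3, wordProd_cons, isLeftDescent_iff_not_isLeftDescent_mul,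
        simple_mul_simple_cancel_left]
      exact (isReduced_cons_iff.1 hω).2
    obtain ⟨j, -, hj⟩ := cs.exists_eraseIdx_of_isLeftDescent hd
    rw [h3] at hj
    have hmem : cs.simple i * cs.wordProd (i :: ω) ∈ parabolic cs I := by
      rw [hj]
      exact wordProd_mem_parabolic fun a ha => h2 a ((List.eraseIdx_sublist _ _).subset ha)
    have hi := mem_of_simple_mem_parabolic ((Subgroup.mul_mem_cancel_right _ h).1 hmem)
    rw [wordProd_cons, simple_mul_simple_cancel_left] at hmem
    intro a ha
    rcases List.mem_cons.1 ha with rfl | ha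
    · exact hi
    · exact ih (isReduced_cons_iff.1 hω).1 hmem a ha

/-- If `u` has minimal length in its coset modulo a parabolic subgroup, then lengths add up. -/
theorem length_mul_of_minimal {I : Finset B} {u : W}
    (hu : ∀ v ∈ parabolic cs I, cs.length u ≤ cs.length (u * v)) {v : W}
    (hv : v ∈ parabolic cs I) : cs.length (u * v) = cs.length u + cs.length v := by
  obtain ⟨ω, h1, h2, rfl⟩ := exists_isReduced_of_mem_parabolic hv
  clear hv
  induction ω using List.reverseRecOn with
  | nil => simp
  | append_singleton ω i ih =>
    have hω := isReduced_append_singleton_iff.1 h1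
    have h2' : ∀ a ∈ ω, a ∈ I := fun a ha => h2 a (by simp [ha])
    have ih' := ih hω.1 h2'
    rw [wordProd_append, wordProd_singleton, ← mul_assoc, cs.not_isRightDescent_iff.1 hω.2,
      ← add_assoc, ← ih', ← cs.not_isRightDescent_iff]
    intro hd
    obtain ⟨η, h3, h4⟩ := cs.exists_isReduced u
    rw [h4, ← wordProd_append] at hd
    obtain ⟨p, hp, hp'⟩ := cs.exists_eraseIdx_of_isRightDescent hd
    rw [wordProd_append, ← h4] at hp'
    -- A letter deleted from `η` would give a shorter element of the coset of `u`, and one deleted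
    -- from `ω` would contradict that `ω` followed by `i` is reduced.
    rcases lt_or_ge p η.length with hpη | hpη
    · rw [List.eraseIdx_append_of_lt_length hpη, wordProd_append] at hp'
      have h5 : cs.wordProd (η.eraseIdx p) =
          u * (cs.wordProd ω * cs.simple i * (cs.wordProd ω)⁻¹) := by
        rw [← mul_assoc, ← mul_assoc, hp', mul_inv_cancel_right]
      have h6 := hu _ (mul_mem (mul_mem (wordProd_mem_parabolic h2')
        (simple_mem_parabolic (h2 i (by simp)))) (inv_mem (wordProd_mem_parabolic h2')))
      rw [← h5] at h6
      have h7 := cs.length_wordProd_le (η.eraseIdx p)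
      have h8 := h3.eq
      rw [← h4] at h8
      rw [List.length_eraseIdx_of_lt hpη] at h7
      omega
    · rw [List.eraseIdx_append_of_length_le hpη, wordProd_append, ← h4, mul_assoc,
        mul_right_inj] at hp'
      have h5 := cs.length_wordProd_le (ω.eraseIdx (p - η.length))
      rw [← hp', cs.not_isRightDescent_iff.1 hω.2, hω.1.eq, List.length_eraseIdx] at h5
      split_ifs at h5 <;> omega

/-! ### Longest elements -/

theorem exists_isLongest (I : Finitary cs) : ∃ w, IsLongest cs I w := by
  obtain ⟨w, hw⟩ := Finite.exists_max fun w : parabolic cs I.1 => cs.length w.1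
  exact ⟨w.1, w.2, fun v hv => hw ⟨v, hv⟩⟩

theorem IsLongest.isLeftDescent {I : Finitary cs} {w : W} (hw : IsLongest cs I w) {i : B}
    (hi : i ∈ I.1) : cs.IsLeftDescent w i :=
  lt_of_le_of_ne (hw.2 _ (mul_mem (simple_mem_parabolic hi) hw.1)) (cs.length_simple_mul_ne w i)

/-- Every element of a finite parabolic subgroup is the product of a sublist of any reduced word
of the longest element. -/
theorem IsLongest.subwordProds_eq {I : Finitary cs} {ω : List B} (hω : cs.IsReduced ω)
    (hw : IsLongest cs I (cs.wordProd ω)) : cs.subwordProds ω = parabolic cs I.1 := by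
  apply Set.Subset.antisymm
  · rintro _ ⟨η, h, rfl⟩
    exact wordProd_mem_parabolic fun a ha =>
      mem_of_isReduced_of_mem_parabolic hω hw.1 a (h.subset ha)
  · intro w hw'
    obtain ⟨η, -, h2, rfl⟩ := exists_isReduced_of_mem_parabolic hw'
    clear hw'
    induction η with
    | nil => simpa using cs.one_mem_subwordProds ω
    | cons i η ih =>
      have ih' := ih fun a ha => h2 a (by simp [ha])
      have hd := hw.isLeftDescent (h2 i (by simp))
      -- As `i` is a left descent, the longest element has a reduced word that starts with `i`. Its
      -- subword products are the same as those of `ω`, and they are visibly stable under left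
      -- multiplication by $s_i$.
      obtain ⟨ξ, h3, h4⟩ := cs.exists_isReduced (cs.simple i * cs.wordProd ω)
      have h5 : cs.wordProd ω = cs.wordProd (i :: ξ) := by
        rw [wordProd_cons, ← h4, simple_mul_simple_cancel_left]
      have h6 : cs.IsReduced (i :: ξ) := by
        rw [isReduced_cons_iff, ← h4, ← cs.isLeftDescent_iff_not_isLeftDescent_mul]
        exact ⟨h3, hd⟩
      rw [cs.subwordProds_eq_of_isReduced hω h6 h5] at ih' ⊢
      rw [wordProd_cons]
      exact cs.simple_mul_mem_subwordProds_cons ih'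

/-- Let $u$ be a shortest element of the coset $w_JW_I$, so that $w_J=uv^{-1}$ with $v\in W_I$.
Lengths add, hence $\ell(w_J)=\ell(u)+\ell(v^{-1})\le\ell(u)+\ell(w_I)=\ell(uw_I)$, and $uw_I$ is
longest too. -/
theorem IsLongest.exists_append {I J : Finitary cs} (h : I.1 ⊆ J.1) {ω : List B}
    (hω : cs.IsReduced ω) (hw : IsLongest cs I (cs.wordProd ω)) :
    ∃ η : List B, cs.IsReduced (η ++ ω) ∧ IsLongest cs J (cs.wordProd (η ++ ω)) := by
  obtain ⟨w, hw1, hw2⟩ := exists_isLongest J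
  obtain ⟨v, hv⟩ := Finite.exists_min fun v : parabolic cs I.1 => cs.length (w * v.1)
  set u := w * v.1 with hu
  have hmin : ∀ v' ∈ parabolic cs I.1, cs.length u ≤ cs.length (u * v') := by
    intro v' hv'
    rw [hu, mul_assoc]
    exact hv ⟨v.1 * v', mul_mem v.2 hv'⟩
  obtain ⟨η, h1, h2⟩ := cs.exists_isReduced u
  have hJ : u ∈ parabolic cs J.1 := mul_mem hw1 (parabolic_mono h v.2)
  have hlen := length_mul_of_minimal hmin hw.1
  have hlen' := length_mul_of_minimal hmin (inv_mem v.2)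
  rw [hu, mul_inv_cancel_right, ← hu] at hlen'
  have hle := hw.2 _ (inv_mem v.2)
  have hprod : cs.wordProd (η ++ ω) = u * cs.wordProd ω := by rw [wordProd_append, ← h2]
  refine ⟨η, ?_, ?_, fun x hx => ?_⟩
  · rw [CoxeterSystem.IsReduced, hprod, hlen, h2, h1.eq, hω.eq, List.length_append]
  · rw [hprod]
    exact mul_mem hJ (parabolic_mono h hw.1)
  · rw [hprod, hlen]
    have := hw2 x hx
    omega

theorem Adapted.isReduced_and_isLongest {I : Finitary cs} {F : ChainTo I} {ω : List B}
    (h : Adapted F ω) : cs.IsReduced ω ∧ IsLongest cs I (cs.wordProd ω) := by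
  cases F with
  | nil =>
    have h' : ω = [] := h
    subst h'
    refine ⟨by simp [CoxeterSystem.IsReduced], by simp [one_mem], fun v hv => ?_⟩
    have : v = 1 := by simpa [parabolic, emptySet] using hv
    simp [this]
  | cons F h' => exact ⟨h.1, h.2.1⟩

theorem exists_adapted {I : Finitary cs} (F : ChainTo I) : ∃ ω : List B, Adapted F ω := by
  induction F with
  | nil => exact ⟨[], rfl⟩
  | cons F h ih =>
    obtain ⟨ω, hω⟩ := ih
    obtain ⟨h1, h2⟩ := hω.isReduced_and_isLongest
    obtain ⟨η, h3, h4⟩ := h2.exists_append h.1 h1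
    exact ⟨η ++ ω, h3, h4, ω, List.suffix_append _ _, hω⟩

end HeckeEndo

end

/-! ### The Hecke algebra: the elements $x_I$, the basis $T_w$, expressions in the $x_s$. -/

noncomputable section

namespace HeckeEndo

open CoxeterSystem

variable {B W : Type*} [Group W] {M : CoxeterMatrix B} {cs : CoxeterSystem M W}

/-! ### The standard elements of the Hecke algebra -/

variable (cs) in
theorem heckeT_mul_self (s : B) :
    heckeT cs s * heckeT cs s = (q - 1) • heckeT cs s + q • (1 : Hecke cs) := by
  have := RingQuot.mkAlgHom_rel ℤ[X] (HeckeRel.quadratic (M := M) s)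
  simp only [map_mul, map_add, map_smul, map_one] at this
  exact this

variable (cs) in
theorem heckeT_braid (s t : B) :
    ((braidWord M s t).map (heckeT cs)).prod = ((braidWord M t s).map (heckeT cs)).prod := by
  have := RingQuot.mkAlgHom_rel ℤ[X] (HeckeRel.braid (M := M) s t)
  simp only [map_list_prod, List.map_map] at this
  exact this

/-- A family of elements of an algebra that satisfies the Hecke relations defines a homomorphism
from the Hecke algebra. -/
def heckeLift {A : Type*} [Ring A] [Algebra ℤ[X] A] (t : B → A)
    (hq : ∀ s, t s * t s = (q - 1) • t s + q • (1 : A))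
    (hb : ∀ i j, ((braidWord M i j).map t).prod = ((braidWord M j i).map t).prod) :
    Hecke cs →ₐ[ℤ[X]] A :=
  RingQuot.liftAlgHom ℤ[X] ⟨FreeAlgebra.lift ℤ[X] t, by
    intro a b h
    cases h with
    | quadratic s => simpa using hq s
    | braid i j =>
      simp only [map_list_prod, List.map_map, FreeAlgebra.ι_comp_lift]
      exact hb i j⟩

theorem heckeLift_heckeT {A : Type*} [Ring A] [Algebra ℤ[X] A] (t : B → A)
    (hq : ∀ s, t s * t s = (q - 1) • t s + q • (1 : A))
    (hb : ∀ i j, ((braidWord M i j).map t).prod = ((braidWord M j i).map t).prod) (s : B) :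
    heckeLift (cs := cs) t hq hb (heckeT cs s) = t s := by
  rw [heckeLift, heckeT]
  exact (RingQuot.liftAlgHom_mkAlgHom_apply _ _ _ _).trans (FreeAlgebra.lift_ι_apply _ _)

theorem isReduced_redWord (w : W) : cs.IsReduced (redWord cs w) :=
  (cs.exists_isReduced w).choose_spec.1

theorem wordProd_redWord (w : W) : cs.wordProd (redWord cs w) = w :=
  (cs.exists_isReduced w).choose_spec.2.symm

theorem redWord_one : redWord cs (1 : W) = [] := by
  have := (isReduced_redWord (cs := cs) 1).eq
  rw [wordProd_redWord, length_one] at this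
  exact List.length_eq_zero_iff.1 this.symm

theorem heckeTw_wordProd {ω : List B} (hω : cs.IsReduced ω) :
    heckeTw cs (cs.wordProd ω) = (ω.map (heckeT cs)).prod := by
  refine cs.prod_map_eq_of_isReduced (fun i j => ?_) (isReduced_redWord _) hω (wordProd_redWord _)
  have := heckeT_braid cs i j
  rwa [braidWord, braidWord, M.symmetric j i] at this

theorem heckeTw_one : heckeTw cs 1 = 1 := by
  simp [heckeTw, redWord_one]

theorem heckeT_mul_heckeTw_of_not_isLeftDescent {s : B} {w : W} (h : ¬ cs.IsLeftDescent w s) :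
    heckeT cs s * heckeTw cs w = heckeTw cs (cs.simple s * w) := by
  have hr : cs.IsReduced (s :: redWord cs w) := by
    rw [isReduced_cons_iff, wordProd_redWord]
    exact ⟨isReduced_redWord w, h⟩
  have := heckeTw_wordProd hr
  rw [wordProd_cons, wordProd_redWord] at this
  rw [this, List.map_cons, List.prod_cons, heckeTw]

theorem heckeT_mul_heckeTw_of_isLeftDescent {s : B} {w : W} (h : cs.IsLeftDescent w s) :
    heckeT cs s * heckeTw cs w = (q - 1) • heckeTw cs w + q • heckeTw cs (cs.simple s * w) := by
  have h1 := heckeT_mul_heckeTw_of_not_isLeftDescent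
    (cs.isLeftDescent_iff_not_isLeftDescent_mul.1 h)
  rw [simple_mul_simple_cancel_left] at h1
  nth_rw 1 [← h1]
  rw [← mul_assoc, heckeT_mul_self, add_mul, smul_mul_assoc, smul_mul_assoc, one_mul, h1]

theorem heckeTw_mul_heckeT_of_not_isRightDescent {s : B} {w : W} (h : ¬ cs.IsRightDescent w s) :
    heckeTw cs w * heckeT cs s = heckeTw cs (w * cs.simple s) := by
  have hr : cs.IsReduced (redWord cs w ++ [s]) := by
    rw [isReduced_append_singleton_iff, wordProd_redWord]
    exact ⟨isReduced_redWord w, h⟩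
  have := heckeTw_wordProd hr
  rw [wordProd_append, wordProd_redWord, wordProd_singleton] at this
  rw [this, List.map_append, List.prod_append, heckeTw]
  simp

theorem heckeTw_mul_heckeT_of_isRightDescent {s : B} {w : W} (h : cs.IsRightDescent w s) :
    heckeTw cs w * heckeT cs s = (q - 1) • heckeTw cs w + q • heckeTw cs (w * cs.simple s) := by
  have h1 := heckeTw_mul_heckeT_of_not_isRightDescent
    (cs.isRightDescent_iff_not_isRightDescent_mul.1 h)
  rw [simple_mul_simple_cancel_right] at h1
  nth_rw 1 [← h1]
  rw [mul_assoc, heckeT_mul_self, mul_add, mul_smul_comm, mul_smul_comm, mul_one, h1]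

-- Multiplication by $s$ permutes $W_I$ and interchanges the elements with and without the descent
-- $s$. After reindexing, the coefficient of $T_w$ is $(q-1)+1$ at a descent and $0+q$ otherwise.
open Classical in
theorem heckeT_mul_xI {I : Finitary cs} {s : B} (hs : s ∈ I.1) :
    heckeT cs s * xI I = q • xI I := by
  set s' : parabolic cs I.1 := ⟨cs.simple s, simple_mem_parabolic hs⟩ with hs'
  have h1 (w : W) : heckeT cs s * heckeTw cs w =
      (if cs.IsLeftDescent w s then q - 1 else 0) • heckeTw cs w +
        (if cs.IsLeftDescent w s then q else 1) • heckeTw cs (cs.simple s * w) := by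
    split_ifs with h
    · exact heckeT_mul_heckeTw_of_isLeftDescent h
    · rw [heckeT_mul_heckeTw_of_not_isLeftDescent h, zero_smul, zero_add, one_smul]
  have h2 : ∑ w : parabolic cs I.1, (if cs.IsLeftDescent w.1 s then q else 1) •
      heckeTw cs (cs.simple s * w.1) =
      ∑ w : parabolic cs I.1, (if cs.IsLeftDescent w.1 s then 1 else q) • heckeTw cs w.1 := by
    refine Fintype.sum_equiv (Equiv.mulLeft s') _ _ fun w => ?_
    have : cs.IsLeftDescent w.1 s ↔ ¬ cs.IsLeftDescent (cs.simple s * w.1) s :=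
      cs.isLeftDescent_iff_not_isLeftDescent_mul
    simp only [Equiv.coe_mulLeft, hs', Subgroup.coe_mul]
    by_cases hd : cs.IsLeftDescent w.1 s
    · rw [if_pos hd, if_neg (this.1 hd)]
    · rw [if_neg hd, if_pos (by tauto)]
  rw [xI, Finset.mul_sum, Finset.sum_congr rfl fun w _ => h1 w.1, Finset.sum_add_distrib, h2,
    ← Finset.sum_add_distrib, Finset.smul_sum]
  refine Finset.sum_congr rfl fun w _ => ?_
  rw [← add_smul]
  split_ifs <;> simp

open Classical in
theorem xI_mul_heckeT {I : Finitary cs} {s : B} (hs : s ∈ I.1) :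
    xI I * heckeT cs s = q • xI I := by
  set s' : parabolic cs I.1 := ⟨cs.simple s, simple_mem_parabolic hs⟩ with hs'
  have h1 (w : W) : heckeTw cs w * heckeT cs s =
      (if cs.IsRightDescent w s then q - 1 else 0) • heckeTw cs w +
        (if cs.IsRightDescent w s then q else 1) • heckeTw cs (w * cs.simple s) := by
    split_ifs with h
    · exact heckeTw_mul_heckeT_of_isRightDescent h
    · rw [heckeTw_mul_heckeT_of_not_isRightDescent h, zero_smul, zero_add, one_smul]
  have h2 : ∑ w : parabolic cs I.1, (if cs.IsRightDescent w.1 s then q else 1) •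
      heckeTw cs (w.1 * cs.simple s) =
      ∑ w : parabolic cs I.1, (if cs.IsRightDescent w.1 s then 1 else q) • heckeTw cs w.1 := by
    refine Fintype.sum_equiv (Equiv.mulRight s') _ _ fun w => ?_
    have : cs.IsRightDescent w.1 s ↔ ¬ cs.IsRightDescent (w.1 * cs.simple s) s :=
      cs.isRightDescent_iff_not_isRightDescent_mul
    simp only [Equiv.coe_mulRight, hs', Subgroup.coe_mul]
    by_cases hd : cs.IsRightDescent w.1 s
    · rw [if_pos hd, if_neg (this.1 hd)]
    · rw [if_neg hd, if_pos (by tauto)]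
  rw [xI, Finset.sum_mul, Finset.sum_congr rfl fun w _ => h1 w.1, Finset.sum_add_distrib, h2,
    ← Finset.sum_add_distrib, Finset.smul_sum]
  refine Finset.sum_congr rfl fun w _ => ?_
  rw [← add_smul]
  split_ifs <;> simp

theorem heckeTw_mul_xI {I : Finitary cs} {w : W} (hw : w ∈ parabolic cs I.1) :
    heckeTw cs w * xI I = q ^ cs.length w • xI I := by
  obtain ⟨ω, h1, h2, rfl⟩ := exists_isReduced_of_mem_parabolic hw
  rw [heckeTw_wordProd h1, h1.eq]
  clear hw h1
  induction ω with
  | nil => simp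
  | cons s ω ih =>
    rw [List.map_cons, List.prod_cons, mul_assoc, ih fun a ha => h2 a (by simp [ha]),
      mul_smul_comm, heckeT_mul_xI (h2 s (by simp)), smul_smul, List.length_cons, pow_succ]

theorem xI_mul_heckeTw {I : Finitary cs} {w : W} (hw : w ∈ parabolic cs I.1) :
    xI I * heckeTw cs w = q ^ cs.length w • xI I := by
  obtain ⟨ω, h1, h2, rfl⟩ := exists_isReduced_of_mem_parabolic hw
  rw [heckeTw_wordProd h1, h1.eq]
  clear hw h1
  induction ω with
  | nil => simp
  | cons s ω ih =>
    rw [List.map_cons, List.prod_cons, ← mul_assoc, xI_mul_heckeT (h2 s (by simp)),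
      smul_mul_assoc, ih fun a ha => h2 a (by simp [ha]), smul_smul, List.length_cons, pow_succ']

theorem xI_mul_xI_of_subset {I J : Finitary cs} (h : I.1 ⊆ J.1) :
    xI I * xI J = poincare I • xI J := by
  rw [xI, Finset.sum_mul, poincare, Finset.sum_smul]
  exact Finset.sum_congr rfl fun w _ => heckeTw_mul_xI (parabolic_mono h w.2)

theorem xI_mul_xI_of_superset {I J : Finitary cs} (h : I.1 ⊆ J.1) :
    xI J * xI I = poincare I • xI J := by
  rw [xI, xI, Finset.mul_sum, poincare, Finset.sum_smul]
  exact Finset.sum_congr rfl fun w _ => xI_mul_heckeTw (parabolic_mono h w.2)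

theorem xI_mul_self (I : Finitary cs) : xI I * xI I = poincare I • xI I :=
  xI_mul_xI_of_subset (Finset.Subset.refl _)

variable (cs) in
theorem xI_emptySet : xI (emptySet cs) = 1 := by
  have h (w : parabolic cs (emptySet cs).1) : w.1 = 1 := by
    simpa [parabolic, emptySet] using w.2
  rw [xI, Finset.sum_eq_single 1 (fun w _ hw => absurd (Subtype.ext (h w)) hw) (by simp)]
  exact heckeTw_one

variable (cs) in
theorem poincare_emptySet : poincare (emptySet cs) = 1 := by
  have h (w : parabolic cs (emptySet cs).1) : w.1 = 1 := by
    simpa [parabolic, emptySet] using w.2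
  rw [poincare, Finset.sum_eq_single 1 (fun w _ hw => absurd (Subtype.ext (h w)) hw) (by simp)]
  simp

theorem sum_parabolic_singleton {A : Type*} [AddCommMonoid A] (s : B) (f : W → A) :
    ∑ w : parabolic cs (singletonSet cs s).1, f w.1 = f 1 + f (cs.simple s) := by
  classical
  have hs : cs.simple s ∈ parabolic cs (singletonSet cs s).1 :=
    simple_mem_parabolic (by simp [singletonSet])
  have hne : (1 : parabolic cs (singletonSet cs s).1) ≠ ⟨cs.simple s, hs⟩ := by
    intro h
    have := congrArg (fun w => cs.length w.1) h
    simp at this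
  have huniv : (Finset.univ : Finset (parabolic cs (singletonSet cs s).1)) =
      {1, ⟨cs.simple s, hs⟩} := by
    ext ⟨w, hw⟩
    obtain ⟨ω, h1, h2, h3⟩ := exists_isReduced_of_mem_parabolic hw
    have h2' : ∀ a ∈ ω, a = s := fun a ha => by simpa [singletonSet] using h2 a ha
    simp only [Finset.mem_univ, Finset.mem_insert, Finset.mem_singleton, true_iff, Subtype.ext_iff]
    match ω, h1, h2', h3 with
    | [], _, _, h3 => exact Or.inl (by simpa using h3.symm)
    | [a], _, h2', h3 =>
      rw [h2' a (by simp), wordProd_singleton] at h3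
      exact Or.inr h3.symm
    | a :: b :: ω, h1, h2', _ =>
      exfalso
      rw [h2' a (by simp), h2' b (by simp)] at h1
      have := (isReduced_cons_iff.1 h1)
      refine this.2 ?_
      rw [wordProd_cons, isLeftDescent_iff_not_isLeftDescent_mul, simple_mul_simple_cancel_left]
      exact (isReduced_cons_iff.1 this.1).2
  rw [huniv, Finset.sum_pair hne]
  rfl

theorem heckeTw_simple (s : B) : heckeTw cs (cs.simple s) = heckeT cs s := by
  have h : cs.IsReduced [s] := by simp [CoxeterSystem.IsReduced]
  simpa using heckeTw_wordProd h

theorem xI_singletonSet (s : B) : xI (singletonSet cs s) = heckeT cs s + 1 := by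
  rw [xI, sum_parabolic_singleton s (heckeTw cs), heckeTw_one, heckeTw_simple, add_comm]

theorem poincare_singletonSet (s : B) : poincare (singletonSet cs s) = q + 1 := by
  rw [poincare, sum_parabolic_singleton s fun w => q ^ cs.length w]
  simp [add_comm]

end HeckeEndo

end

noncomputable section

namespace CoxeterSystem

variable {B W : Type*} [Group W] {M : CoxeterMatrix B} (cs : CoxeterSystem M W)

/-- If $s$ is a left descent of $wt$ but not of $w$, exchange deletes a letter from a reduced word
of $w$ followed by $t$. Only the final $t$ is possible, which says $swt=w$. The opposite case
follows with $wt$ in place of $w$. This is the exceptional case in the commutation of left and right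
multiplications. -/
theorem simple_mul_eq_mul_simple_of_isLeftDescent {w : W} {s t : B}
    (h : ¬ (cs.IsLeftDescent (w * cs.simple t) s ↔ cs.IsLeftDescent w s)) :
    cs.simple s * w = w * cs.simple t := by
  have key (w : W) (h1 : cs.IsLeftDescent (w * cs.simple t) s) (h2 : ¬ cs.IsLeftDescent w s) :
      cs.simple s * w = w * cs.simple t := by
    obtain ⟨ω, h3, rfl⟩ := cs.exists_isReduced w
    rw [← wordProd_singleton, ← wordProd_append] at h1
    obtain ⟨p, hp, hp'⟩ := cs.exists_eraseIdx_of_isLeftDescent h1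
    rcases lt_or_ge p ω.length with hpω | hpω
    · exfalso
      rw [List.eraseIdx_append_of_lt_length hpω, wordProd_append, wordProd_append, ← mul_assoc,
        mul_left_inj] at hp'
      have h4 := cs.length_wordProd_le (ω.eraseIdx p)
      rw [not_isLeftDescent_iff, hp', h3.eq] at h2
      rw [List.length_eraseIdx_of_lt hpω] at h4
      omega
    · have hp0 : p - ω.length = 0 := by
        simp at hp
        omega
      rw [List.eraseIdx_append_of_length_le hpω, hp0, wordProd_append, wordProd_singleton] at hp'
      simp only [List.eraseIdx_zero, List.tail_cons, List.append_nil] at hp'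
      rw [← mul_assoc] at hp'
      nth_rw 2 [← hp']
      rw [simple_mul_simple_cancel_right]
  by_cases h2 : cs.IsLeftDescent w s
  · have h1 : ¬ cs.IsLeftDescent (w * cs.simple t) s := fun h1 => h (by tauto)
    have := key (w * cs.simple t) (by simpa using h2) h1
    rw [simple_mul_simple_cancel_right] at this
    calc cs.simple s * w = cs.simple s * (cs.simple s * (w * cs.simple t)) := by rw [this]
      _ = w * cs.simple t := cs.simple_mul_simple_cancel_left s
  · exact key w (by tauto) h2

theorem simple_mul_eq_mul_simple_of_isRightDescent {w : W} {s t : B}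
    (h : ¬ (cs.IsRightDescent (cs.simple s * w) t ↔ cs.IsRightDescent w t)) :
    cs.simple s * w = w * cs.simple t := by
  rw [← cs.isLeftDescent_inv_iff, ← cs.isLeftDescent_inv_iff (w := w), mul_inv_rev,
    inv_simple] at h
  have := cs.simple_mul_eq_mul_simple_of_isLeftDescent h
  have h' := congrArg (·⁻¹) this
  simpa using h'.symm

end CoxeterSystem

namespace HeckeEndo

open CoxeterSystem

variable {B W : Type*} [Group W] {M : CoxeterMatrix B} {cs : CoxeterSystem M W}

/-! ### Linear independence of the standard elements -/

variable (cs) in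
open Classical in
/-- The operator of left multiplication by `T_s` on the free module on `W`. -/
def leftOp (s : B) : Module.End ℤ[X] (W →₀ ℤ[X]) :=
  Finsupp.linearCombination ℤ[X] fun w =>
    (if cs.IsLeftDescent w s then q - 1 else 0) • Finsupp.single w (1 : ℤ[X]) +
      (if cs.IsLeftDescent w s then q else 1) • Finsupp.single (cs.simple s * w) (1 : ℤ[X])

variable (cs) in
open Classical in
/-- The operator of right multiplication by `T_s` on the free module on `W`. -/
def rightOp (s : B) : Module.End ℤ[X] (W →₀ ℤ[X]) :=
  Finsupp.linearCombination ℤ[X] fun w =>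
    (if cs.IsRightDescent w s then q - 1 else 0) • Finsupp.single w (1 : ℤ[X]) +
      (if cs.IsRightDescent w s then q else 1) • Finsupp.single (w * cs.simple s) (1 : ℤ[X])

open Classical in
theorem leftOp_single (s : B) (w : W) : leftOp cs s (Finsupp.single w 1) =
    (if cs.IsLeftDescent w s then q - 1 else 0) • Finsupp.single w (1 : ℤ[X]) +
      (if cs.IsLeftDescent w s then q else 1) • Finsupp.single (cs.simple s * w) (1 : ℤ[X]) := by
  rw [leftOp, Finsupp.linearCombination_single, one_smul]

open Classical in
theorem rightOp_single (s : B) (w : W) : rightOp cs s (Finsupp.single w 1) =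
    (if cs.IsRightDescent w s then q - 1 else 0) • Finsupp.single w (1 : ℤ[X]) +
      (if cs.IsRightDescent w s then q else 1) • Finsupp.single (w * cs.simple s) (1 : ℤ[X]) := by
  rw [rightOp, Finsupp.linearCombination_single, one_smul]

theorem leftOp_mul_self (s : B) :
    leftOp cs s * leftOp cs s = (q - 1) • leftOp cs s + q • (1 : Module.End ℤ[X] (W →₀ ℤ[X])) := by
  classical
  refine Finsupp.lhom_ext' fun w => LinearMap.ext_ring ?_
  have h : cs.IsLeftDescent w s ↔ ¬ cs.IsLeftDescent (cs.simple s * w) s :=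
    cs.isLeftDescent_iff_not_isLeftDescent_mul
  simp only [LinearMap.comp_apply, Module.End.mul_apply, LinearMap.add_apply, LinearMap.smul_apply,
    Module.End.one_apply, Finsupp.lsingle_apply, leftOp_single, map_add, map_smul,
    simple_mul_simple_cancel_left]
  by_cases hd : cs.IsLeftDescent w s
  · simp only [hd, h.1 hd, if_true, if_false]
    module
  · have hd' : cs.IsLeftDescent (cs.simple s * w) s := by tauto
    simp only [hd, hd', if_true, if_false]
    module

theorem leftOp_commute_rightOp (s t : B) : Commute (leftOp cs s) (rightOp cs t) := by
  classical
  refine Finsupp.lhom_ext' fun w => LinearMap.ext_ring ?_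
  simp only [LinearMap.comp_apply, Module.End.mul_apply, Finsupp.lsingle_apply, leftOp_single,
    rightOp_single, map_add, map_smul]
  by_cases h : (cs.IsLeftDescent (w * cs.simple t) s ↔ cs.IsLeftDescent w s) ∧
      (cs.IsRightDescent (cs.simple s * w) t ↔ cs.IsRightDescent w t)
  · simp only [h.1, h.2, mul_assoc]
    module
  · have e : cs.simple s * w = w * cs.simple t := by
      by_cases h1 : (cs.IsLeftDescent (w * cs.simple t) s ↔ cs.IsLeftDescent w s)
      · exact cs.simple_mul_eq_mul_simple_of_isRightDescent fun h2 => h ⟨h1, h2⟩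
      · exact cs.simple_mul_eq_mul_simple_of_isLeftDescent h1
    have e1 : cs.IsLeftDescent w s ↔ cs.IsRightDescent w t := by
      rw [IsLeftDescent, IsRightDescent, e]
    have e2 : cs.IsLeftDescent (w * cs.simple t) s ↔ ¬ cs.IsRightDescent w t := by
      rw [← e, ← e1, cs.isLeftDescent_iff_not_isLeftDescent_mul (w := w), not_not]
    have e3 : cs.IsRightDescent (w * cs.simple t) t ↔ ¬ cs.IsRightDescent w t := by
      rw [cs.isRightDescent_iff_not_isRightDescent_mul (w := w), not_not]
    have e4 : cs.simple s * (w * cs.simple t) = w * cs.simple t * cs.simple t := by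
      rw [← mul_assoc, e]
    simp only [e4, e, e1, e2, e3]

/-- Compositions of right multiplications reach every basis vector from that of 1 and commute with
the left ones. So an identity between products of the `leftOp` need only be tested at the vector of
1; there the braid relation is clear, because alternating words of length $m_{s,t}$ are reduced. -/
theorem exists_commute_leftOp (w : W) : ∃ R : Module.End ℤ[X] (W →₀ ℤ[X]),
    (∀ s, Commute (leftOp cs s) R) ∧ R (Finsupp.single 1 1) = Finsupp.single w 1 := by
  obtain ⟨ω, h1, rfl⟩ := cs.exists_isReduced w
  induction ω using List.reverseRecOn with
  | nil => exact ⟨1, fun s => Commute.one_right _, by simp⟩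
  | append_singleton ω t ih =>
    rw [isReduced_append_singleton_iff] at h1
    obtain ⟨R, h2, h3⟩ := ih h1.1
    refine ⟨rightOp cs t * R, fun s => (leftOp_commute_rightOp s t).mul_right (h2 s), ?_⟩
    rw [Module.End.mul_apply, h3, rightOp_single, if_neg h1.2, if_neg h1.2, zero_smul, zero_add,
      one_smul, wordProd_append, wordProd_singleton]

theorem leftOp_prod_single_one {ω : List B} (h : cs.IsReduced ω) :
    (ω.map (leftOp cs)).prod (Finsupp.single 1 1) = Finsupp.single (cs.wordProd ω) 1 := by
  induction ω with
  | nil => simp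
  | cons s ω ih =>
    rw [isReduced_cons_iff] at h
    rw [List.map_cons, List.prod_cons, Module.End.mul_apply, ih h.1, leftOp_single, if_neg h.2,
      if_neg h.2, zero_smul, zero_add, one_smul, wordProd_cons]

theorem leftOp_braid (s t : B) :
    ((braidWord M s t).map (leftOp cs)).prod = ((braidWord M t s).map (leftOp cs)).prod := by
  refine Finsupp.lhom_ext' fun w => LinearMap.ext_ring ?_
  obtain ⟨R, h1, h2⟩ := exists_commute_leftOp (cs := cs) w
  have h3 (ω : List B) : Commute (ω.map (leftOp cs)).prod R := by
    apply Commute.list_prod_left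
    intro x hx
    obtain ⟨s, -, rfl⟩ := List.mem_map.1 hx
    exact h1 s
  have h4 (i j : B) : (((braidWord M i j).map (leftOp cs)).prod ∘ₗ Finsupp.lsingle w) 1 =
      R (Finsupp.single (cs.wordProd (braidWord M i j)) 1) := by
    rw [LinearMap.comp_apply, Finsupp.lsingle_apply, ← h2, ← Module.End.mul_apply, (h3 _).eq,
      Module.End.mul_apply, HeckeEndo.braidWord,
      leftOp_prod_single_one (cs.isReduced_alternatingWord (Or.inr le_rfl))]
  rw [h4, h4]
  exact congrArg (fun x => R (Finsupp.single x 1)) (cs.wordProd_braidWord_eq s t)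

/-- The action by left operators, evaluated at the basis vector of 1, sends $T_w$ to the basis
vector of $w$. -/
theorem linearIndependent_heckeTw : LinearIndependent ℤ[X] (heckeTw cs) := by
  set φ := heckeLift (cs := cs) (leftOp cs) leftOp_mul_self leftOp_braid with hφ
  let ψ : Hecke cs →ₗ[ℤ[X]] (W →₀ ℤ[X]) :=
    (LinearMap.applyₗ (Finsupp.single (1 : W) (1 : ℤ[X]))) ∘ₗ φ.toLinearMap
  have h (w : W) : ψ (heckeTw cs w) = Finsupp.single w 1 := by
    have h1 : φ (heckeTw cs w) = ((redWord cs w).map (leftOp cs)).prod := by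
      rw [heckeTw, map_list_prod, List.map_map]
      congr 2
      ext1 s
      exact heckeLift_heckeT _ _ _ s
    change φ (heckeTw cs w) (Finsupp.single 1 1) = _
    rw [h1, leftOp_prod_single_one (isReduced_redWord w), wordProd_redWord]
  refine LinearIndependent.of_comp ψ ?_
  have : ψ ∘ heckeTw cs = fun w => Finsupp.single w (1 : ℤ[X]) := funext h
  rw [this]
  exact Finsupp.linearIndependent_single_one ℤ[X] W

end HeckeEndo

end

noncomputable section

namespace CoxeterSystem

variable {B W : Type*} [Group W] {M : CoxeterMatrix B} (cs : CoxeterSystem M W)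

theorem finite_subwordProds (ω : List B) : (cs.subwordProds ω).Finite := by
  refine ((List.finite_toSet ω.sublists).image cs.wordProd).subset ?_
  rintro _ ⟨η, h, rfl⟩
  exact ⟨η, List.mem_sublists.2 h, rfl⟩

theorem length_le_of_mem_subwordProds {ω : List B} {w : W} (h : w ∈ cs.subwordProds ω) :
    cs.length w ≤ ω.length := by
  obtain ⟨η, h, rfl⟩ := h
  exact (cs.length_wordProd_le η).trans h.length_le

theorem mem_subwordProds_cons_of_not_isLeftDescent {i : B} {ω : List B} {w : W}
    (hw : ¬ cs.IsLeftDescent w i) : w ∈ cs.subwordProds (i :: ω) ↔ w ∈ cs.subwordProds ω := by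
  rw [mem_subwordProds_cons]
  refine ⟨fun h => h.elim id fun h => ?_, Or.inl⟩
  have := cs.simple_mul_mem_subwordProds (i := i) h
    (by rwa [isLeftDescent_iff_not_isLeftDescent_mul, simple_mul_simple_cancel_left])
  rwa [simple_mul_simple_cancel_left] at this

end CoxeterSystem

namespace HeckeEndo

open CoxeterSystem

variable {B W : Type*} [Group W] {M : CoxeterMatrix B} {cs : CoxeterSystem M W}

/-! ### Expressions in the Kazhdan–Lusztig generators -/

open Classical in
theorem heckeT_add_one_mul_heckeTw (s : B) (w : W) :
    (heckeT cs s + 1) * heckeTw cs w =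
      (if cs.IsLeftDescent w s then q else 1) •
        (heckeTw cs w + heckeTw cs (cs.simple s * w)) := by
  rw [add_mul, one_mul]
  split_ifs with h
  · rw [heckeT_mul_heckeTw_of_isLeftDescent h]
    module
  · rw [heckeT_mul_heckeTw_of_not_isLeftDescent h, one_smul, add_comm]

/-- The subword products of `s :: ω` are stable under left multiplication by $s$. Of each pair
$\{w,sw\}$ exactly one member does not have $s$ as a left descent, and by exchange it is already a
subword product of `ω`. -/
theorem sum_subwordProds_cons {s : B} {ω : List B} {A : Type*} [AddCommMonoid A] (f : W → A)
    [DecidablePred fun w => cs.IsLeftDescent w s] :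
    ∑ w ∈ (cs.finite_subwordProds (s :: ω)).toFinset, f w =
      ∑ w ∈ (cs.finite_subwordProds ω).toFinset with ¬ cs.IsLeftDescent w s,
        (f w + f (cs.simple s * w)) := by
  rw [← Finset.sum_filter_not_add_sum_filter _ (fun w => cs.IsLeftDescent w s),
    Finset.sum_add_distrib]
  congr 1
  · refine Finset.sum_congr ?_ fun _ _ => rfl
    ext w
    simp only [Finset.mem_filter, Set.Finite.mem_toFinset]
    exact and_congr_left fun h => cs.mem_subwordProds_cons_of_not_isLeftDescent h
  · refine Finset.sum_nbij' (cs.simple s * ·) (cs.simple s * ·) ?_ ?_ ?_ ?_ ?_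
    · intro w hw
      simp only [Finset.mem_filter, Set.Finite.mem_toFinset] at hw ⊢
      have hd := cs.isLeftDescent_iff_not_isLeftDescent_mul.1 hw.2
      exact ⟨(cs.mem_subwordProds_cons_of_not_isLeftDescent hd).1
        (cs.simple_mul_mem_subwordProds_cons hw.1), hd⟩
    · intro w hw
      simp only [Finset.mem_filter, Set.Finite.mem_toFinset] at hw ⊢
      refine ⟨cs.mem_subwordProds_cons.2 (Or.inr (by simpa using hw.1)), ?_⟩
      rw [isLeftDescent_iff_not_isLeftDescent_mul, simple_mul_simple_cancel_left]
      exact hw.2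
    · intro w _
      simp
    · intro w _
      simp
    · intro w _
      simp

/-- By induction, as $(T_s+1)T_w$ is $T_w+T_{sw}$ or $q$ times it, according to whether $s$ is a
left descent of $w$. The terms without the factor $q$ form the sum for the longer word; the others
go into `h`. The top element stays out of `h`: it can only arise as $s$ times the top element of
`ω`, which does not have the descent $s$. -/
theorem exists_xWord_eq {ω : List B} (hω : cs.IsReduced ω) :
    ∃ h ∈ Submodule.span ℤ[X] (heckeTw cs '' (cs.subwordProds ω \ {cs.wordProd ω})),
      xWord cs ω = ∑ w ∈ (cs.finite_subwordProds ω).toFinset, heckeTw cs w + q • h := by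
  classical
  induction ω with
  | nil =>
    refine ⟨0, zero_mem _, ?_⟩
    have : (cs.finite_subwordProds []).toFinset = {1} := by
      ext w
      simp [subwordProds, eq_comm]
    rw [this]
    simp [xWord, heckeTw_one]
  | cons s ω ih =>
    have hr := isReduced_cons_iff.1 hω
    obtain ⟨h, h1, h2⟩ := ih hr.1
    have hlen : cs.length (cs.simple s * cs.wordProd ω) = ω.length + 1 := by
      rw [← wordProd_cons, hω.eq, List.length_cons]
    set D := Submodule.span ℤ[X]
      (heckeTw cs '' (cs.subwordProds (s :: ω) \ {cs.wordProd (s :: ω)})) with hD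
    have mem (w : W) (hw : w ∈ cs.subwordProds ω) : heckeTw cs w ∈ D := by
      refine Submodule.subset_span ⟨w, ⟨cs.mem_subwordProds_cons.2 (Or.inl hw), ?_⟩, rfl⟩
      rintro rfl
      have := cs.length_le_of_mem_subwordProds hw
      rw [wordProd_cons] at this
      omega
    have mem' (w : W) (hw : w ∈ cs.subwordProds ω) (hne : w ≠ cs.wordProd ω) :
        heckeTw cs (cs.simple s * w) ∈ D := by
      refine Submodule.subset_span ⟨_, ⟨cs.mem_subwordProds_cons.2 (Or.inr (by simpa using hw)),
        fun h => hne ?_⟩, rfl⟩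
      rwa [Set.mem_singleton_iff, wordProd_cons, mul_right_inj] at h
    have hD1 : (heckeT cs s + 1) * h ∈ D := by
      clear h2
      induction h1 using Submodule.span_induction with
      | mem x hx =>
        obtain ⟨w, hw, rfl⟩ := hx
        rw [heckeT_add_one_mul_heckeTw]
        exact D.smul_mem _ (add_mem (mem w hw.1) (mem' w hw.1 hw.2))
      | zero => simp
      | add x y _ _ hx hy =>
        rw [mul_add]
        exact add_mem hx hy
      | smul a x _ hx =>
        rw [mul_smul_comm]
        exact D.smul_mem _ hx
    refine ⟨∑ w ∈ (cs.finite_subwordProds ω).toFinset with cs.IsLeftDescent w s,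
      (heckeTw cs w + heckeTw cs (cs.simple s * w)) + (heckeT cs s + 1) * h, ?_, ?_⟩
    · refine add_mem (sum_mem fun w hw => ?_) hD1
      simp only [Finset.mem_filter, Set.Finite.mem_toFinset] at hw
      refine add_mem (mem w hw.1) (mem' w hw.1 ?_)
      rintro rfl
      exact hr.2 hw.2
    · rw [sum_subwordProds_cons, xWord, List.map_cons, List.prod_cons, ← xWord, h2, mul_add,
        Finset.mul_sum, mul_smul_comm, smul_add, ← add_assoc]
      congr 1
      rw [← Finset.sum_filter_not_add_sum_filter _ (fun w => cs.IsLeftDescent w s),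
        Finset.smul_sum]
      congr 1
      · refine Finset.sum_congr rfl fun w hw => ?_
        rw [heckeT_add_one_mul_heckeTw, if_neg (Finset.mem_filter.1 hw).2, one_smul]
      · refine Finset.sum_congr rfl fun w hw => ?_
        rw [heckeT_add_one_mul_heckeTw, if_pos (Finset.mem_filter.1 hw).2]

theorem heckeT_prod_mem_span_xWord (η : List B) :
    (η.map (heckeT cs)).prod ∈ Submodule.span ℤ[X] (xWord cs '' {ξ | ξ.Sublist η}) := by
  induction η with
  | nil => exact Submodule.subset_span ⟨[], List.Sublist.refl _, by simp [xWord]⟩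
  | cons s η ih =>
    rw [List.map_cons, List.prod_cons]
    generalize (η.map (heckeT cs)).prod = y at ih
    induction ih using Submodule.span_induction with
    | mem x hx =>
      obtain ⟨ξ, hξ, rfl⟩ := hx
      have : heckeT cs s * xWord cs ξ = xWord cs (s :: ξ) - xWord cs ξ := by
        simp [xWord, add_mul]
      rw [this]
      exact sub_mem (Submodule.subset_span ⟨_, hξ.cons_cons _, rfl⟩)
        (Submodule.subset_span ⟨_, hξ.cons _, rfl⟩)
    | zero => simp
    | add x y _ _ hx hy =>
      rw [mul_add]
      exact add_mem hx hy
    | smul a x _ hx =>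
      rw [mul_smul_comm]
      exact Submodule.smul_mem _ _ hx

/-- For an adapted word the sum in `exists_xWord_eq` runs over all of $W_I$, so it is $x_I$. The
error term involves only $T_w$ with $w\ne w_I$. Each such $w$ has a reduced word that is a proper
subsequence, and substituting $T_s=x_s-1$ there produces only proper subsequences. -/
theorem nonempty_expression {I : Finitary cs} (F : ChainTo I) : Nonempty (Expression F) := by
  obtain ⟨ω, hω⟩ := exists_adapted F
  obtain ⟨h1, h2⟩ := hω.isReduced_and_isLongest
  obtain ⟨h, hh, heq⟩ := exists_xWord_eq h1
  have hx : xI I = ∑ w ∈ (cs.finite_subwordProds ω).toFinset, heckeTw cs w := by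
    refine (Finset.sum_subtype _ (fun w => ?_) _).symm
    rw [Set.Finite.mem_toFinset, h2.subwordProds_eq h1]
    rfl
  have hspan : -h ∈ Submodule.span ℤ[X] (xWord cs '' {y | y.Sublist ω ∧ y ≠ ω}) := by
    refine neg_mem (Submodule.span_le.2 ?_ hh)
    rintro _ ⟨w, ⟨hw, hne⟩, rfl⟩
    obtain ⟨η, h3, h4, rfl⟩ := cs.mem_subwordProds_iff.1 hw
    rw [heckeTw_wordProd h4]
    refine Submodule.span_mono (Set.image_mono ?_) (heckeT_prod_mem_span_xWord η)
    intro ξ hξ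
    refine ⟨List.Sublist.trans hξ h3, ?_⟩
    rintro rfl
    exact hne (by rw [h3.antisymm hξ]; rfl)
  obtain ⟨l, hl, hl'⟩ := (Finsupp.mem_span_image_iff_linearCombination _).1 hspan
  refine ⟨⟨ω, hω, l, fun y hy => hl hy, ?_⟩⟩
  rw [Finsupp.linearCombination_apply] at hl'
  rw [hl', heq, hx, smul_neg, add_neg_cancel_right]

end HeckeEndo

end

/-! ### Universal properties of path algebras and of the Hecke endomorphism algebra. -/

noncomputable section

namespace PathAlgebra

variable {R : Type*} [CommRing R] {V : Type*} [Quiver V]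

theorem arrow_mul_ofPath {a b c : V} (p : Quiver.Path a b) (f : b ⟶ c) :
    arrow R f * ofPath R ⟨a, b, p⟩ = ofPath R ⟨a, c, p.cons f⟩ := by
  rw [arrow, ofPath_mul_ofPath, concat_comp]
  rfl

theorem vertex_mul_self (a : V) : vertex R a * vertex R a = vertex R a := by
  classical
  nth_rw 2 [vertex]
  rw [vertex_mul_ofPath, if_pos rfl]
  rfl

theorem vertex_mul_of_ne {a b : V} (h : a ≠ b) : vertex R a * vertex R b = 0 := by
  classical
  nth_rw 2 [vertex]
  rw [vertex_mul_ofPath, if_neg h.symm]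

theorem vertex_mul_arrow {a b : V} (f : a ⟶ b) : vertex R b * arrow R f = arrow R f := by
  classical
  rw [arrow, vertex_mul_ofPath, if_pos rfl]

theorem arrow_mul_vertex {a b : V} (f : a ⟶ b) : arrow R f * vertex R a = arrow R f := by
  classical
  rw [arrow, ofPath_mul_vertex, if_pos rfl]

/-! ### The universal property of a path algebra -/

/-- A representation of a quiver in a ring: orthogonal idempotents with sum `1`, indexed by the
vertices, and for each arrow an element of the corresponding Peirce component. -/
structure Data (V : Type*) [Quiver V] [Finite V] (A : Type*) [Ring A] where
  vert : V → A
  arr : ∀ {a b : V}, (a ⟶ b) → A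
  vert_mul_self : ∀ a, vert a * vert a = vert a
  vert_mul_of_ne : ∀ {a b}, a ≠ b → vert a * vert b = 0
  sum_vert : ∑ a ∈ (Set.toFinite (Set.univ : Set V)).toFinset, vert a = 1
  vert_mul_arr : ∀ {a b} (f : a ⟶ b), vert b * arr f = arr f
  arr_mul_vert : ∀ {a b} (f : a ⟶ b), arr f * vert a = arr f

variable [Finite V]

namespace Data

variable {A : Type*} [Ring A] (D : Data V A)

/-- The product of the values of the arrows of a path. -/
def pathVal {a : V} : {b : V} → Quiver.Path a b → A
  | _, .nil => D.vert a
  | _, .cons p f => D.arr f * pathVal p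

theorem vert_mul_pathVal {a b : V} (p : Quiver.Path a b) : D.vert b * D.pathVal p = D.pathVal p := by
  cases p with
  | nil => exact D.vert_mul_self a
  | cons p f => rw [pathVal, ← mul_assoc, D.vert_mul_arr]

theorem pathVal_mul_vert {a b : V} (p : Quiver.Path a b) : D.pathVal p * D.vert a = D.pathVal p := by
  induction p with
  | nil => exact D.vert_mul_self a
  | cons p f ih => rw [pathVal, mul_assoc, ih]

theorem pathVal_comp {a b c : V} (p : Quiver.Path a b) (q : Quiver.Path b c) :
    D.pathVal (p.comp q) = D.pathVal q * D.pathVal p := by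
  induction q with
  | nil => rw [Quiver.Path.comp_nil, pathVal, D.vert_mul_pathVal]
  | cons q f ih => rw [Quiver.Path.comp_cons, pathVal, pathVal, ih, mul_assoc]

variable [Algebra R A]

variable (R) in
/-- The linear extension of `pathVal`. -/
def liftLin : PathAlgebra R V →ₗ[R] A :=
  Finsupp.lift A R (QuiverPath V) fun p => D.pathVal p.path

theorem liftLin_ofPath (p : QuiverPath V) : D.liftLin R (ofPath R p) = D.pathVal p.path := by
  unfold liftLin ofPath
  exact (Finsupp.sum_single_index (by simp)).trans (one_smul R _)

theorem liftLin_mul (x y : PathAlgebra R V) :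
    D.liftLin R (x * y) = D.liftLin R x * D.liftLin R y := by
  refine induction (P := fun x => D.liftLin R (x * y) = D.liftLin R x * D.liftLin R y) x
    (by simp) (fun a b ha hb => by simp only [add_mul, map_add, ha, hb]) fun r p => ?_
  refine induction (P := fun y => D.liftLin R (_ * y) = D.liftLin R _ * D.liftLin R y) y
    (by simp) (fun a b ha hb => by simp only [mul_add, map_add, ha, hb]) fun t u => ?_
  simp only [map_smul, smul_mul_assoc, mul_smul_comm, liftLin_ofPath,
    ofPath_mul_ofPath]
  congr 2
  obtain ⟨a, b, p⟩ := p
  obtain ⟨c, d, u⟩ := u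
  by_cases h : d = a
  · subst h
    rw [concat_comp, liftLin_ofPath, pathVal_comp]
  · rw [concat_of_ne (by exact h), map_zero]
    dsimp only
    rw [← D.pathVal_mul_vert p, ← D.vert_mul_pathVal u, mul_assoc, ← mul_assoc (D.vert a),
      D.vert_mul_of_ne (Ne.symm h), zero_mul, mul_zero]

variable (R) in
/-- The homomorphism from the path algebra defined by a representation of the quiver. -/
def lift : PathAlgebra R V →ₐ[R] A :=
  AlgHom.ofLinearMap (D.liftLin R)
    (by
      rw [one_def, map_sum]
      refine Eq.trans (Finset.sum_congr rfl fun a _ => ?_) D.sum_vert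
      exact D.liftLin_ofPath _)
    D.liftLin_mul

theorem lift_vertex (a : V) : D.lift R (vertex R a) = D.vert a := D.liftLin_ofPath _

theorem lift_arrow {a b : V} (f : a ⟶ b) : D.lift R (arrow R f) = D.arr f := by
  refine (D.liftLin_ofPath _).trans ?_
  change D.arr f * D.vert a = D.arr f
  exact D.arr_mul_vert f

end Data

theorem algHom_ext {A : Type*} [Ring A] [Algebra R A] {φ ψ : PathAlgebra R V →ₐ[R] A}
    (hv : ∀ a, φ (vertex R a) = ψ (vertex R a))
    (ha : ∀ {a b : V} (f : a ⟶ b), φ (arrow R f) = ψ (arrow R f)) : φ = ψ := by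
  ext x
  refine induction (P := fun x => φ x = ψ x) x (by simp)
    (fun a b ha hb => by rw [map_add, map_add, ha, hb]) fun r ⟨a, b, p⟩ => ?_
  rw [map_smul, map_smul]
  congr 1
  induction p with
  | nil => exact hv a
  | cons p f ih => rw [← arrow_mul_ofPath, map_mul, map_mul, ha, ih]

end PathAlgebra

end

noncomputable section

namespace HeckeEndo

open CoxeterSystem MulOpposite

variable {B W : Type*} [Group W] {M : CoxeterMatrix B} {cs : CoxeterSystem M W}

/-! ### Elements of the Hecke endomorphism algebra -/

theorem mem_xIdeal_iff {I : Finitary cs} {y : Hecke cs} :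
    y ∈ xIdeal I ↔ ∃ h, y = xI I * h := by
  rw [xIdeal, Submodule.mem_span_singleton]
  constructor
  · rintro ⟨a, rfl⟩
    exact ⟨a.unop, rfl⟩
  · rintro ⟨h, rfl⟩
    exact ⟨op h, rfl⟩

theorem xI_mul_mem_xIdeal (I : Finitary cs) (h : Hecke cs) : xI I * h ∈ xIdeal I :=
  mem_xIdeal_iff.2 ⟨h, rfl⟩

theorem xI_mem_xIdeal (I : Finitary cs) : xI I ∈ xIdeal I :=
  mem_xIdeal_iff.2 ⟨1, (mul_one _).symm⟩

theorem xI_mul_of_mem {I : Finitary cs} {y : Hecke cs} (hy : y ∈ xIdeal I) :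
    xI I * y = poincare I • y := by
  obtain ⟨h, rfl⟩ := mem_xIdeal_iff.1 hy
  rw [← mul_assoc, xI_mul_self, smul_mul_assoc]

/-- The homomorphism `y ↦ x_J a y` from `x_I H` to `x_J H`. -/
def mulHom (J : Finitary cs) (a : Hecke cs) (I : Finitary cs) :
    xIdeal I →ₗ[(Hecke cs)ᵐᵒᵖ] xIdeal J where
  toFun y := ⟨xI J * (a * y.1), xI_mul_mem_xIdeal _ _⟩
  map_add' y z := Subtype.ext (by simp [mul_add])
  map_smul' c y := Subtype.ext (by simp [mul_assoc])

open Classical in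
/-- The endomorphism of `⨁ x_I H` that is `φ` from the summand of `I` to the summand of `J` and
zero on the other summands. -/
def blockEnd {I J : Finitary cs} (φ : xIdeal I →ₗ[(Hecke cs)ᵐᵒᵖ] xIdeal J) : HeckeEnd cs :=
  DirectSum.lof (Hecke cs)ᵐᵒᵖ (Finitary cs) (fun I => xIdeal I) J ∘ₗ φ ∘ₗ
    DirectSum.component (Hecke cs)ᵐᵒᵖ (Finitary cs) (fun I => xIdeal I) I

/-- The endomorphism `y ↦ x_J a y` from the summand `x_I H` to the summand `x_J H`. -/
def mulEnd (J : Finitary cs) (a : Hecke cs) (I : Finitary cs) : HeckeEnd cs :=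
  blockEnd (mulHom J a I)

/-- The projection to the summand of `I`. -/
def projEnd (I : Finitary cs) : HeckeEnd cs := blockEnd (LinearMap.id : xIdeal I →ₗ[_] xIdeal I)

theorem blockEnd_mul_blockEnd {I J K : Finitary cs} (ψ : xIdeal J →ₗ[(Hecke cs)ᵐᵒᵖ] xIdeal K)
    (φ : xIdeal I →ₗ[(Hecke cs)ᵐᵒᵖ] xIdeal J) :
    blockEnd ψ * blockEnd φ = blockEnd (ψ ∘ₗ φ) := by
  refine LinearMap.ext fun x => ?_
  simp [blockEnd, DirectSum.component.lof_self]

theorem blockEnd_mul_blockEnd_of_ne {I J J' K : Finitary cs}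
    (ψ : xIdeal J' →ₗ[(Hecke cs)ᵐᵒᵖ] xIdeal K) (φ : xIdeal I →ₗ[(Hecke cs)ᵐᵒᵖ] xIdeal J)
    (h : J ≠ J') : blockEnd ψ * blockEnd φ = 0 := by
  refine LinearMap.ext fun x => ?_
  simp [blockEnd, DirectSum.component.of, h]

theorem blockEnd_add {I J : Finitary cs} (ψ φ : xIdeal I →ₗ[(Hecke cs)ᵐᵒᵖ] xIdeal J) :
    blockEnd (ψ + φ) = blockEnd ψ + blockEnd φ := by
  refine LinearMap.ext fun x => ?_
  simp [blockEnd]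

theorem blockEnd_smul {I J : Finitary cs} (c : ℤ[X]) (φ : xIdeal I →ₗ[(Hecke cs)ᵐᵒᵖ] xIdeal J) :
    blockEnd (c • φ) = c • blockEnd φ := by
  refine LinearMap.ext fun x => ?_
  simp only [blockEnd, LinearMap.comp_apply, LinearMap.smul_apply]
  exact LinearMap.map_smul_of_tower _ _ _

theorem mulEnd_mul_mulEnd (K : Finitary cs) (b : Hecke cs) (J : Finitary cs) (a : Hecke cs)
    (I : Finitary cs) : mulEnd K b J * mulEnd J a I = mulEnd K (b * xI J * a) I := by
  rw [mulEnd, mulEnd, blockEnd_mul_blockEnd, mulEnd]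
  congr 1
  ext y
  simp [mulHom, mul_assoc]

theorem mulEnd_add (J : Finitary cs) (a b : Hecke cs) (I : Finitary cs) :
    mulEnd J (a + b) I = mulEnd J a I + mulEnd J b I := by
  rw [mulEnd, mulEnd, mulEnd, ← blockEnd_add]
  congr 1
  ext y
  simp [mulHom, add_mul, mul_add]

theorem mulEnd_smul (J : Finitary cs) (c : ℤ[X]) (a : Hecke cs) (I : Finitary cs) :
    mulEnd J (c • a) I = c • mulEnd J a I := by
  rw [mulEnd, mulEnd, ← blockEnd_smul]
  congr 1
  ext y
  simp [mulHom]

/-- `mulEnd` as a linear map. -/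
def mulEndLin (J I : Finitary cs) : Hecke cs →ₗ[ℤ[X]] HeckeEnd cs where
  toFun a := mulEnd J a I
  map_add' a b := mulEnd_add J a b I
  map_smul' c a := mulEnd_smul J c a I

theorem mulEnd_congr_right (J : Finitary cs) {a b : Hecke cs} {I : Finitary cs}
    (h : a * xI I = b * xI I) : mulEnd J a I = mulEnd J b I := by
  rw [mulEnd, mulEnd]
  congr 1
  ext ⟨y, hy⟩
  obtain ⟨z, rfl⟩ := mem_xIdeal_iff.1 hy
  simp only [mulHom, LinearMap.coe_mk, AddHom.coe_mk]
  rw [← mul_assoc a, h, mul_assoc b]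

theorem mulEnd_congr_left {J : Finitary cs} {a b : Hecke cs} (I : Finitary cs)
    (h : xI J * a = xI J * b) : mulEnd J a I = mulEnd J b I := by
  rw [mulEnd, mulEnd]
  congr 1
  ext ⟨y, hy⟩
  simp only [mulHom, LinearMap.coe_mk, AddHom.coe_mk]
  rw [← mul_assoc, h, mul_assoc]

theorem mulEnd_one_self (I : Finitary cs) : mulEnd I 1 I = poincare I • projEnd I := by
  rw [mulEnd, projEnd, ← blockEnd_smul]
  congr 1
  ext ⟨y, hy⟩
  simp [mulHom, xI_mul_of_mem hy]

theorem projEnd_mul_self (I : Finitary cs) : projEnd I * projEnd I = projEnd I := by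
  rw [projEnd, blockEnd_mul_blockEnd, LinearMap.id_comp]

theorem projEnd_mul_of_ne {I J : Finitary cs} (h : I ≠ J) : projEnd I * projEnd J = 0 :=
  blockEnd_mul_blockEnd_of_ne _ _ h.symm

theorem projEnd_mul_mulEnd (J : Finitary cs) (a : Hecke cs) (I : Finitary cs) :
    projEnd J * mulEnd J a I = mulEnd J a I := by
  rw [projEnd, mulEnd, blockEnd_mul_blockEnd, LinearMap.id_comp]

theorem mulEnd_mul_projEnd (J : Finitary cs) (a : Hecke cs) (I : Finitary cs) :
    mulEnd J a I * projEnd I = mulEnd J a I := by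
  rw [projEnd, mulEnd, blockEnd_mul_blockEnd, LinearMap.comp_id]

variable (cs) in
theorem projEnd_emptySet : projEnd (emptySet cs) = mulEnd (emptySet cs) 1 (emptySet cs) := by
  rw [mulEnd_one_self, poincare_emptySet, one_smul]

instance [Finite B] : Fintype (Finitary cs) := Fintype.ofFinite _

theorem sum_projEnd [Finite B] : ∑ I : Finitary cs, projEnd I = 1 := by
  classical
  refine LinearMap.ext fun x => ?_
  rw [LinearMap.sum_apply]
  exact DirectSum.sum_univ_of x

open Classical in
/-- The coefficient `f(x_I)_J` of an endomorphism. -/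
def endCoeff (f : HeckeEnd cs) (J I : Finitary cs) : Hecke cs :=
  (f (DirectSum.lof (Hecke cs)ᵐᵒᵖ (Finitary cs) (fun I => xIdeal I) I ⟨xI I, xI_mem_xIdeal I⟩) J).1

theorem endCoeff_mem (f : HeckeEnd cs) (J I : Finitary cs) : endCoeff f J I ∈ xIdeal J :=
  Subtype.prop _

-- For $y\in x_IH$ one has $x_Iy=\pi(I)y$, hence $f(x_I)y=f(x_Iy)=\pi(I)f(y)$. Once $\pi(I)$ is
-- invertible, the coefficients determine $f$.
open Classical in
theorem endCoeff_mul (f : HeckeEnd cs) (J I : Finitary cs) (y : xIdeal I) :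
    endCoeff f J I * y.1 = poincare I •
      (f (DirectSum.lof (Hecke cs)ᵐᵒᵖ (Finitary cs) (fun I => xIdeal I) I y) J).1 := by
  have h1 : op y.1 • (⟨xI I, xI_mem_xIdeal I⟩ : xIdeal I) = poincare I • y :=
    Subtype.ext (xI_mul_of_mem y.2)
  have h2 := congrArg (fun z => (f (DirectSum.lof (Hecke cs)ᵐᵒᵖ (Finitary cs)
    (fun I => xIdeal I) I z) J).1) h1
  simp only [LinearMap.map_smul_of_tower] at h2
  exact h2

/-- Each block of `f` becomes a multiple of a multiplication map. The factor $\pi(I)$ comes from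
`endCoeff_mul`, and $\pi(J)$ from the left multiplication by $x_J$ built into `mulEnd`. -/
theorem mulEnd_endCoeff (f : HeckeEnd cs) (J I : Finitary cs) :
    mulEnd J (endCoeff f J I) I = (poincare J * poincare I) • (projEnd J * f * projEnd I) := by
  classical
  have h : mulHom J (endCoeff f J I) I = (poincare J * poincare I) •
      (DirectSum.component (Hecke cs)ᵐᵒᵖ (Finitary cs) (fun I => xIdeal I) J ∘ₗ f ∘ₗ
        DirectSum.lof (Hecke cs)ᵐᵒᵖ (Finitary cs) (fun I => xIdeal I) I) := by
    refine LinearMap.ext fun y => Subtype.ext ?_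
    change xI J * (endCoeff f J I * y.1) = (poincare J * poincare I) • _
    rw [endCoeff_mul, mul_smul_comm, xI_mul_of_mem (Subtype.prop _), smul_smul, mul_comm]
    rfl
  rw [mulEnd, h, blockEnd_smul]
  rfl

end HeckeEndo

end

noncomputable section

namespace HeckeEndo

open CoxeterSystem

variable {B W : Type*} [Group W] {M : CoxeterMatrix B} {cs : CoxeterSystem M W}

/-! ### Hook systems -/

theorem algebraMap_poincare_mul_invPoincare (I : Finitary cs) :
    algebraMap ℤ[X] LocRing (poincare I) * invPoincare I = 1 := by
  rw [invPoincare, ← Localization.mk_one_eq_algebraMap, Localization.mk_mul, mul_one, one_mul]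
  exact Localization.mk_self (⟨poincare I, poincare_mem I⟩ : unitConst)

theorem invPoincare_emptySet : invPoincare (emptySet cs) = 1 := by
  have := algebraMap_poincare_mul_invPoincare (emptySet cs)
  rwa [poincare_emptySet, map_one, one_mul] at this

section

variable {K A : Type*} [CommRing K] [Ring A] [Algebra K A] [Algebra ℤ[X] A] [Algebra ℤ[X] K]
  [IsScalarTower ℤ[X] K A] {inv : Finitary cs → K}

theorem smul_poincare_smul (hinv : ∀ I, algebraMap ℤ[X] K (poincare I) * inv I = 1)
    (I : Finitary cs) (x : A) : inv I • poincare I • x = x := by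
  rw [← algebraMap_smul K (poincare I) x, smul_smul, mul_comm, hinv, one_smul]

theorem poincare_smul_smul (hinv : ∀ I, algebraMap ℤ[X] K (poincare I) * inv I = 1)
    (I : Finitary cs) (x : A) : poincare I • inv I • x = x := by
  rw [← algebraMap_smul K (poincare I), smul_smul, hinv, one_smul]

end

theorem hecke_induction {P : Hecke cs → Prop} (hc : ∀ c : ℤ[X], P (algebraMap ℤ[X] _ c))
    (hT : ∀ s, P (heckeT cs s)) (hadd : ∀ a b, P a → P b → P (a + b))
    (hmul : ∀ a b, P a → P b → P (a * b)) (h : Hecke cs) : P h := by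
  obtain ⟨x, rfl⟩ := RingQuot.mkAlgHom_surjective ℤ[X] (HeckeRel M) h
  induction x using FreeAlgebra.induction with
  | grade0 r => rw [AlgHom.commutes]; exact hc r
  | grade1 s => exact hT s
  | mul a b ha hb => rw [map_mul]; exact hmul _ _ ha hb
  | add a b ha hb => rw [map_add]; exact hadd _ _ ha hb

theorem endCoeff_add (f g : HeckeEnd cs) (J I : Finitary cs) :
    endCoeff (f + g) J I = endCoeff f J I + endCoeff g J I := rfl

theorem endCoeff_smul (c : ℤ[X]) (f : HeckeEnd cs) (J I : Finitary cs) :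
    endCoeff (c • f) J I = c • endCoeff f J I := rfl

theorem endCoeff_blockEnd_self {I J : Finitary cs} (φ : xIdeal I →ₗ[(Hecke cs)ᵐᵒᵖ] xIdeal J) :
    endCoeff (blockEnd φ) J I = (φ ⟨xI I, xI_mem_xIdeal I⟩).1 := by
  rw [endCoeff, DirectSum.apply_eq_component (Hecke cs)ᵐᵒᵖ, blockEnd, LinearMap.comp_apply,
    LinearMap.comp_apply, DirectSum.component.lof_self, DirectSum.component.lof_self]

theorem endCoeff_blockEnd_of_ne_left {I J J' : Finitary cs} (I' : Finitary cs)
    {φ : xIdeal I →ₗ[(Hecke cs)ᵐᵒᵖ] xIdeal J} (h : J ≠ J') :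
    endCoeff (blockEnd φ) J' I' = 0 := by
  rw [endCoeff, DirectSum.apply_eq_component (Hecke cs)ᵐᵒᵖ, blockEnd, LinearMap.comp_apply,
    LinearMap.comp_apply, DirectSum.component.of, dif_neg h]
  rfl

theorem endCoeff_blockEnd_of_ne_right {I J I' : Finitary cs} (J' : Finitary cs)
    (φ : xIdeal I →ₗ[(Hecke cs)ᵐᵒᵖ] xIdeal J) (h : I' ≠ I) :
    endCoeff (blockEnd φ) J' I' = 0 := by
  rw [endCoeff, blockEnd, LinearMap.comp_apply, LinearMap.comp_apply, DirectSum.component.of,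
    dif_neg h, map_zero, map_zero]
  rfl

theorem endCoeff_mul_endCoeff (g f : HeckeEnd cs) (K J I : Finitary cs) :
    endCoeff g K J * endCoeff f J I = poincare J • endCoeff (g * projEnd J * f) K I := by
  classical
  rw [endCoeff.eq_def f]
  exact endCoeff_mul g K J _

/-- Elements of an algebra that behave like the canonical elements of the Hecke endomorphism
algebra: the projections to the summands `x_I H`, the inclusions of `x_I H` in `H`, the
projections `x_I / π(I)` of `H` to `x_I H`, and the action of the Hecke algebra. -/
structure HookSystem (cs : CoxeterSystem M W) [Finite B] {K : Type*} [CommRing K]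
    (inv : Finitary cs → K) (A : Type*) [Ring A] [Algebra K A] [Algebra ℤ[X] A] where
  e : Finitary cs → A
  up : Finitary cs → A
  down : Finitary cs → A
  hecke : Hecke cs →ₐ[ℤ[X]] A
  e_mul_of_ne : ∀ {I J}, I ≠ J → e I * e J = 0
  sum_e : ∑ I, e I = 1
  up_mul_e : ∀ I, up I * e I = up I
  e_mul_down : ∀ I, e I * down I = down I
  e_mul_up : ∀ I, e (emptySet cs) * up I = up I
  down_mul_e : ∀ I, down I * e (emptySet cs) = down I
  commute : ∀ h, e (emptySet cs) * hecke h = hecke h * e (emptySet cs)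
  up_mul_down : ∀ I, up I * down I = inv I • (e (emptySet cs) * hecke (xI I))
  down_mul_up : ∀ I, down I * up I = e I
  up_empty : up (emptySet cs) = e (emptySet cs)
  down_empty : down (emptySet cs) = e (emptySet cs)

namespace HookSystem

variable [Finite B] {K : Type*} [CommRing K] {inv : Finitary cs → K}
  {A : Type*} [Ring A] [Algebra K A] [Algebra ℤ[X] A] (S : HookSystem cs inv A)

theorem e_mul_self (I : Finitary cs) : S.e I * S.e I = S.e I := by
  nth_rw 2 [← S.down_mul_up I]
  rw [← mul_assoc, S.e_mul_down, S.down_mul_up]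

/-- The element of `A` that corresponds to `y ↦ p_J a y` from `x_I H` to `x_J H`. -/
def block (J : Finitary cs) (a : Hecke cs) (I : Finitary cs) : A :=
  S.down J * S.hecke a * S.up I

/-- The middle factor `up J * down J` acts as $x_J/\pi(J)$; its $e_\emptyset$ commutes with the
Hecke action and is absorbed by `down L`. -/
theorem block_mul_block (L : Finitary cs) (b : Hecke cs) (J : Finitary cs) (a : Hecke cs)
    (I : Finitary cs) :
    S.block L b J * S.block J a I = inv J • S.block L (b * xI J * a) I := by
  have h : S.block L b J * S.block J a I =
      S.down L * S.hecke b * (S.up J * S.down J) * S.hecke a * S.up I := by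
    simp only [block, mul_assoc]
  have h' : S.down L * S.hecke b * (S.e (emptySet cs) * S.hecke (xI J)) =
      S.down L * S.hecke b * S.hecke (xI J) := by
    rw [← mul_assoc, mul_assoc (S.down L), ← S.commute, ← mul_assoc, S.down_mul_e]
  rw [h, S.up_mul_down, mul_smul_comm, smul_mul_assoc, smul_mul_assoc, h', block]
  simp only [map_mul, mul_assoc]

theorem block_mul_block_of_ne (L : Finitary cs) (b : Hecke cs) {J J' : Finitary cs}
    (a : Hecke cs) (I : Finitary cs) (h : J ≠ J') : S.block L b J' * S.block J a I = 0 := by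
  rw [block, block, ← S.up_mul_e J', ← S.e_mul_down J]
  have : S.down L * S.hecke b * (S.up J' * S.e J') * (S.e J * S.down J * S.hecke a * S.up I) =
      S.down L * S.hecke b * S.up J' * (S.e J' * S.e J) * (S.down J * S.hecke a * S.up I) := by
    simp only [mul_assoc]
  rw [this, S.e_mul_of_ne h.symm, mul_zero, zero_mul]

theorem block_add (J : Finitary cs) (a b : Hecke cs) (I : Finitary cs) :
    S.block J (a + b) I = S.block J a I + S.block J b I := by
  rw [block, map_add, mul_add, add_mul, block, block]

theorem block_smul (J : Finitary cs) (c : ℤ[X]) (a : Hecke cs) (I : Finitary cs) :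
    S.block J (c • a) I = c • S.block J a I := by
  rw [block, map_smul, mul_smul_comm, smul_mul_assoc, block]

theorem block_zero (J I : Finitary cs) : S.block J 0 I = 0 := by
  rw [block, map_zero, mul_zero, zero_mul]

theorem block_one_self (I : Finitary cs) : S.block I 1 I = S.e I := by
  rw [block, map_one, mul_one, S.down_mul_up]

/-- The value of the homomorphism to `A` on an endomorphism `f`. -/
def psi (f : HeckeEnd cs) : A :=
  -- On $x_IH$ the component of $f$ at $J$ is left multiplication by $f(x_I)_J/\pi(I)$. Since
  -- $f(x_I)_J$ lies in $x_JH$, the projection $p_J$ built into `block` does not change it.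
  ∑ I, ∑ J, inv I • S.block J (endCoeff f J I) I

theorem psi_add (f g : HeckeEnd cs) : S.psi (f + g) = S.psi f + S.psi g := by
  simp only [psi, endCoeff_add, block_add, smul_add, Finset.sum_add_distrib]

theorem psi_sum {ι : Type*} (s : Finset ι) (f : ι → HeckeEnd cs) :
    S.psi (∑ i ∈ s, f i) = ∑ i ∈ s, S.psi (f i) :=
  map_sum (AddMonoidHom.mk' S.psi S.psi_add) f s

variable [Algebra ℤ[X] K] [IsScalarTower ℤ[X] K A]

/-- Multiply the block on the left by `block J 1 J`, which is $e_J$ and acts on it as the identity;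
`block_mul_block` computes the same product. -/
theorem block_xI_mul (hinv : ∀ I, algebraMap ℤ[X] K (poincare I) * inv I = 1)
    (J : Finitary cs) (a : Hecke cs) (I : Finitary cs) :
    S.block J (xI J * a) I = poincare J • S.block J a I := by
  have h := S.block_mul_block J 1 J a I
  rw [one_mul, S.block_one_self, block, ← mul_assoc, ← mul_assoc, S.e_mul_down, ← block] at h
  rw [h, poincare_smul_smul hinv]

theorem block_mul_xI (hinv : ∀ I, algebraMap ℤ[X] K (poincare I) * inv I = 1)
    (J : Finitary cs) (a : Hecke cs) (I : Finitary cs) :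
    S.block J (a * xI I) I = poincare I • S.block J a I := by
  have h := S.block_mul_block J a I 1 I
  rw [mul_one, S.block_one_self, block, mul_assoc, S.up_mul_e, ← block] at h
  rw [h, poincare_smul_smul hinv]

theorem psi_smul (c : ℤ[X]) (f : HeckeEnd cs) : S.psi (c • f) = c • S.psi f := by
  simp only [psi, endCoeff_smul, block_smul, Finset.smul_sum]
  refine Finset.sum_congr rfl fun I _ => Finset.sum_congr rfl fun J _ => ?_
  rw [← algebraMap_smul K c, ← algebraMap_smul K c, smul_smul, smul_smul, mul_comm]

theorem psi_mulEnd (hinv : ∀ I, algebraMap ℤ[X] K (poincare I) * inv I = 1)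
    (J : Finitary cs) (a : Hecke cs) (I : Finitary cs) :
    S.psi (mulEnd J a I) = poincare J • S.block J a I := by
  rw [psi, Finset.sum_eq_single I _ (by simp), Finset.sum_eq_single J _ (by simp)]
  · rw [mulEnd, endCoeff_blockEnd_self]
    change inv I • S.block J (xI J * (a * xI I)) I = _
    rw [S.block_xI_mul hinv, S.block_mul_xI hinv]
    rw [← algebraMap_smul K (poincare J), smul_comm, smul_poincare_smul hinv,
      algebraMap_smul]
  · intro J' _ h
    rw [mulEnd, endCoeff_blockEnd_of_ne_left _ h.symm, block_zero, smul_zero]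
  · intro I' _ h
    refine Finset.sum_eq_zero fun J' _ => ?_
    rw [mulEnd, endCoeff_blockEnd_of_ne_right _ _ h, block_zero, smul_zero]

theorem psi_projEnd (hinv : ∀ I, algebraMap ℤ[X] K (poincare I) * inv I = 1)
    (I : Finitary cs) : S.psi (projEnd I) = S.e I := by
  have h := S.psi_mulEnd hinv I 1 I
  rw [mulEnd_one_self, psi_smul, S.block_one_self] at h
  rw [← smul_poincare_smul hinv I (S.psi _), h, smul_poincare_smul hinv]

theorem psi_one (hinv : ∀ I, algebraMap ℤ[X] K (poincare I) * inv I = 1) :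
    S.psi 1 = 1 := by
  rw [← sum_projEnd, psi_sum, ← S.sum_e]
  exact Finset.sum_congr rfl fun I _ => S.psi_projEnd hinv I

/-- Two factors $1/\pi(J)$ have to cancel, one from `psi g` and one from the product of blocks. One
factor $\pi(J)$ arises because $x_J$ acts as $\pi(J)$ on the coefficient of `f`, the other from
`endCoeff_mul_endCoeff`. -/
theorem psi_mul (hinv : ∀ I, algebraMap ℤ[X] K (poincare I) * inv I = 1)
    (g f : HeckeEnd cs) : S.psi (g * f) = S.psi g * S.psi f := by
  have key (I J L : Finitary cs) :
      (inv J • S.block L (endCoeff g L J) J) * (inv I • S.block J (endCoeff f J I) I) =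
      inv I • S.block L (endCoeff (g * projEnd J * f) L I) I := by
    rw [smul_mul_assoc, mul_smul_comm, smul_comm, block_mul_block, mul_assoc,
      xI_mul_of_mem (endCoeff_mem f J I), mul_smul_comm, block_smul, smul_poincare_smul hinv,
      endCoeff_mul_endCoeff, block_smul, smul_poincare_smul hinv]
  have key' (I J J' L : Finitary cs) (h : J' ≠ J) :
      (inv J • S.block L (endCoeff g L J) J) * (inv I • S.block J' (endCoeff f J' I) I) = 0 := by
    rw [smul_mul_assoc, mul_smul_comm, S.block_mul_block_of_ne _ _ _ _ h, smul_zero, smul_zero]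
  have h1 : g * f = ∑ J : Finitary cs, g * projEnd J * f := by
    rw [← Finset.sum_mul, ← Finset.mul_sum, sum_projEnd, mul_one]
  have h2 : S.psi g * S.psi f = ∑ J, ∑ I, ∑ L,
      inv I • S.block L (endCoeff (g * projEnd J * f) L I) I := by
    simp only [psi, Finset.sum_mul_sum]
    refine Finset.sum_congr rfl fun J _ => Finset.sum_congr rfl fun I _ =>
      Finset.sum_congr rfl fun L _ => ?_
    rw [Finset.sum_eq_single J (fun J' _ h => key' I J J' L h) (by simp), key]
  rw [h2, h1, psi_sum]
  rfl

/-- The map `psi` as a homomorphism of algebras. -/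
def psiAlgHom (hinv : ∀ I, algebraMap ℤ[X] K (poincare I) * inv I = 1) : HeckeEnd cs →ₐ[ℤ[X]] A :=
  AlgHom.ofLinearMap ⟨⟨S.psi, S.psi_add⟩, S.psi_smul⟩ (S.psi_one hinv) (S.psi_mul hinv)

/-- The homomorphism from the base change of the Hecke endomorphism algebra defined by a hook
system. -/
def psiHom (hinv : ∀ I, algebraMap ℤ[X] K (poincare I) * inv I = 1) : K ⊗[ℤ[X]] HeckeEnd cs →ₐ[K] A :=
  Algebra.TensorProduct.lift (Algebra.ofId K A) (S.psiAlgHom hinv) fun c f =>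
    show Commute (Algebra.ofId K A c) (S.psiAlgHom hinv f) from Algebra.commutes c _

theorem psiHom_tmul (hinv : ∀ I, algebraMap ℤ[X] K (poincare I) * inv I = 1) (c : K)
    (f : HeckeEnd cs) : S.psiHom hinv (c ⊗ₜ f) = c • S.psi f := by
  rw [Algebra.smul_def]
  exact Algebra.TensorProduct.lift_tmul _ _ _ c f

end HookSystem

/-! ### The canonical hook elements of the base change -/

section Loc

variable {K : Type*} [CommRing K] [Algebra ℤ[X] K] (inv : Finitary cs → K)

variable (K) in
/-- The projection to `x_I H`. -/
def locProj (I : Finitary cs) : K ⊗[ℤ[X]] HeckeEnd cs := 1 ⊗ₜ projEnd I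

variable (K) in
/-- The inclusion of `x_I H` in `H`. -/
def locUp (I : Finitary cs) : K ⊗[ℤ[X]] HeckeEnd cs := 1 ⊗ₜ mulEnd (emptySet cs) 1 I

/-- The projection `x_I / π(I)` of `H` to `x_I H`. -/
def locDown (I : Finitary cs) : K ⊗[ℤ[X]] HeckeEnd cs := inv I ⊗ₜ mulEnd I 1 (emptySet cs)

variable (K cs) in
/-- The left multiplication on the summand `H`. -/
def locHecke : Hecke cs →ₗ[ℤ[X]] K ⊗[ℤ[X]] HeckeEnd cs :=
  (Algebra.TensorProduct.includeRight : HeckeEnd cs →ₐ[ℤ[X]] K ⊗[ℤ[X]] HeckeEnd cs).toLinearMap ∘ₗ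
    mulEndLin (emptySet cs) (emptySet cs)

theorem locHecke_apply (h : Hecke cs) :
    locHecke cs K h = 1 ⊗ₜ mulEnd (emptySet cs) h (emptySet cs) := rfl

theorem tmul_smul_eq (c : K) (d : ℤ[X]) (f : HeckeEnd cs) :
    c ⊗ₜ[ℤ[X]] (d • f) = (algebraMap ℤ[X] K d * c) ⊗ₜ f := by
  rw [← TensorProduct.smul_tmul, Algebra.smul_def]

theorem locProj_mul_self (I : Finitary cs) : locProj K I * locProj K I = locProj K I := by
  rw [locProj, Algebra.TensorProduct.tmul_mul_tmul, projEnd_mul_self, one_mul]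

theorem locProj_mul_of_ne {I J : Finitary cs} (h : I ≠ J) : locProj K I * locProj K J = 0 := by
  rw [locProj, locProj, Algebra.TensorProduct.tmul_mul_tmul, projEnd_mul_of_ne h,
    TensorProduct.tmul_zero]

theorem sum_locProj [Finite B] : ∑ I : Finitary cs, locProj K I = 1 := by
  simp only [locProj]
  rw [← TensorProduct.tmul_sum, sum_projEnd, Algebra.TensorProduct.one_def]

theorem locHecke_one : locHecke cs K 1 = locProj K (emptySet cs) := by
  rw [locHecke_apply, locProj, projEnd_emptySet]

theorem locHecke_mul (a b : Hecke cs) :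
    locHecke cs K (a * b) = locHecke cs K a * locHecke cs K b := by
  simp only [locHecke_apply]
  rw [Algebra.TensorProduct.tmul_mul_tmul, mulEnd_mul_mulEnd, xI_emptySet, one_mul, mul_one]

theorem locProj_mul_locUp (I : Finitary cs) :
    locProj K (emptySet cs) * locUp K I = locUp K I := by
  rw [locProj, locUp, Algebra.TensorProduct.tmul_mul_tmul, projEnd_mul_mulEnd, one_mul]

theorem locUp_mul_locProj (I : Finitary cs) : locUp K I * locProj K I = locUp K I := by
  rw [locProj, locUp, Algebra.TensorProduct.tmul_mul_tmul, mulEnd_mul_projEnd, one_mul]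

theorem locProj_mul_locDown (I : Finitary cs) : locProj K I * locDown inv I = locDown inv I := by
  rw [locProj, locDown, Algebra.TensorProduct.tmul_mul_tmul, projEnd_mul_mulEnd, one_mul]

theorem locDown_mul_locProj (I : Finitary cs) :
    locDown inv I * locProj K (emptySet cs) = locDown inv I := by
  rw [locProj, locDown, Algebra.TensorProduct.tmul_mul_tmul, mulEnd_mul_projEnd, mul_one]

theorem locUp_mul_locDown (I : Finitary cs) :
    locUp K I * locDown inv I = inv I • locHecke cs K (xI I) := by
  rw [locUp, locDown, Algebra.TensorProduct.tmul_mul_tmul, mulEnd_mul_mulEnd, locHecke_apply,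
    one_mul, one_mul, mul_one, TensorProduct.smul_tmul', smul_eq_mul, mul_one]

theorem locUp_emptySet : locUp K (emptySet cs) = locProj K (emptySet cs) := by
  rw [locUp, locProj, projEnd_emptySet]

variable {inv}

theorem locDown_emptySet (hinv : ∀ I, algebraMap ℤ[X] K (poincare I) * inv I = 1) :
    locDown inv (emptySet cs) = locProj K (emptySet cs) := by
  have h := hinv (emptySet cs)
  rw [poincare_emptySet, map_one, one_mul] at h
  rw [locDown, locProj, projEnd_emptySet, h]

theorem locDown_mul_locUp (hinv : ∀ I, algebraMap ℤ[X] K (poincare I) * inv I = 1)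
    (I : Finitary cs) : locDown inv I * locUp K I = locProj K I := by
  rw [locUp, locDown, Algebra.TensorProduct.tmul_mul_tmul, mulEnd_mul_mulEnd, xI_emptySet,
    mul_one, mul_one, mul_one, mulEnd_one_self, tmul_smul_eq, hinv, locProj]

/-- For $I\subseteq J$ the idempotent $p_I$ fixes $x_JH\subseteq x_IH$, as $x_Ix_J=\pi(I)x_J$.
Together with the dual statement $p_Jp_I=p_J$ this accounts for the idempotent and the sandwich
relations. -/
theorem locUp_mul_locDown_mul_locUp (hinv : ∀ I, algebraMap ℤ[X] K (poincare I) * inv I = 1)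
    {I J : Finitary cs} (h : I.1 ⊆ J.1) : locUp K I * locDown inv I * locUp K J = locUp K J := by
  have h' : mulEnd (emptySet cs) (xI I) J = poincare I • mulEnd (emptySet cs) 1 J := by
    rw [← mulEnd_smul]
    apply mulEnd_congr_right
    rw [xI_mul_xI_of_subset h, smul_mul_assoc, one_mul]
  rw [locUp_mul_locDown, smul_mul_assoc, locHecke_apply, locUp,
    Algebra.TensorProduct.tmul_mul_tmul, mulEnd_mul_mulEnd, xI_emptySet]
  simp only [mul_one]
  rw [h', tmul_smul_eq, TensorProduct.smul_tmul', smul_eq_mul, mul_one, mul_comm, hinv]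

theorem locDown_mul_locUp_mul_locDown (hinv : ∀ I, algebraMap ℤ[X] K (poincare I) * inv I = 1)
    {I J : Finitary cs} (h : I.1 ⊆ J.1) :
    locDown inv J * (locUp K I * locDown inv I) = locDown inv J := by
  have h' : mulEnd J (xI I) (emptySet cs) = poincare I • mulEnd J 1 (emptySet cs) := by
    rw [← mulEnd_smul]
    apply mulEnd_congr_left
    rw [xI_mul_xI_of_superset h, mul_smul_comm, mul_one]
  rw [locUp_mul_locDown, mul_smul_comm, locHecke_apply, locDown,
    Algebra.TensorProduct.tmul_mul_tmul, mulEnd_mul_mulEnd, xI_emptySet]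
  simp only [mul_one, one_mul]
  rw [h', tmul_smul_eq, TensorProduct.smul_tmul', smul_eq_mul, ← mul_assoc, mul_comm (inv I),
    hinv, one_mul]

namespace HookSystem

variable [Finite B] {A : Type*} [Ring A] [Algebra K A] [Algebra ℤ[X] A]
  [IsScalarTower ℤ[X] K A] (S : HookSystem cs inv A)

theorem psiHom_locProj (hinv : ∀ I, algebraMap ℤ[X] K (poincare I) * inv I = 1)
    (I : Finitary cs) : S.psiHom hinv (locProj K I) = S.e I := by
  rw [locProj, psiHom_tmul, one_smul, S.psi_projEnd hinv]

theorem psiHom_locUp (hinv : ∀ I, algebraMap ℤ[X] K (poincare I) * inv I = 1)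
    (I : Finitary cs) : S.psiHom hinv (locUp K I) = S.up I := by
  rw [locUp, psiHom_tmul, one_smul, S.psi_mulEnd hinv, poincare_emptySet, one_smul, block,
    map_one, mul_one, S.down_empty, S.e_mul_up]

theorem psiHom_locDown (hinv : ∀ I, algebraMap ℤ[X] K (poincare I) * inv I = 1)
    (I : Finitary cs) : S.psiHom hinv (locDown inv I) = S.down I := by
  rw [locDown, psiHom_tmul, S.psi_mulEnd hinv, smul_poincare_smul hinv, block, map_one, mul_one,
    S.up_empty, S.down_mul_e]

/-- The values on `up` and `down` also fix $\varphi$ on the Hecke action, because `up * down` at a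
singleton encodes $T_s+1$. Hence $\varphi$ takes blocks to multiplication maps, and
`mulEnd_endCoeff` turns those of the coefficients of `f` back into the components of `f`, which sum
to `f`. -/
theorem comp_psiHom (hinv : ∀ I, algebraMap ℤ[X] K (poincare I) * inv I = 1)
    (φ : A →ₐ[K] K ⊗[ℤ[X]] HeckeEnd cs)
    (he : φ (S.e (emptySet cs)) = locProj K (emptySet cs))
    (hu : ∀ I, φ (S.up I) = locUp K I) (hd : ∀ I, φ (S.down I) = locDown inv I) :
    φ.comp (S.psiHom hinv) = AlgHom.id K _ := by
  have hφ (c : ℤ[X]) (x : A) : φ (c • x) = c • φ x := by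
    rw [← algebraMap_smul K c x, map_smul, algebraMap_smul]
  have h1 (h : Hecke cs) : φ (S.e (emptySet cs) * S.hecke h) = locHecke cs K h := by
    induction h using hecke_induction with
    | hc c =>
      rw [Algebra.algebraMap_eq_smul_one, map_smul, map_one, mul_smul_comm, mul_one, hφ, he,
        map_smul, locHecke_one]
    | hT s =>
      have hx : heckeT cs s = xI (singletonSet cs s) - 1 := by
        rw [xI_singletonSet, add_sub_cancel_right]
      have h2 := congrArg φ (S.up_mul_down (singletonSet cs s))
      rw [map_mul, hu, hd, locUp_mul_locDown, map_smul] at h2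
      have h3 := congrArg (fun x => algebraMap ℤ[X] K (poincare (singletonSet cs s)) • x) h2
      simp only [smul_smul, hinv, one_smul] at h3
      rw [hx, map_sub, map_sub, mul_sub, map_one, mul_one, map_sub, he, locHecke_one, h3]
    | hadd a b ha hb => rw [map_add, mul_add, map_add, ha, hb, map_add]
    | hmul a b ha hb =>
      have : S.e (emptySet cs) * S.hecke (a * b) =
          (S.e (emptySet cs) * S.hecke a) * (S.e (emptySet cs) * S.hecke b) := by
        rw [map_mul, mul_assoc (S.e _) (S.hecke a), ← mul_assoc (S.hecke a), ← S.commute a,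
          mul_assoc (S.e _) (S.hecke a), ← mul_assoc (S.e _) (S.e _), S.e_mul_self]
      rw [this, map_mul, ha, hb, locHecke_mul]
  have h2 (J : Finitary cs) (a : Hecke cs) (I : Finitary cs) :
      φ (S.block J a I) = inv J ⊗ₜ mulEnd J a I := by
    rw [HookSystem.block, ← S.down_mul_e, mul_assoc (S.down J), map_mul, map_mul, h1, hd, hu,
      locDown, locHecke_apply, locUp, Algebra.TensorProduct.tmul_mul_tmul,
      Algebra.TensorProduct.tmul_mul_tmul, mulEnd_mul_mulEnd, mulEnd_mul_mulEnd, xI_emptySet]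
    simp only [mul_one, one_mul]
  refine Algebra.TensorProduct.ext (by ext) ?_
  ext1 f
  change φ (S.psiHom hinv (1 ⊗ₜ f)) = 1 ⊗ₜ f
  rw [S.psiHom_tmul, one_smul, HookSystem.psi, map_sum]
  have h3 (I J : Finitary cs) : φ (inv I • S.block J (endCoeff f J I) I) =
      1 ⊗ₜ (projEnd J * f * projEnd I) := by
    have h4 : inv I * (algebraMap ℤ[X] K (poincare J * poincare I) * inv J) = 1 := by
      rw [map_mul]
      linear_combination (algebraMap ℤ[X] K (poincare I) * inv I) * hinv J + hinv I
    rw [map_smul, h2, mulEnd_endCoeff, tmul_smul_eq, TensorProduct.smul_tmul', smul_eq_mul, h4]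
  simp only [map_sum, h3, ← TensorProduct.tmul_sum]
  congr 1
  simp only [← Finset.sum_mul, ← Finset.mul_sum, sum_projEnd, one_mul, mul_one]

end HookSystem

end Loc

end HeckeEndo

end

noncomputable section

namespace HeckeEndo

open CoxeterSystem

variable {B W : Type*} [Group W] {M : CoxeterMatrix B} {cs : CoxeterSystem M W}

/-! ### Hook systems from corner generators -/

section Corner

variable {A : Type*} [Ring A] {e : A} {x : B → A}

theorem cornerProd_cons (hl : ∀ s, e * x s = x s) (hr : ∀ s, x s * e = x s)
    (s : B) (ω : List B) : cornerProd e x (s :: ω) = x s * cornerProd e x ω := by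
  rw [cornerProd, cornerProd, List.map_cons, List.prod_cons, ← mul_assoc, hl, ← mul_assoc, hr]

/-- The Hecke generators act on all of `A` as $\chi_s-1$, whereas the relations in the path algebras
speak of $\chi_s-e$ in the corner of $e$. Multiplied by $e$, the two products agree. -/
theorem cornerProd_sub_one (he : e * e = e) (hl : ∀ s, e * x s = x s) (hr : ∀ s, x s * e = x s)
    (ω : List B) : cornerProd e (fun s => x s - 1) ω = cornerProd e (fun s => x s - e) ω := by
  induction ω with
  | nil => rfl
  | cons s ω ih =>
    rw [cornerProd_cons (x := fun s => x s - e) (fun s => by rw [mul_sub, hl, he])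
      (fun s => by rw [sub_mul, hr, he]), ← ih, cornerProd, cornerProd, List.map_cons,
      List.prod_cons, ← mul_assoc, ← mul_assoc, mul_sub, hl, mul_one, sub_mul (x s) e e, hr, he]

/-- On the complement of the corner every $x_s-1$ acts as $-1$, so only the length of the word
matters. A braid relation that holds in the corner thus holds in the whole algebra, as its two words
have equal length. -/
theorem one_sub_mul_prod (hl : ∀ s, e * x s = x s) (ω : List B) :
    (1 - e) * (ω.map fun s => x s - 1).prod = (-1) ^ ω.length * (1 - e) := by
  induction ω with
  | nil => simp
  | cons s ω ih =>
    have h : (1 - e) * (x s - 1) = -(1 - e) := by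
      rw [sub_mul, mul_sub e, hl, one_mul, mul_one]
      abel
    rw [List.map_cons, List.prod_cons, ← mul_assoc, h, neg_mul, ih, List.length_cons, pow_succ',
      neg_one_mul, neg_mul]

theorem prod_eq_of_cornerProd_eq (hl : ∀ s, e * x s = x s) {ω ω' : List B}
    (hlen : ω.length = ω'.length)
    (h : cornerProd e (fun s => x s - 1) ω = cornerProd e (fun s => x s - 1) ω') :
    (ω.map fun s => x s - 1).prod = (ω'.map fun s => x s - 1).prod := by
  have h1 (η : List B) : (η.map fun s => x s - 1).prod =
      cornerProd e (fun s => x s - 1) η + (-1) ^ η.length * (1 - e) := by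
    rw [← one_sub_mul_prod hl, cornerProd, ← add_mul, add_sub_cancel, one_mul]
  rw [h1, h1, h, hlen]

end Corner

/-- The part of a hook system that does not involve the action of the Hecke algebra, with the braid
relations on the generators `χ_s = (q + 1) υ_s δ_s`. -/
structure BraidSystem (cs : CoxeterSystem M W) [Finite B] (A : Type*) [Ring A]
    [Algebra ℤ[X] A] where
  e : Finitary cs → A
  up : Finitary cs → A
  down : Finitary cs → A
  e_mul_of_ne : ∀ {I J}, I ≠ J → e I * e J = 0
  sum_e : ∑ I, e I = 1
  up_mul_e : ∀ I, up I * e I = up I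
  e_mul_down : ∀ I, e I * down I = down I
  e_mul_up : ∀ I, e (emptySet cs) * up I = up I
  down_mul_e : ∀ I, down I * e (emptySet cs) = down I
  down_mul_up : ∀ I, down I * up I = e I
  up_empty : up (emptySet cs) = e (emptySet cs)
  down_empty : down (emptySet cs) = e (emptySet cs)
  braid : ∀ s t,
    cornerProd (e (emptySet cs)) (fun s => (q + 1) • (up (singletonSet cs s) *
      down (singletonSet cs s)) - 1) (braidWord M s t) =
    cornerProd (e (emptySet cs)) (fun s => (q + 1) • (up (singletonSet cs s) *
      down (singletonSet cs s)) - 1) (braidWord M t s)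

theorem length_braidWord (s t : B) : (braidWord M s t).length = (braidWord M t s).length := by
  rw [braidWord, braidWord, length_alternatingWord, length_alternatingWord, M.symmetric]

/-- The quadratic relation for `χ - 1`, where `χ² = (q + 1) χ`. -/
theorem sub_one_mul_sub_one {A : Type*} [Ring A] [Algebra ℤ[X] A] {x : A}
    (h : x * x = (q + 1) • x) : (x - 1) * (x - 1) = (q - 1) • (x - 1) + q • (1 : A) := by
  rw [sub_mul, mul_sub, mul_one, one_mul, h]
  module

namespace BraidSystem

variable [Finite B] {A : Type*} [Ring A] [Algebra ℤ[X] A] (S : BraidSystem cs A)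

theorem e_mul_self (I : Finitary cs) : S.e I * S.e I = S.e I := by
  nth_rw 2 [← S.down_mul_up I]
  rw [← mul_assoc, S.e_mul_down, S.down_mul_up]

/-- The element `χ_s`. -/
def chi (s : B) : A := (q + 1) • (S.up (singletonSet cs s) * S.down (singletonSet cs s))

theorem chi_mul_self (s : B) : S.chi s * S.chi s = (q + 1) • S.chi s := by
  rw [chi, smul_mul_assoc, mul_smul_comm, mul_assoc, ← mul_assoc (S.down _), S.down_mul_up,
    S.e_mul_down]

theorem e_mul_chi (s : B) : S.e (emptySet cs) * S.chi s = S.chi s := by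
  rw [chi, mul_smul_comm, ← mul_assoc, S.e_mul_up]

theorem chi_mul_e (s : B) : S.chi s * S.e (emptySet cs) = S.chi s := by
  rw [chi, smul_mul_assoc, mul_assoc, S.down_mul_e]

/-- The homomorphism from the Hecke algebra that maps `T_s` to `χ_s - 1`. -/
def hecke : Hecke cs →ₐ[ℤ[X]] A :=
  heckeLift (fun s => S.chi s - 1) (fun s => sub_one_mul_sub_one (S.chi_mul_self s)) fun s t =>
    prod_eq_of_cornerProd_eq S.e_mul_chi (length_braidWord s t) (S.braid s t)

theorem hecke_heckeT (s : B) : S.hecke (heckeT cs s) = S.chi s - 1 := heckeLift_heckeT _ _ _ _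

theorem e_mul_hecke (h : Hecke cs) :
    S.e (emptySet cs) * S.hecke h = S.hecke h * S.e (emptySet cs) := by
  induction h using hecke_induction with
  | hc c => rw [AlgHom.commutes, Algebra.commutes]
  | hT s => rw [hecke_heckeT, mul_sub, sub_mul, e_mul_chi, chi_mul_e, one_mul, mul_one]
  | hadd a b ha hb => rw [map_add, mul_add, add_mul, ha, hb]
  | hmul a b ha hb => rw [map_mul, ← mul_assoc, ha, mul_assoc, hb, mul_assoc]

theorem hecke_prod (ω : List B) : S.hecke (ω.map (heckeT cs)).prod =
    (ω.map fun s => S.chi s - 1).prod := by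
  rw [map_list_prod, List.map_map]
  congr 2
  funext s
  exact S.hecke_heckeT s

theorem e_mul_hecke_heckeTw (w : W) : S.e (emptySet cs) * S.hecke (heckeTw cs w) =
    cornerProd (S.e (emptySet cs)) (fun s => S.chi s - S.e (emptySet cs)) (redWord cs w) := by
  rw [← cornerProd_sub_one (S.e_mul_self _) S.e_mul_chi S.chi_mul_e, cornerProd, heckeTw,
    hecke_prod]

/-- A braid system with the hook relations is a hook system. -/
def toHookSystem {K : Type*} [CommRing K] {inv : Finitary cs → K} [Algebra K A]
    (h : ∀ I, S.up I * S.down I = inv I • (S.e (emptySet cs) * S.hecke (xI I))) :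
    HookSystem cs inv A where
  e := S.e
  up := S.up
  down := S.down
  hecke := S.hecke
  e_mul_of_ne := S.e_mul_of_ne
  sum_e := S.sum_e
  up_mul_e := S.up_mul_e
  e_mul_down := S.e_mul_down
  e_mul_up := S.e_mul_up
  down_mul_e := S.down_mul_e
  commute := S.e_mul_hecke
  up_mul_down := h
  down_mul_up := S.down_mul_up
  up_empty := S.up_empty
  down_empty := S.down_empty

end BraidSystem

/-! ### The canonical elements and the Hecke generators -/

section Loc

variable {K : Type*} [CommRing K] [Algebra ℤ[X] K] {inv : Finitary cs → K}

theorem smul_locUp_mul_locDown_singletonSet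
    (hinv : ∀ I, algebraMap ℤ[X] K (poincare I) * inv I = 1) (s : B) :
    algebraMap ℤ[X] K (q + 1) • (locUp K (singletonSet cs s) * locDown inv (singletonSet cs s)) =
      locHecke cs K (heckeT cs s + 1) := by
  rw [locUp_mul_locDown, smul_smul, ← poincare_singletonSet (cs := cs) s, hinv, one_smul,
    xI_singletonSet]

theorem cornerProd_locHecke (f : B → Hecke cs) (ω : List B) :
    cornerProd (locProj K (emptySet cs)) (fun s => locHecke cs K (f s)) ω =
      locHecke cs K (ω.map f).prod := by
  induction ω with
  | nil => rw [cornerProd, List.map_nil, List.map_nil, List.prod_nil, List.prod_nil, mul_one,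
      locHecke_one]
  | cons s ω ih =>
    rw [cornerProd_cons, ih, List.map_cons, List.prod_cons, locHecke_mul]
    · intro s
      rw [← locHecke_one, ← locHecke_mul, one_mul]
    · intro s
      rw [← locHecke_one, ← locHecke_mul, mul_one]

end Loc

end HeckeEndo

end

/-! ### The presentation by the quiver $Q$. -/

noncomputable section

namespace HeckeEndo

open CoxeterSystem

variable {B W : Type*} [Group W] {M : CoxeterMatrix B} {cs : CoxeterSystem M W}

/-! ### The quiver with arrows to and from the empty set -/

theorem emptySet_of_not_nonempty {I : Finitary cs} (h : ¬ I.1.Nonempty) : I = emptySet cs :=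
  Subtype.ext (Finset.not_nonempty_iff_eq_empty.1 h)

theorem not_nonempty_emptySet : ¬ (emptySet cs).1.Nonempty := Finset.not_nonempty_empty

theorem map_cornerProd {A A' F : Type*} [Ring A] [Ring A'] [FunLike F A A'] [RingHomClass F A A']
    (φ : F) (e : A) (t : B → A) (ω : List B) :
    φ (cornerProd e t ω) = cornerProd (φ e) (fun s => φ (t s)) ω := by
  rw [cornerProd, cornerProd, map_mul, map_list_prod, List.map_map]
  rfl

/-- An algebra over the localisation as an algebra over the polynomials. -/
abbrev polyAlgebra (A : Type*) [Ring A] [Algebra LocRing A] : Algebra ℤ[X] A :=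
  Algebra.compHom A (algebraMap ℤ[X] LocRing)

theorem isScalarTower_polyAlgebra (A : Type*) [Ring A] [Algebra LocRing A] :
    @IsScalarTower ℤ[X] LocRing A _ _ (polyAlgebra A).toSMul := by
  let := polyAlgebra A
  refine ⟨fun c k a => ?_⟩
  have h : c • k = algebraMap ℤ[X] LocRing c * k := Algebra.smul_def c k
  rw [h]
  exact mul_smul (algebraMap ℤ[X] LocRing c) k a

theorem add_one_smul_polyAlgebra {A : Type*} [Ring A] [Algebra LocRing A] (a : A) :
    (polyAlgebra A).toSMul.smul (q + 1) a = (1 + qR) • a := by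
  change algebraMap ℤ[X] LocRing (q + 1) • a = _
  rw [map_add, map_one, add_comm]
  rfl

theorem starE_mul_self (I : Finitary cs) : starE I * starE I = starE I :=
  PathAlgebra.vertex_mul_self _

section Generic

variable {K : Type*} [CommRing K] [Algebra ℤ[X] K] {inv : Finitary cs → K}

theorem locUp_mul_locDown_eq_sum (I : Finitary cs) : locUp K I * locDown inv I =
    inv I • ∑ w : parabolic cs I.1, cornerProd (locProj K (emptySet cs))
      (fun s => locHecke cs K (heckeT cs s)) (redWord cs w.1) := by
  rw [locUp_mul_locDown, xI, map_sum]
  congr 2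
  funext w
  rw [cornerProd_locHecke, heckeTw]

theorem smul_sub_locProj (hinv : ∀ I, algebraMap ℤ[X] K (poincare I) * inv I = 1) (s : B) :
    (1 + algebraMap ℤ[X] K q) •
      (locUp K (singletonSet cs s) * locDown inv (singletonSet cs s)) -
      locProj K (emptySet cs) = locHecke cs K (heckeT cs s) := by
  have h := smul_locUp_mul_locDown_singletonSet hinv s
  rw [map_add, map_one, add_comm] at h
  rw [h, ← locHecke_one, map_add, add_sub_cancel_right]

theorem cornerProd_braidWord (s t : B) :
    cornerProd (locProj K (emptySet cs)) (fun s => locHecke cs K (heckeT cs s)) (braidWord M s t) =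
    cornerProd (locProj K (emptySet cs)) (fun s => locHecke cs K (heckeT cs s))
      (braidWord M t s) := by
  rw [cornerProd_locHecke, cornerProd_locHecke, heckeT_braid]

variable (inv) in
/-- The value of an arrow of the quiver in the base change of the Hecke endomorphism algebra. -/
def starArr : {I J : Finitary cs} → StarArrow I J → K ⊗[ℤ[X]] HeckeEnd cs
  | _, _, .up I _ => locUp K I
  | _, _, .down I _ => locDown inv I

end Generic

variable [Finite B]

theorem sum_starQuiver {A : Type*} [AddCommMonoid A] (f : Finitary cs → A) :
    ∑ a ∈ (Set.toFinite (Set.univ : Set (StarQuiver cs))).toFinset, f a.set = ∑ I, f I :=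
  Finset.sum_bij (fun a _ => a.set) (fun _ _ => Finset.mem_univ _)
    (fun ⟨_⟩ _ ⟨_⟩ _ h => congrArg _ h) (fun I _ => ⟨⟨I⟩, by simp, rfl⟩) fun _ _ => rfl

/-- The canonical representation of the quiver in the base change of the Hecke endomorphism
algebra. -/
def starData {K : Type*} [CommRing K] [Algebra ℤ[X] K] (inv : Finitary cs → K) :
    PathAlgebra.Data (StarQuiver cs) (K ⊗[ℤ[X]] HeckeEnd cs) where
  vert a := locProj K a.set
  arr f := starArr inv f
  vert_mul_self a := locProj_mul_self a.set
  vert_mul_of_ne {a b} h := locProj_mul_of_ne fun h' => h (by cases a; cases b; exact congrArg _ h')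
  sum_vert := (sum_starQuiver fun I => locProj K I).trans sum_locProj
  vert_mul_arr {a b} f := by
    obtain ⟨a⟩ := a
    obtain ⟨b⟩ := b
    change StarArrow a b at f
    cases f with
    | up _ h => exact locProj_mul_locUp _
    | down _ h => exact locProj_mul_locDown _ _
  arr_mul_vert {a b} f := by
    obtain ⟨a⟩ := a
    obtain ⟨b⟩ := b
    change StarArrow a b at f
    cases f with
    | up _ h => exact locUp_mul_locProj _
    | down _ h => exact locDown_mul_locProj _ _

theorem starData_lift_starTau (s : B) :
    (starData (invPoincare (cs := cs))).lift LocRing (starTau cs s) =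
      locHecke cs LocRing (heckeT cs s) := by
  rw [← smul_sub_locProj algebraMap_poincare_mul_invPoincare, starTau, map_sub, map_smul, map_mul]
  erw [PathAlgebra.Data.lift_arrow, PathAlgebra.Data.lift_arrow, PathAlgebra.Data.lift_vertex]
  rfl

variable (cs) in
/-- The homomorphism from the quotient of the path algebra to the base change of the Hecke
endomorphism algebra. -/
def starHom : StarAlgebra cs →ₐ[LocRing] LocHeckeEnd cs :=
  RingQuot.liftAlgHom LocRing ⟨(starData invPoincare).lift LocRing, by
    have hv (I : Finitary cs) : (starData (invPoincare (cs := cs))).lift LocRing (starE I) =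
      locProj LocRing I := PathAlgebra.Data.lift_vertex _ _
    have hu (I : Finitary cs) (h) : (starData (invPoincare (cs := cs))).lift LocRing (starUp I h) =
      locUp LocRing I := PathAlgebra.Data.lift_arrow _ _
    have hd (I : Finitary cs) (h) : (starData (invPoincare (cs := cs))).lift LocRing
      (starDown I h) = locDown invPoincare I := PathAlgebra.Data.lift_arrow _ _
    have ht : (fun s => (starData (invPoincare (cs := cs))).lift LocRing (starTau cs s)) =
      fun s => locHecke cs LocRing (heckeT cs s) := funext starData_lift_starTau
    intro x y h
    cases h with
    | braid s t =>
      rw [map_cornerProd, map_cornerProd, ht, hv, cornerProd_braidWord]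
    | hook I h =>
      rw [map_mul, hu, hd, locUp_mul_locDown_eq_sum, pSubst, map_smul, map_sum]
      congr 2
      funext w
      rw [map_cornerProd, ht, hv]
    | idem I h =>
      rw [map_mul, hu, hd, hv, locDown_mul_locUp algebraMap_poincare_mul_invPoincare]⟩


theorem starHom_mk (x : StarPathAlgebra cs) : starHom cs (RingQuot.mkAlgHom LocRing (StarRel cs) x) =
    (starData invPoincare).lift LocRing x :=
  RingQuot.liftAlgHom_mkAlgHom_apply _ _ _ _

instance : Algebra ℤ[X] (StarAlgebra cs) := polyAlgebra (StarAlgebra cs)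

instance : IsScalarTower ℤ[X] LocRing (StarAlgebra cs) := isScalarTower_polyAlgebra _

open Classical in
/-- The image of `υ_I`, which is `e_∅` for the empty set. -/
def starAlgUp (I : Finitary cs) : StarAlgebra cs :=
  RingQuot.mkAlgHom LocRing (StarRel cs)
    (if h : I.1.Nonempty then starUp I h else starE (emptySet cs))

open Classical in
/-- The image of `δ_I`, which is `e_∅` for the empty set. -/
def starAlgDown (I : Finitary cs) : StarAlgebra cs :=
  RingQuot.mkAlgHom LocRing (StarRel cs)
    (if h : I.1.Nonempty then starDown I h else starE (emptySet cs))

theorem starAlgUp_of_nonempty {I : Finitary cs} (h : I.1.Nonempty) :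
    starAlgUp I = RingQuot.mkAlgHom LocRing (StarRel cs) (starUp I h) := by
  rw [starAlgUp, dif_pos h]

theorem starAlgDown_of_nonempty {I : Finitary cs} (h : I.1.Nonempty) :
    starAlgDown I = RingQuot.mkAlgHom LocRing (StarRel cs) (starDown I h) := by
  rw [starAlgDown, dif_pos h]

theorem starAlgUp_emptySet : starAlgUp (emptySet cs) =
    RingQuot.mkAlgHom LocRing (StarRel cs) (starE (emptySet cs)) := by
  rw [starAlgUp, dif_neg not_nonempty_emptySet]

theorem starAlgDown_emptySet : starAlgDown (emptySet cs) =
    RingQuot.mkAlgHom LocRing (StarRel cs) (starE (emptySet cs)) := by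
  rw [starAlgDown, dif_neg not_nonempty_emptySet]

theorem mk_starTau (s : B) : RingQuot.mkAlgHom LocRing (StarRel cs) (starTau cs s) =
    (q + 1) • (starAlgUp (singletonSet cs s) * starAlgDown (singletonSet cs s)) -
      RingQuot.mkAlgHom LocRing (StarRel cs) (starE (emptySet cs)) := by
  have h : (singletonSet cs s).1.Nonempty := Finset.singleton_nonempty s
  rw [starAlgUp_of_nonempty h, starAlgDown_of_nonempty h, starTau, map_sub, map_smul, map_mul]
  exact congrArg (· - _) (add_one_smul_polyAlgebra _).symm

theorem mk_starE_mul_starAlgUp (I : Finitary cs) :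
    RingQuot.mkAlgHom LocRing (StarRel cs) (starE (emptySet cs)) * starAlgUp I = starAlgUp I := by
  by_cases h : I.1.Nonempty
  · rw [starAlgUp_of_nonempty h, ← map_mul]
    exact congrArg _ (PathAlgebra.vertex_mul_arrow _)
  · rw [emptySet_of_not_nonempty h, starAlgUp_emptySet, ← map_mul, starE_mul_self]

theorem starAlgUp_mul_mk_starE (I : Finitary cs) :
    starAlgUp I * RingQuot.mkAlgHom LocRing (StarRel cs) (starE I) = starAlgUp I := by
  by_cases h : I.1.Nonempty
  · rw [starAlgUp_of_nonempty h, ← map_mul]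
    exact congrArg _ (PathAlgebra.arrow_mul_vertex _)
  · rw [emptySet_of_not_nonempty h, starAlgUp_emptySet, ← map_mul, starE_mul_self]

theorem mk_starE_mul_starAlgDown (I : Finitary cs) :
    RingQuot.mkAlgHom LocRing (StarRel cs) (starE I) * starAlgDown I = starAlgDown I := by
  by_cases h : I.1.Nonempty
  · rw [starAlgDown_of_nonempty h, ← map_mul]
    exact congrArg _ (PathAlgebra.vertex_mul_arrow _)
  · rw [emptySet_of_not_nonempty h, starAlgDown_emptySet, ← map_mul, starE_mul_self]

theorem starAlgDown_mul_mk_starE (I : Finitary cs) :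
    starAlgDown I * RingQuot.mkAlgHom LocRing (StarRel cs) (starE (emptySet cs)) =
      starAlgDown I := by
  by_cases h : I.1.Nonempty
  · rw [starAlgDown_of_nonempty h, ← map_mul]
    exact congrArg _ (PathAlgebra.arrow_mul_vertex _)
  · rw [emptySet_of_not_nonempty h, starAlgDown_emptySet, ← map_mul, starE_mul_self]

variable (cs) in
/-- The braid system of the quotient of the path algebra. -/
def starBraidSystem : BraidSystem cs (StarAlgebra cs) where
  e I := RingQuot.mkAlgHom LocRing (StarRel cs) (starE I)
  up := starAlgUp
  down := starAlgDown
  e_mul_of_ne {I J} h := by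
    rw [← map_mul, starE, starE, PathAlgebra.vertex_mul_of_ne, map_zero]
    exact fun h' => h (congrArg StarQuiver.set h')
  sum_e := by
    rw [← map_sum, ← sum_starQuiver]
    exact map_one _
  up_mul_e := starAlgUp_mul_mk_starE
  e_mul_down := mk_starE_mul_starAlgDown
  e_mul_up := mk_starE_mul_starAlgUp
  down_mul_e := starAlgDown_mul_mk_starE
  down_mul_up I := by
    by_cases h : I.1.Nonempty
    · rw [starAlgDown_of_nonempty h, starAlgUp_of_nonempty h, ← map_mul]
      exact RingQuot.mkAlgHom_rel LocRing (StarRel.idem I h)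
    · rw [emptySet_of_not_nonempty h, starAlgDown_emptySet, starAlgUp_emptySet, ← map_mul,
        starE_mul_self]
  up_empty := starAlgUp_emptySet
  down_empty := starAlgDown_emptySet
  braid s t := by
    have h := RingQuot.mkAlgHom_rel LocRing (StarRel.braid (cs := cs) s t)
    rw [map_cornerProd, map_cornerProd] at h
    simp only [mk_starTau] at h
    rwa [cornerProd_sub_one, cornerProd_sub_one]
    all_goals first
      | rw [← map_mul, starE_mul_self]
      | intro s
        first
          | rw [mul_smul_comm, ← mul_assoc, mk_starE_mul_starAlgUp]
          | rw [smul_mul_assoc, mul_assoc, starAlgDown_mul_mk_starE]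

variable (cs) in
/-- The hook system of the quotient of the path algebra. -/
def starHookSystem : HookSystem cs (invPoincare (cs := cs)) (StarAlgebra cs) :=
  (starBraidSystem cs).toHookSystem fun I => by
    change starAlgUp I * starAlgDown I = _
    have h0 : (starBraidSystem cs).e (emptySet cs) * (starBraidSystem cs).hecke (xI I) =
        ∑ w : parabolic cs I.1, RingQuot.mkAlgHom LocRing (StarRel cs)
          (cornerProd (starE (emptySet cs)) (starTau cs) (redWord cs w.1)) := by
      rw [xI, map_sum, Finset.mul_sum]
      refine Finset.sum_congr rfl fun w _ => ?_
      rw [BraidSystem.e_mul_hecke_heckeTw, map_cornerProd]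
      simp only [mk_starTau]
      rfl
    rw [h0, ← map_sum, ← map_smul]
    by_cases h : I.1.Nonempty
    · rw [starAlgUp_of_nonempty h, starAlgDown_of_nonempty h, ← map_mul]
      exact RingQuot.mkAlgHom_rel LocRing (StarRel.hook I h)
    -- There is no hook relation at the empty set; it holds automatically because $x_\emptyset=1$
    -- and $\pi(\emptyset)=1$.
    · obtain rfl := emptySet_of_not_nonempty h
      rw [map_smul, map_sum, ← h0, xI_emptySet, map_one, mul_one, invPoincare_emptySet,
        starAlgUp_emptySet, starAlgDown_emptySet, ← map_mul, starE_mul_self]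
      exact (one_smul LocRing (_ : StarAlgebra cs)).symm

variable (cs) in
/-- The quotient of the path algebra is the base change of the Hecke endomorphism algebra. -/
def starEquiv : StarAlgebra cs ≃ₐ[LocRing] LocHeckeEnd cs :=
  AlgEquiv.ofAlgHom (starHom cs)
    ((starHookSystem cs).psiHom algebraMap_poincare_mul_invPoincare)
    (by
      refine (starHookSystem cs).comp_psiHom algebraMap_poincare_mul_invPoincare _ ?_
        (fun I => ?_) fun I => ?_
      · exact (starHom_mk _).trans (PathAlgebra.Data.lift_vertex _ _)
      · change starHom cs (starAlgUp I) = _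
        by_cases h : I.1.Nonempty
        · rw [starAlgUp_of_nonempty h]
          exact (starHom_mk _).trans (PathAlgebra.Data.lift_arrow _ _)
        · rw [emptySet_of_not_nonempty h, starAlgUp_emptySet, locUp_emptySet]
          exact (starHom_mk _).trans (PathAlgebra.Data.lift_vertex _ _)
      · change starHom cs (starAlgDown I) = _
        by_cases h : I.1.Nonempty
        · rw [starAlgDown_of_nonempty h]
          exact (starHom_mk _).trans (PathAlgebra.Data.lift_arrow _ _)
        · rw [emptySet_of_not_nonempty h, starAlgDown_emptySet,
            locDown_emptySet algebraMap_poincare_mul_invPoincare]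
          exact (starHom_mk _).trans (PathAlgebra.Data.lift_vertex _ _))
    (by
      -- This composite is the identity because it fixes all vertices and arrows.
      refine RingQuot.ringQuot_ext' LocRing _ _ (PathAlgebra.algHom_ext (fun a => ?_) ?_)
      · have h : starHom cs (RingQuot.mkAlgHom LocRing (StarRel cs)
            (PathAlgebra.vertex LocRing a)) = locProj LocRing a.set :=
          (starHom_mk _).trans (PathAlgebra.Data.lift_vertex _ _)
        exact (congrArg _ h).trans
          ((starHookSystem cs).psiHom_locProj algebraMap_poincare_mul_invPoincare _)
      · rintro ⟨a⟩ ⟨b⟩ f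
        have h : starHom cs (RingQuot.mkAlgHom LocRing (StarRel cs)
            (PathAlgebra.arrow LocRing f)) = starArr invPoincare f :=
          (starHom_mk _).trans (PathAlgebra.Data.lift_arrow _ _)
        refine (congrArg _ h).trans ?_
        change StarArrow a b at f
        cases f with
        | up _ hI =>
          exact ((starHookSystem cs).psiHom_locUp algebraMap_poincare_mul_invPoincare _).trans
            (starAlgUp_of_nonempty hI)
        | down _ hI =>
          exact ((starHookSystem cs).psiHom_locDown algebraMap_poincare_mul_invPoincare _).trans
            (starAlgDown_of_nonempty hI))

end HeckeEndo

end

/-! ### Rank two: recovering the braid relations from two expressions of $x_{\{s,t\}}$. -/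

noncomputable section

namespace CoxeterSystem

variable {B : Type*}

/-! ### Alternating words in two letters -/

/-- The word `η` of length `k` alternates between the letters `s` and `t`. -/
def IsAlternating (s t : B) (k : ℕ) (η : List B) : Prop :=
  η = alternatingWord s t k ∨ η = alternatingWord t s k

theorem isAlternating_comm {s t : B} {k : ℕ} {η : List B} :
    IsAlternating s t k η ↔ IsAlternating t s k η := or_comm

theorem IsAlternating.length_eq {s t : B} {k : ℕ} {η : List B} (h : IsAlternating s t k η) :
    η.length = k := by
  rcases h with rfl | rfl <;> exact length_alternatingWord _ _ _

/-- The dichotomy prepares for the quadratic relation: the new letter either continues the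
alternation or repeats the first letter, and then the square can be reduced. -/
theorem cons_alternatingWord {s t a : B} (ha : a = s ∨ a = t) (k : ℕ) :
    IsAlternating s t (k + 1) (a :: alternatingWord s t k) ∨
      ∃ l η, k = l + 1 ∧ IsAlternating s t l η ∧ alternatingWord s t k = a :: η := by
  rcases k with _ | k
  · refine Or.inl ?_
    rcases ha with rfl | rfl
    · exact Or.inr rfl
    · exact Or.inl rfl
  · by_cases h : a = if Even (k + 1) then t else s
    · exact Or.inl (Or.inl (by rw [alternatingWord_succ' s t (k + 1), ← h]))
    · refine Or.inr ⟨k, _, rfl, Or.inl rfl, ?_⟩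
      rw [alternatingWord_succ' s t k]
      congr 1
      by_cases hk : Even k <;> simp [Nat.even_add_one, hk] at h ⊢ <;> tauto

theorem IsAlternating.cons {s t a : B} (ha : a = s ∨ a = t) {k : ℕ} {η : List B}
    (h : IsAlternating s t k η) : IsAlternating s t (k + 1) (a :: η) ∨
      ∃ l η', k = l + 1 ∧ IsAlternating s t l η' ∧ η = a :: η' := by
  rcases h with rfl | rfl
  · exact cons_alternatingWord ha k
  · simp only [isAlternating_comm (s := s) (t := t)]
    exact cons_alternatingWord ha.symm k

variable {W : Type*} [Group W] {M : CoxeterMatrix B} {cs : CoxeterSystem M W}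

theorem isAlternating_of_isReduced {s t : B} {ω : List B} (hω : cs.IsReduced ω)
    (h : ∀ a ∈ ω, a = s ∨ a = t) : IsAlternating s t ω.length ω := by
  induction ω with
  | nil => exact Or.inl rfl
  | cons a ω ih =>
    have ih := ih (IsReduced.of_append_right (ω := [a]) hω) fun b hb => h b (List.mem_cons_of_mem _ hb)
    rcases ih.cons (h a List.mem_cons_self) with h' | ⟨l, η, -, -, rfl⟩
    · exact h'
    · have := IsReduced.of_append_left (ω := [a, a]) (ω' := η) hω
      simp [IsReduced, wordProd_cons] at this

theorem IsAlternating.isReduced {s t : B} {k : ℕ} {η : List B} (h : IsAlternating s t k η)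
    (hk : k ≤ M s t) : cs.IsReduced η := by
  rcases h with rfl | rfl
  · exact cs.isReduced_alternatingWord (Or.inr hk)
  · exact cs.isReduced_alternatingWord (Or.inr (by rwa [M.symmetric]))

/-- Both words are reduced, so their lengths agree. If the two different alternating words of a
length $0<k<m$ had the same product, prefixing a suitable letter would give a reduced word of length
$k+1\le m$ in one case and cancel the first letter in the other. -/
theorem IsAlternating.wordProd_inj {s t : B} {k l : ℕ} {η η' : List B}
    (h : IsAlternating s t k η) (h' : IsAlternating s t l η') (hk : k < M s t) (hl : l < M s t)
    (heq : cs.wordProd η = cs.wordProd η') : η = η' := by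
  have hkl : k = l := by
    rw [← h.length_eq, ← h'.length_eq, ← (h.isReduced (cs := cs) hk.le).eq,
      ← (h'.isReduced (cs := cs) hl.le).eq, heq]
  subst hkl
  have key : cs.wordProd (alternatingWord s t k) = cs.wordProd (alternatingWord t s k) →
      k = 0 := by
    intro heq
    rcases k with _ | k
    · rfl
    · exfalso
      set a := if Even (k + 1) then t else s with ha
      have h1 : (a :: alternatingWord s t (k + 1)) = alternatingWord s t (k + 1 + 1) := by
        rw [alternatingWord_succ' s t (k + 1)]
      have h2 : alternatingWord t s (k + 1) = a :: alternatingWord t s k := by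
        rw [alternatingWord_succ' t s k, ha]
        congr 1
        by_cases hk : Even k <;> simp [Nat.even_add_one, hk]
      have h3 := (cs.isReduced_alternatingWord (i := s) (j := t) (k := k + 1 + 1)
        (Or.inr hk)).eq
      rw [← h1, wordProd_cons, heq, h2, wordProd_cons, simple_mul_simple_cancel_left] at h3
      have h4 := cs.length_wordProd_le (alternatingWord t s k)
      rw [length_alternatingWord] at h4
      simp only [List.length_cons, length_alternatingWord] at h3
      omega
  rcases h with rfl | rfl <;> rcases h' with rfl | rfl
  · rfl
  · rw [key heq]
    rfl
  · rw [key heq.symm]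
    rfl
  · rfl

end CoxeterSystem

namespace HeckeEndo

open CoxeterSystem

variable {B W : Type*} [Group W] {M : CoxeterMatrix B} {cs : CoxeterSystem M W}

/-! ### Products of generators with the quadratic relation -/

section Span

variable {C : Type*} [Ring C] [Algebra ℤ[X] C] (x : B → C) (s t : B)

/-- The span of the products of the elements `x_a - 1` over the alternating words in `s` and `t` of
length less than `k`. -/
def altSpan (k : ℕ) : Submodule ℤ[X] C :=
  Submodule.span ℤ[X] (Set.range fun η : {η : List B // ∃ l < k, IsAlternating s t l η} =>
    (η.1.map fun a => x a - 1).prod)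

variable {x s t}

theorem prod_mem_altSpan {k l : ℕ} (hl : l < k) {η : List B} (h : IsAlternating s t l η) :
    (η.map fun a => x a - 1).prod ∈ altSpan x s t k :=
  Submodule.subset_span ⟨⟨η, l, hl, h⟩, rfl⟩

theorem altSpan_mono {k l : ℕ} (h : k ≤ l) : altSpan x s t k ≤ altSpan x s t l := by
  refine Submodule.span_le.2 ?_
  rintro _ ⟨⟨η, j, hj, hη⟩, rfl⟩
  exact prod_mem_altSpan (hj.trans_le h) hη

theorem mul_mem_altSpan (hx : ∀ a, x a * x a = (q + 1) • x a) {a : B} (ha : a = s ∨ a = t)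
    {k : ℕ} {c : C} (hc : c ∈ altSpan x s t k) : (x a - 1) * c ∈ altSpan x s t (k + 1) := by
  induction hc using Submodule.span_induction with
  | zero => rw [mul_zero]; exact Submodule.zero_mem _
  | add c d _ _ hc hd => rw [mul_add]; exact Submodule.add_mem _ hc hd
  | smul r c _ hc => rw [mul_smul_comm]; exact Submodule.smul_mem _ _ hc
  | mem c hc =>
    obtain ⟨⟨η, l, hl, hη⟩, rfl⟩ := hc
    dsimp only
    rcases hη.cons ha with h | ⟨j, η', rfl, h, rfl⟩
    · have := prod_mem_altSpan (x := x) (Nat.succ_lt_succ hl) h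
      rwa [List.map_cons, List.prod_cons] at this
    · have h1 := prod_mem_altSpan (x := x) (hl.trans (Nat.lt_succ_self k)) hη
      have h2 := prod_mem_altSpan (x := x) (k := k + 1) (by omega) h
      rw [List.map_cons, List.prod_cons] at h1 ⊢
      rw [← mul_assoc, sub_one_mul_sub_one (hx a), add_mul, smul_mul_assoc, smul_mul_assoc,
        one_mul]
      exact Submodule.add_mem _ (Submodule.smul_mem _ _ h1) (Submodule.smul_mem _ _ h2)

theorem prod_mem_altSpan_succ (hx : ∀ a, x a * x a = (q + 1) • x a) {ω : List B}
    (h : ∀ a ∈ ω, a = s ∨ a = t) :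
    (ω.map fun a => x a - 1).prod ∈ altSpan x s t (ω.length + 1) := by
  induction ω with
  | nil => exact prod_mem_altSpan (l := 0) (Nat.succ_pos _) (Or.inl rfl)
  | cons a ω ih =>
    rw [List.map_cons, List.prod_cons]
    exact mul_mem_altSpan hx (h a List.mem_cons_self) (ih fun b hb => h b (List.mem_cons_of_mem _ hb))

/-- Expanding $x_a=(x_a-1)+1$, the leading term is the product over the same word. All other terms
have fewer factors, and the quadratic relation reduces them to alternating words without lengthening
them. -/
theorem prod_sub_prod_mem_altSpan (hx : ∀ a, x a * x a = (q + 1) • x a) {ω : List B}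
    (h : ∀ a ∈ ω, a = s ∨ a = t) :
    (ω.map x).prod - (ω.map fun a => x a - 1).prod ∈ altSpan x s t ω.length := by
  induction ω with
  | nil => simp
  | cons a ω ih =>
    have hω : ∀ b ∈ ω, b = s ∨ b = t := fun b hb => h b (List.mem_cons_of_mem _ hb)
    have ih := ih hω
    have : ((a :: ω).map x).prod - ((a :: ω).map fun a => x a - 1).prod =
        (x a - 1) * ((ω.map x).prod - (ω.map fun a => x a - 1).prod) +
        ((ω.map x).prod - (ω.map fun a => x a - 1).prod) + (ω.map fun a => x a - 1).prod := by
      simp only [List.map_cons, List.prod_cons]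
      noncomm_ring
    rw [this]
    exact Submodule.add_mem _ (Submodule.add_mem _ (mul_mem_altSpan hx (h a List.mem_cons_self) ih)
      (altSpan_mono (Nat.le_succ _) ih)) (prod_mem_altSpan_succ hx hω)

theorem prod_map_mem_altSpan (hx : ∀ a, x a * x a = (q + 1) • x a) {ω : List B}
    (h : ∀ a ∈ ω, a = s ∨ a = t) : (ω.map x).prod ∈ altSpan x s t (ω.length + 1) := by
  have := Submodule.add_mem _ (altSpan_mono (Nat.le_succ _) (prod_sub_prod_mem_altSpan hx h))
    (prod_mem_altSpan_succ hx h)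
  rwa [sub_add_cancel] at this

end Span

namespace Expression

variable {I : Finitary cs} {F : ChainTo I} (E : Expression F)

/-- The expression with each generator `x_s` replaced by an element of an algebra. -/
def eval {C : Type*} [Ring C] [Algebra ℤ[X] C] (x : B → C) : C :=
  (E.word.map x).prod + q • E.coeff.sum fun y a => a • (y.map x).prod

theorem eval_heckeT : E.eval (fun s => heckeT cs s + 1) = xI I := E.eq.symm

theorem map_eval {C D : Type*} [Ring C] [Algebra ℤ[X] C] [Ring D] [Algebra ℤ[X] D]
    (φ : C →ₐ[ℤ[X]] D) (x : B → C) : φ (E.eval x) = E.eval fun s => φ (x s) := by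
  simp only [eval, map_add, map_smul, map_finsuppSum, map_list_prod, List.map_map,
    Function.comp_def]

theorem eval_sub_prod_mem_altSpan {C : Type*} [Ring C] [Algebra ℤ[X] C] {x : B → C}
    (hx : ∀ a, x a * x a = (q + 1) • x a) {s t : B} (h : ∀ a ∈ E.word, a = s ∨ a = t) :
    E.eval x - (E.word.map fun a => x a - 1).prod ∈ altSpan x s t E.word.length := by
  rw [eval, add_sub_right_comm]
  refine Submodule.add_mem _ (prod_sub_prod_mem_altSpan hx h) (Submodule.smul_mem _ _ ?_)
  refine Submodule.sum_mem _ fun y hy => Submodule.smul_mem _ _ ?_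
  obtain ⟨h1, h2⟩ := E.proper y hy
  refine altSpan_mono ?_ (prod_map_mem_altSpan hx fun a ha => h a (h1.subset ha))
  exact lt_of_le_of_ne h1.length_le fun h' => h2 (h1.eq_of_length h')

end Expression

theorem heckeT_add_one_mul_self (s : B) :
    (heckeT cs s + 1) * (heckeT cs s + 1) = (q + 1) • (heckeT cs s + 1) := by
  rw [add_mul, mul_add, heckeT_mul_self, mul_one, one_mul]
  module

/-- The second components of the spanning elements are the $T_w$ of distinct $w$, hence linearly
independent. An element of the span is therefore determined by its second component. Working in `C ×
Hecke cs` transfers identities from the Hecke algebra to `C`, where the braid relation is not yet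
known. -/
theorem eq_zero_of_mem_altSpan {C : Type*} [Ring C] [Algebra ℤ[X] C] {x : B → C} {s t : B} {c : C}
    (h : ((c, 0) : C × Hecke cs) ∈
      altSpan (fun a => ((x a, heckeT cs a + 1) : C × Hecke cs)) s t (M s t)) : c = 0 := by
  have hli : LinearIndependent ℤ[X]
      (LinearMap.snd ℤ[X] C (Hecke cs) ∘
        fun η : {η : List B // ∃ l < M s t, IsAlternating s t l η} =>
          (η.1.map fun a => ((x a, heckeT cs a + 1) : C × Hecke cs) - 1).prod) := by
    have h1 := (linearIndependent_heckeTw (cs := cs)).comp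
      (fun η : {η : List B // ∃ l < M s t, IsAlternating s t l η} => cs.wordProd η.1) (by
        rintro ⟨η, k, hk, h⟩ ⟨η', l, hl, h'⟩ heq
        exact Subtype.ext (h.wordProd_inj h' hk hl heq))
    convert h1 using 1
    funext ⟨η, k, hk, hη⟩
    change (RingHom.snd C (Hecke cs)) _ = heckeTw cs (cs.wordProd η)
    rw [heckeTw_wordProd (hη.isReduced hk.le), map_list_prod, List.map_map]
    congr 2
    funext a
    exact add_sub_cancel_right _ _
  have h2 := (Submodule.range_ker_disjoint hli).le_bot ⟨h, rfl⟩
  exact congrArg Prod.fst ((Submodule.mem_bot ℤ[X]).1 h2)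

end HeckeEndo

end

noncomputable section

namespace HeckeEndo

open CoxeterSystem

variable {B W : Type*} [Group W] {M : CoxeterMatrix B} {cs : CoxeterSystem M W}

/-! ### The braid relations from the rank two expressions -/

theorem Expression.eval_pair {C : Type*} [Ring C] [Algebra ℤ[X] C] (x : B → C) {I : Finitary cs}
    {F : ChainTo I} (E : Expression F) :
    E.eval (fun a => ((x a, heckeT cs a + 1) : C × Hecke cs)) = (E.eval x, xI I) :=
  Prod.ext (E.map_eval (AlgHom.fst ℤ[X] C (Hecke cs)) _)
    ((E.map_eval (AlgHom.snd ℤ[X] C (Hecke cs)) _).trans E.eval_heckeT)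

/-- In $C\times H$ subtract from each evaluation its leading product. Both remainders lie in the
span of the shorter alternating products, and in $H$ they coincide, both being $x_I$ minus the same
braid product. So they coincide in $C$ as well, and equal evaluations (after multiplication by `e`)
have equal leading products. -/
theorem Expression.mul_prod_eq {C : Type*} [Ring C] [Algebra ℤ[X] C] {x : B → C}
    (hx : ∀ a, x a * x a = (q + 1) • x a) {s t : B} {I : Finitary cs} {F F' : ChainTo I}
    (E : Expression F) (E' : Expression F') (hE : E.word = braidWord M s t)
    (hE' : E'.word = braidWord M t s) {e : C} (h : e * E.eval x = e * E'.eval x) :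
    cornerProd e (fun a => x a - 1) (braidWord M s t) =
      cornerProd e (fun a => x a - 1) (braidWord M t s) := by
  set y : B → C × Hecke cs := fun a => (x a, heckeT cs a + 1) with hy
  have hyy (a : B) : y a * y a = (q + 1) • y a :=
    Prod.ext (hx a) (heckeT_add_one_mul_self a)
  have h1 := E.eval_sub_prod_mem_altSpan hyy (s := s) (t := t) fun a ha =>
    mem_alternatingWord (by rw [hE] at ha; exact ha)
  have h2 := E'.eval_sub_prod_mem_altSpan hyy (s := s) (t := t) fun a ha =>
    (mem_alternatingWord (by rw [hE'] at ha; exact ha)).symm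
  have hl : E.word.length = M s t := by rw [hE]; exact length_alternatingWord _ _ _
  have hl' : E'.word.length = M s t := by
    rw [hE', M.symmetric]; exact length_alternatingWord _ _ _
  rw [hl] at h1
  rw [hl'] at h2
  have h3 := Submodule.sub_mem _ h1 h2
  have hp (ω : List B) : (ω.map fun a => y a - 1).prod =
      ((ω.map fun a => x a - 1).prod, (ω.map (heckeT cs)).prod) := by
    induction ω with
    | nil => rfl
    | cons a ω ih =>
      rw [List.map_cons, List.prod_cons, ih]
      refine Prod.ext rfl ?_
      change (heckeT cs a + 1 - 1) * _ = _
      rw [add_sub_cancel_right]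
      rfl
  rw [hy, E.eval_pair, E'.eval_pair, ← hy, hp, hp, hE, hE', heckeT_braid cs s t] at h3
  simp only [Prod.mk_sub_mk, sub_self] at h3
  have h4 := congrArg (e * ·) (eq_zero_of_mem_altSpan h3)
  simp only [mul_sub, mul_zero, h] at h4
  rw [cornerProd, cornerProd]
  rw [sub_sub_sub_cancel_left, sub_eq_zero] at h4
  exact h4.symm

theorem finite_parabolic_pair [DecidableEq B] {s t : B} (h : M s t ≠ 0) :
    Finite (parabolic cs {s, t}) := by
  have hfin : (cs.dihedralSet s t).Finite := by
    refine Set.Finite.subset (((Set.finite_Iic (M s t)).image fun k =>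
      cs.wordProd (alternatingWord s t k)).union ((Set.finite_Iic (M s t)).image fun k =>
      cs.wordProd (alternatingWord t s k))) ?_
    rintro w ⟨k, hk, rfl | rfl⟩
    · exact Or.inl ⟨k, hk, rfl⟩
    · exact Or.inr ⟨k, hk, rfl⟩
  refine Set.Finite.subset hfin fun w hw => ?_
  obtain ⟨ω, -, hω, rfl⟩ := exists_isReduced_of_mem_parabolic hw
  exact cs.wordProd_mem_dihedralSet h fun a ha => by simpa using hω a ha

variable (cs) in
/-- A pair of generators with finite `m_{s,t}` as a finitary subset. -/
def pairSet [DecidableEq B] (s t : B) (h : M s t ≠ 0) : Finitary cs :=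
  ⟨{s, t}, finite_parabolic_pair h⟩

theorem covers_pair_left [DecidableEq B] {s t : B} (hst : s ≠ t) (h : M s t ≠ 0) :
    Covers (singletonSet cs s) (pairSet cs s t h) := by
  refine ⟨by simp [singletonSet, pairSet], ?_⟩
  simp [singletonSet, pairSet, Finset.card_pair hst]

theorem covers_pair_right [DecidableEq B] {s t : B} (hst : s ≠ t) (h : M s t ≠ 0) :
    Covers (singletonSet cs t) (pairSet cs s t h) := by
  refine ⟨by simp [singletonSet, pairSet], ?_⟩
  simp [singletonSet, pairSet, Finset.card_pair hst]

theorem Adapted.eq_singleton {s : B} {ω : List B}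
    (h : Adapted (ChainTo.nil.cons (covers_singleton (cs := cs) s)) ω) : ω = [s] := by
  obtain ⟨h1, h2, -⟩ := h
  have hl : ∀ a ∈ ω, a = s := fun a ha =>
    Finset.mem_singleton.1 (mem_of_isReduced_of_mem_parabolic h1 h2.1 a ha)
  have h4 := h2.2 _ (simple_mem_parabolic (i := s) (Finset.mem_singleton_self s))
  rw [length_simple, h1.eq] at h4
  rcases ω with _ | ⟨a, _ | ⟨b, ω⟩⟩
  · simp at h4
  · rw [hl a (by simp)]
  · exfalso
    have := IsReduced.of_append_left (ω := [a, b]) (ω' := ω) h1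
    rw [hl a (by simp), hl b (by simp)] at this
    simp [CoxeterSystem.IsReduced, wordProd_cons] at this

/-- A reduced word of the longest element of a finite dihedral group is one of the two alternating
words of length $m_{s,t}$; the final segment prescribed by the chain decides which. -/
theorem Adapted.eq_alternatingWord {s t : B} {I : Finitary cs} (hst : s ≠ t) (h0 : M s t ≠ 0)
    (hI : ∀ a, a ∈ I.1 ↔ a = s ∨ a = t) (hc : Covers (singletonSet cs s) I) {ω : List B}
    (h : Adapted ((ChainTo.nil.cons (covers_singleton s)).cons hc) ω) :
    ω = alternatingWord t s (M s t) := by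
  obtain ⟨h1, h2, ω', h3, h4⟩ := h
  obtain rfl := Adapted.eq_singleton h4
  have hl : ∀ a ∈ ω, a = s ∨ a = t := fun a ha =>
    (hI a).1 (mem_of_isReduced_of_mem_parabolic h1 h2.1 a ha)
  have hlen : ω.length = M s t := by
    apply le_antisymm
    · obtain ⟨k, hk, h | h⟩ := cs.wordProd_mem_dihedralSet h0 hl
      all_goals
        rw [← h1.eq, h]
        refine (cs.length_wordProd_le _).trans ?_
        rwa [length_alternatingWord]
    · have := h2.2 (cs.wordProd (alternatingWord s t (M s t)))
        (wordProd_mem_parabolic fun a ha => (hI a).2 (mem_alternatingWord ha))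
      rwa [h1.eq, (cs.isReduced_alternatingWord (Or.inr le_rfl)).eq, length_alternatingWord] at this
  have h5 := isAlternating_of_isReduced h1 hl
  rw [hlen] at h5
  rcases h5 with h5 | h5
  · exfalso
    obtain ⟨m, hm⟩ := Nat.exists_eq_succ_of_ne_zero h0
    obtain ⟨η, hη⟩ := h3
    rw [hm, Nat.succ_eq_add_one, alternatingWord_succ, ← hη, List.concat_eq_append] at h5
    have := List.append_inj_right' h5 rfl
    exact hst (List.singleton_inj.1 this)
  · exact h5

end HeckeEndo

end

/-! ### The presentation by the Hasse quiver. -/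

noncomputable section

namespace HeckeEndo

open CoxeterSystem

variable {B W : Type*} [Group W] {M : CoxeterMatrix B} {cs : CoxeterSystem M W}

/-! ### Chains of finitary subsets -/

/-- A subset of a finitary subset is finitary. -/
def Finitary.ofSubset (J : Finitary cs) (I : Finset B) (h : I ⊆ J.1) : Finitary cs :=
  ⟨I, @Finite.of_injective _ _ J.2 _ (Subgroup.inclusion_injective (parabolic_mono h))⟩

theorem nonempty_chainTo (I : Finitary cs) : Nonempty (ChainTo I) := by
  classical
  induction hn : I.1.card generalizing I with
  | zero =>
    rw [emptySet_of_not_nonempty (I := I) (by simpa using hn)]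
    exact ⟨.nil⟩
  | succ n ih =>
    obtain ⟨i, hi⟩ : I.1.Nonempty := Finset.card_pos.1 (by omega)
    have hc : Covers (I.ofSubset (I.1.erase i) (Finset.erase_subset _ _)) I :=
      ⟨Finset.erase_subset _ _, Finset.card_erase_add_one hi⟩
    obtain ⟨F⟩ := ih (I.ofSubset (I.1.erase i) (Finset.erase_subset _ _)) (by have := hc.2; omega)
    exact ⟨F.cons hc⟩

theorem Covers.ne_emptySet {I J : Finitary cs} (h : Covers I J) : J ≠ emptySet cs := by
  rintro rfl
  have := h.2
  simp [emptySet] at this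

/-- The intersection of the two sets lies one step below both. This produces the squares to which
the sandwich relations apply. -/
theorem exists_covers_of_ne {I I' J : Finitary cs} (h : Covers I J) (h' : Covers I' J)
    (hne : I ≠ I') : ∃ L : Finitary cs, Covers L I ∧ Covers L I' := by
  classical
  refine ⟨I.ofSubset (I.1 ∩ I'.1) Finset.inter_subset_left,
    ⟨Finset.inter_subset_left, ?_⟩, ⟨Finset.inter_subset_right, ?_⟩⟩
  all_goals
    change (I.1 ∩ I'.1).card + 1 = _
    have h1 := Finset.card_union_add_card_inter I.1 I'.1
    have h2 : I.1 ∪ I'.1 ⊆ J.1 := Finset.union_subset h.1 h'.1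
    have h3 := Finset.card_le_card h2
    have h4 : I.1.card < (I.1 ∪ I'.1).card := by
      refine Finset.card_lt_card (Finset.ssubset_iff_subset_ne.2 ⟨Finset.subset_union_left, ?_⟩)
      intro h5
      have h6 : I'.1 ⊆ I.1 := by rw [h5]; exact Finset.subset_union_right
      exact hne (Subtype.ext (Finset.eq_of_subset_of_card_le h6
        (by have := h.2; have := h'.2; omega)).symm)
    have := h.2
    have := h'.2
    omega

theorem upPath_of_eq_emptySet {I : Finitary cs} (F : ChainTo I) (h : I = emptySet cs) :
    upPath F = hasseE (emptySet cs) := by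
  cases F with
  | nil => rfl
  | cons F hc => exact absurd h hc.ne_emptySet

theorem downPath_of_eq_emptySet {I : Finitary cs} (F : ChainTo I) (h : I = emptySet cs) :
    downPath F = hasseE (emptySet cs) := by
  cases F with
  | nil => rfl
  | cons F hc => exact absurd h hc.ne_emptySet

theorem hasseE_mul_self (I : Finitary cs) : hasseE I * hasseE I = hasseE I :=
  PathAlgebra.vertex_mul_self _

theorem hasseE_mul_hasseUp {I J : Finitary cs} (h : Covers I J) :
    hasseE I * hasseUp h = hasseUp h := PathAlgebra.vertex_mul_arrow _

theorem hasseUp_mul_hasseE {I J : Finitary cs} (h : Covers I J) :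
    hasseUp h * hasseE J = hasseUp h := PathAlgebra.arrow_mul_vertex _

theorem hasseE_mul_hasseDown {I J : Finitary cs} (h : Covers I J) :
    hasseE J * hasseDown h = hasseDown h := PathAlgebra.vertex_mul_arrow _

theorem hasseDown_mul_hasseE {I J : Finitary cs} (h : Covers I J) :
    hasseDown h * hasseE I = hasseDown h := PathAlgebra.arrow_mul_vertex _

theorem hasseE_mul_upPath {I : Finitary cs} (F : ChainTo I) :
    hasseE (emptySet cs) * upPath F = upPath F := by
  induction F with
  | nil => exact hasseE_mul_self _
  | cons F h ih => rw [upPath, ← mul_assoc, ih]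

theorem upPath_mul_hasseE {I : Finitary cs} (F : ChainTo I) :
    upPath F * hasseE I = upPath F := by
  cases F with
  | nil => exact hasseE_mul_self _
  | cons F h => rw [upPath, mul_assoc, hasseUp_mul_hasseE]

theorem downPath_mul_hasseE {I : Finitary cs} (F : ChainTo I) :
    downPath F * hasseE (emptySet cs) = downPath F := by
  induction F with
  | nil => exact hasseE_mul_self _
  | cons F h ih => rw [downPath, mul_assoc, ih]

theorem hasseE_mul_downPath {I : Finitary cs} (F : ChainTo I) :
    hasseE I * downPath F = downPath F := by
  cases F with
  | nil => exact hasseE_mul_self _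
  | cons F h => rw [downPath, ← mul_assoc, hasseE_mul_hasseDown]

theorem upPath_singleton (s : B) : upPath (ChainTo.nil.cons (covers_singleton (cs := cs) s)) =
    hasseUp (covers_singleton s) := hasseE_mul_hasseUp _

theorem downPath_singleton (s : B) : downPath (ChainTo.nil.cons (covers_singleton (cs := cs) s)) =
    hasseDown (covers_singleton s) := hasseDown_mul_hasseE _

/-! ### The Hasse quiver in the Hecke endomorphism algebra -/

section Generic

variable {K : Type*} [CommRing K] [Algebra ℤ[X] K] {inv : Finitary cs → K}

variable (inv) in
/-- The value of an arrow of the Hasse quiver in the base change of the Hecke endomorphism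
algebra. -/
def hasseArr : {I J : Finitary cs} → HasseArrow I J → K ⊗[ℤ[X]] HeckeEnd cs
  -- The inclusion $x_JH\subseteq x_IH$, written as the inclusion in $H$ followed by $p_I$. The
  -- arrow down is the restriction of $p_J$ to $x_IH$.
  | _, _, .up (I := I) (J := J) _ => locDown inv I * locUp K J
  | _, _, .down (I := I) (J := J) _ => locDown inv J * locUp K I

theorem locProj_mul_eval_locHecke {I : Finitary cs} {F : ChainTo I} (E : Expression F) :
    locProj K (emptySet cs) * E.eval (fun s => locHecke cs K (heckeT cs s + 1)) =
      locHecke cs K (xI I) := by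
  have h (ω : List B) := cornerProd_locHecke (K := K) (fun s => heckeT cs s + 1) ω
  simp only [cornerProd] at h
  rw [← E.eval_heckeT, Expression.eval, Expression.eval, mul_add, h, map_add, mul_smul_comm,
    map_smul, Finsupp.sum, Finsupp.sum, Finset.mul_sum, map_sum]
  congr 2
  refine Finset.sum_congr rfl fun y _ => ?_
  rw [mul_smul_comm, h, map_smul]

end Generic

variable [Finite B]

theorem sum_hasseQuiver {A : Type*} [AddCommMonoid A] (f : Finitary cs → A) :
    ∑ a ∈ (Set.toFinite (Set.univ : Set (HasseQuiver cs))).toFinset, f a.set = ∑ I, f I :=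
  Finset.sum_bij (fun a _ => a.set) (fun _ _ => Finset.mem_univ _)
    (fun ⟨_⟩ _ ⟨_⟩ _ h => congrArg _ h) (fun I _ => ⟨⟨I⟩, by simp, rfl⟩) fun _ _ => rfl

/-- The canonical representation of the Hasse quiver in the base change of the Hecke endomorphism
algebra. -/
def hasseData {K : Type*} [CommRing K] [Algebra ℤ[X] K] (inv : Finitary cs → K) :
    PathAlgebra.Data (HasseQuiver cs) (K ⊗[ℤ[X]] HeckeEnd cs) where
  vert a := locProj K a.set
  arr f := hasseArr inv f
  vert_mul_self a := locProj_mul_self a.set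
  vert_mul_of_ne {a b} h := locProj_mul_of_ne fun h' => h (by cases a; cases b; exact congrArg _ h')
  sum_vert := (sum_hasseQuiver fun I => locProj K I).trans sum_locProj
  vert_mul_arr {a b} f := by
    obtain ⟨a⟩ := a
    obtain ⟨b⟩ := b
    change HasseArrow a b at f
    cases f with
    | up h => exact (mul_assoc _ _ _).symm.trans (congrArg (· * _) (locProj_mul_locDown _ _))
    | down h => exact (mul_assoc _ _ _).symm.trans (congrArg (· * _) (locProj_mul_locDown _ _))
  arr_mul_vert {a b} f := by
    obtain ⟨a⟩ := a
    obtain ⟨b⟩ := b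
    change HasseArrow a b at f
    cases f with
    | up h => exact (mul_assoc _ _ _).trans (congrArg (_ * ·) (locUp_mul_locProj _))
    | down h => exact (mul_assoc _ _ _).trans (congrArg (_ * ·) (locUp_mul_locProj _))

/-- The values of the element `χ_{I_•}` under homomorphisms. -/
theorem map_chi {C : Type*} [Ring C] [Algebra LocRing C] [Algebra ℤ[X] C]
    [IsScalarTower ℤ[X] LocRing C] (φ : HassePathAlgebra cs →ₐ[LocRing] C)
    {I : Finitary cs} {F : ChainTo I} (E : Expression F) :
    φ (chi E) = φ (hasseE (emptySet cs)) * E.eval fun s => φ (hasseChi cs s) := by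
  have h (ω : List B) : φ (chiWord cs ω) =
      φ (hasseE (emptySet cs)) * (ω.map fun s => φ (hasseChi cs s)).prod := map_cornerProd _ _ _ _
  rw [chi, map_add, map_smul, h, Expression.eval, mul_add, mul_smul_comm]
  congr 1
  refine (algebraMap_smul LocRing q (_ : C)).trans ?_
  congr 1
  rw [Finsupp.sum, Finsupp.sum, map_sum, Finset.mul_sum]
  refine Finset.sum_congr rfl fun y _ => ?_
  rw [map_smul, h, mul_smul_comm]
  exact algebraMap_smul LocRing _ (_ : C)

end HeckeEndo

end

noncomputable section

namespace HeckeEndo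

open CoxeterSystem

variable {B W : Type*} [Group W] {M : CoxeterMatrix B} {cs : CoxeterSystem M W}

section Generic

variable {K : Type*} [CommRing K] [Algebra ℤ[X] K] {inv : Finitary cs → K}

theorem locDown_mul_locUp_mul_locDown_mul_locUp
    (hinv : ∀ I, algebraMap ℤ[X] K (poincare I) * inv I = 1) (L : Finitary cs) {I J : Finitary cs}
    (h : I.1 ⊆ J.1) : locDown inv L * locUp K I * (locDown inv I * locUp K J) =
      locDown inv L * locUp K J := by
  rw [mul_assoc, ← mul_assoc (locUp K I), locUp_mul_locDown_mul_locUp hinv h]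

theorem locDown_mul_locUp_mul_locDown_mul_locUp_of_superset
    (hinv : ∀ I, algebraMap ℤ[X] K (poincare I) * inv I = 1) (L : Finitary cs) {I J : Finitary cs}
    (h : I.1 ⊆ J.1) : locDown inv J * locUp K I * (locDown inv I * locUp K L) =
      locDown inv J * locUp K L := by
  rw [← mul_assoc, mul_assoc (locDown inv J), locDown_mul_locUp_mul_locDown hinv h]

theorem smul_hasseArr_mul_hasseArr (hinv : ∀ I, algebraMap ℤ[X] K (poincare I) * inv I = 1)
    (s : B) : (algebraMap ℤ[X] K q + 1) •
      (locDown inv (emptySet cs) * locUp K (singletonSet cs s) *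
        (locDown inv (singletonSet cs s) * locUp K (emptySet cs))) =
      locHecke cs K (heckeT cs s + 1) := by
  rw [← smul_locUp_mul_locDown_singletonSet hinv, map_add, map_one, locDown_emptySet hinv,
    locProj_mul_locUp, locUp_emptySet, locDown_mul_locProj]

end Generic

variable [Finite B]

theorem hasseData_lift_hasseE (I : Finitary cs) :
    (hasseData (invPoincare (cs := cs))).lift LocRing (hasseE I) = locProj LocRing I :=
  PathAlgebra.Data.lift_vertex _ _

theorem hasseData_lift_hasseUp {I J : Finitary cs} (h : Covers I J) :
    (hasseData (invPoincare (cs := cs))).lift LocRing (hasseUp h) =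
      locDown invPoincare I * locUp LocRing J :=
  PathAlgebra.Data.lift_arrow _ _

theorem hasseData_lift_hasseDown {I J : Finitary cs} (h : Covers I J) :
    (hasseData (invPoincare (cs := cs))).lift LocRing (hasseDown h) =
      locDown invPoincare J * locUp LocRing I :=
  PathAlgebra.Data.lift_arrow _ _

theorem hasseData_lift_upPath {I : Finitary cs} (F : ChainTo I) :
    (hasseData (invPoincare (cs := cs))).lift LocRing (upPath F) = locUp LocRing I := by
  induction F with
  | nil => rw [upPath, hasseData_lift_hasseE, locUp_emptySet]
  | cons F h ih =>
    rw [upPath, map_mul, ih, hasseData_lift_hasseUp, ← mul_assoc,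
      locUp_mul_locDown_mul_locUp algebraMap_poincare_mul_invPoincare h.1]

theorem hasseData_lift_downPath {I : Finitary cs} (F : ChainTo I) :
    (hasseData (invPoincare (cs := cs))).lift LocRing (downPath F) = locDown invPoincare I := by
  induction F with
  | nil => rw [downPath, hasseData_lift_hasseE,
      locDown_emptySet algebraMap_poincare_mul_invPoincare]
  | cons F h ih =>
    rw [downPath, map_mul, ih, hasseData_lift_hasseDown, mul_assoc,
      locDown_mul_locUp_mul_locDown algebraMap_poincare_mul_invPoincare h.1]

theorem hasseData_lift_hasseChi (s : B) :
    (hasseData (invPoincare (cs := cs))).lift LocRing (hasseChi cs s) =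
      locHecke cs LocRing (heckeT cs s + 1) := by
  rw [← smul_hasseArr_mul_hasseArr algebraMap_poincare_mul_invPoincare, hasseChi, map_smul,
    map_mul, hasseData_lift_hasseUp, hasseData_lift_hasseDown]
  rfl

theorem hasseData_lift_rho {I : Finitary cs} {F : ChainTo I} (E : Expression F) :
    (hasseData (invPoincare (cs := cs))).lift LocRing (rho E) =
      locUp LocRing I * locDown invPoincare I := by
  rw [rho, map_smul, map_chi, hasseData_lift_hasseE, locUp_mul_locDown]
  simp only [hasseData_lift_hasseChi]
  rw [locProj_mul_eval_locHecke]

variable (E : ∀ (I : Finitary cs) (F : ChainTo I), Expression F)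

/-- The homomorphism from the quotient of the path algebra of the Hasse quiver to the base change of
the Hecke endomorphism algebra. -/
def hasseHom : HasseAlgebra E →ₐ[LocRing] LocHeckeEnd cs :=
  RingQuot.liftAlgHom LocRing ⟨(hasseData invPoincare).lift LocRing, by
    have hinv := algebraMap_poincare_mul_invPoincare (cs := cs)
    intro x y h
    cases h with
    | idem h =>
      rw [map_mul, hasseData_lift_hasseUp, hasseData_lift_hasseDown, hasseData_lift_hasseE,
        locDown_mul_locUp_mul_locDown_mul_locUp hinv _ h.1, locDown_mul_locUp hinv]
    | sandwichUp h₁ h₂ h₁' h₂' =>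
      simp only [map_mul, hasseData_lift_hasseUp]
      rw [locDown_mul_locUp_mul_locDown_mul_locUp hinv _ h₂.1,
        locDown_mul_locUp_mul_locDown_mul_locUp hinv _ h₂'.1]
    | sandwichDown h₁ h₂ h₁' h₂' =>
      simp only [map_mul, hasseData_lift_hasseDown]
      rw [locDown_mul_locUp_mul_locDown_mul_locUp_of_superset hinv _ h₂.1,
        locDown_mul_locUp_mul_locDown_mul_locUp_of_superset hinv _ h₂'.1]
    | extendedBraid I hI F =>
      rw [map_mul, hasseData_lift_upPath, hasseData_lift_downPath, hasseData_lift_rho]⟩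

theorem hasseHom_mk (x : HassePathAlgebra cs) :
    hasseHom E (RingQuot.mkAlgHom LocRing (HasseRel E) x) =
      (hasseData invPoincare).lift LocRing x :=
  RingQuot.liftAlgHom_mkAlgHom_apply _ _ _ _

/-! ### The hook system of the Hasse quiver -/

instance : Algebra ℤ[X] (HasseAlgebra E) := polyAlgebra (HasseAlgebra E)

instance : IsScalarTower ℤ[X] LocRing (HasseAlgebra E) := isScalarTower_polyAlgebra _

/-- The quotient map. -/
abbrev hasseMk : HassePathAlgebra cs →ₐ[LocRing] HasseAlgebra E :=
  RingQuot.mkAlgHom LocRing (HasseRel E)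

/-- Induction on $|I|$. If the last steps of the two chains start at different sets, both chains may
by induction be replaced by chains through the intersection of these sets, and the final square is a
sandwich relation. -/
theorem hasseMk_path_eq {I : Finitary cs} (F F' : ChainTo I) :
    hasseMk E (upPath F) = hasseMk E (upPath F') ∧
      hasseMk E (downPath F) = hasseMk E (downPath F') := by
  induction hn : I.1.card generalizing I with
  | zero =>
    have h := emptySet_of_not_nonempty (I := I) (by simpa using hn)
    rw [upPath_of_eq_emptySet F h, upPath_of_eq_emptySet F' h, downPath_of_eq_emptySet F h,
      downPath_of_eq_emptySet F' h]
    exact ⟨rfl, rfl⟩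
  | succ n ih =>
    cases F with
    | nil => simp [emptySet] at hn
    | @cons I _ F h =>
      cases F' with
      | nil => simp [emptySet] at hn
      | @cons I' _ F' h' =>
        have hI : I.1.card = n := by have := h.2; omega
        have hI' : I'.1.card = n := by have := h'.2; omega
        by_cases heq : I = I'
        · subst heq
          obtain ⟨h1, h2⟩ := ih F F' hI
          simp only [upPath, downPath, map_mul, h1, h2, and_self]
        · obtain ⟨L, hL, hL'⟩ := exists_covers_of_ne h h' heq
          obtain ⟨G⟩ := nonempty_chainTo L
          obtain ⟨h1, h2⟩ := ih F (G.cons hL) hI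
          obtain ⟨h1', h2'⟩ := ih F' (G.cons hL') hI'
          have h3 := RingQuot.mkAlgHom_rel LocRing (HasseRel.sandwichUp (E := E) hL h hL' h')
          have h4 := RingQuot.mkAlgHom_rel LocRing (HasseRel.sandwichDown (E := E) hL h hL' h')
          rw [map_mul, map_mul] at h3 h4
          constructor
          · rw [upPath, upPath, map_mul, map_mul, h1, h1', upPath, upPath, map_mul, map_mul,
              mul_assoc, h3, mul_assoc]
          · rw [downPath, downPath, map_mul, map_mul, h2, h2', downPath, downPath, map_mul, map_mul,
              ← mul_assoc, h4, mul_assoc]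

theorem hasseMk_downPath_mul_upPath {I : Finitary cs} (F : ChainTo I) :
    hasseMk E (downPath F) * hasseMk E (upPath F) = hasseMk E (hasseE I) := by
  induction F with
  | nil => rw [downPath, upPath, ← map_mul, hasseE_mul_self]
  | cons F h ih =>
    rw [downPath, upPath, map_mul, map_mul, mul_assoc, ← mul_assoc (hasseMk E (downPath F)), ih,
      ← mul_assoc, ← map_mul, hasseDown_mul_hasseE, ← map_mul]
    exact RingQuot.mkAlgHom_rel LocRing (HasseRel.idem h)

theorem add_one_smul_hasseAlgebra (a : HasseAlgebra E) : (q + 1) • a = (qR + 1) • a := by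
  rw [add_comm qR]
  exact add_one_smul_polyAlgebra a

theorem hasseMk_hasseChi (s : B) : hasseMk E (hasseChi cs s) =
    (q + 1) • (hasseMk E (hasseUp (covers_singleton s)) *
      hasseMk E (hasseDown (covers_singleton s))) := by
  rw [add_one_smul_hasseAlgebra, hasseChi, map_smul, map_mul]

theorem hasseMk_hasseChi_mul_self (s : B) :
    hasseMk E (hasseChi cs s) * hasseMk E (hasseChi cs s) = (q + 1) • hasseMk E (hasseChi cs s) := by
  have h := RingQuot.mkAlgHom_rel LocRing (HasseRel.idem (E := E) (covers_singleton s))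
  rw [map_mul] at h
  rw [hasseMk_hasseChi, smul_mul_assoc, mul_smul_comm, mul_assoc, ← mul_assoc (hasseMk E (hasseDown _)),
    h, ← map_mul _ (hasseE _), hasseE_mul_hasseDown]

theorem poincare_smul_hasseMk_up_mul_down {I : Finitary cs} (hI : 1 < I.1.card) (F : ChainTo I) :
    poincare I • (hasseMk E (upPath F) * hasseMk E (downPath F)) =
      hasseMk E (hasseE (emptySet cs)) * (E I F).eval fun s => hasseMk E (hasseChi cs s) := by
  rw [← map_chi, ← map_mul, RingQuot.mkAlgHom_rel LocRing (HasseRel.extendedBraid (E := E) I hI F),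
    rho, map_smul]
  exact poincare_smul_smul algebraMap_poincare_mul_invPoincare I _

/-- Path independence identifies the left sides of the extended braid relations for the two
orderings of $\{s,t\}$, so both expressions have the same value and `Expression.mul_prod_eq`
applies. For infinite $m_{s,t}$ both words are empty. -/
theorem hasseMk_braid (s t : B) :
    cornerProd (hasseMk E (hasseE (emptySet cs))) (fun s => hasseMk E (hasseChi cs s) - 1)
      (braidWord M s t) =
    cornerProd (hasseMk E (hasseE (emptySet cs))) (fun s => hasseMk E (hasseChi cs s) - 1)
      (braidWord M t s) := by
  classical
  by_cases hst : s = t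
  · rw [hst]
  by_cases h0 : M s t = 0
  · rw [braidWord, braidWord, M.symmetric t s, h0]
    rfl
  have hcard : 1 < (pairSet cs s t h0).1.card := by
    rw [pairSet, Finset.card_pair hst]
    norm_num
  have hI (a : B) : a ∈ (pairSet cs s t h0).1 ↔ a = s ∨ a = t := by simp [pairSet]
  -- The chain through $\{t\}$ forces the adapted word to end in `t`, which makes it `braidWord M s
  -- t`; the chain through $\{s\}$ gives the other side.
  let F : ChainTo (pairSet cs s t h0) :=
    (ChainTo.nil.cons (covers_singleton t)).cons (covers_pair_right hst h0)
  let F' : ChainTo (pairSet cs s t h0) :=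
    (ChainTo.nil.cons (covers_singleton s)).cons (covers_pair_left hst h0)
  refine Expression.mul_prod_eq (hasseMk_hasseChi_mul_self E) (E _ F) (E _ F') ?_ ?_ ?_
  · have := Adapted.eq_alternatingWord (Ne.symm hst) (by rwa [M.symmetric])
      (fun a => (hI a).trans or_comm) _ (E _ F).adapted
    rwa [M.symmetric] at this
  · have := Adapted.eq_alternatingWord hst h0 hI _ (E _ F').adapted
    rwa [M.symmetric] at this
  · rw [← poincare_smul_hasseMk_up_mul_down E hcard F, ← poincare_smul_hasseMk_up_mul_down E hcard F',
      (hasseMk_path_eq E F F').1, (hasseMk_path_eq E F F').2]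

end HeckeEndo

end

noncomputable section

namespace HeckeEndo

open CoxeterSystem

variable {B W : Type*} [Group W] {M : CoxeterMatrix B} {cs : CoxeterSystem M W} [Finite B]
  (E : ∀ (I : Finitary cs) (F : ChainTo I), Expression F)

/-- The image of the product `υ_{∅,I_1} ⋯ υ_{I_{m-1},I}` along any ordering of `I`. -/
def hasseAlgUp (I : Finitary cs) : HasseAlgebra E := hasseMk E (upPath (nonempty_chainTo I).some)

/-- The image of the product `δ_{I,I_{m-1}} ⋯ δ_{I_1,∅}` along any ordering of `I`. -/
def hasseAlgDown (I : Finitary cs) : HasseAlgebra E :=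
  hasseMk E (downPath (nonempty_chainTo I).some)

theorem hasseAlgUp_eq {I : Finitary cs} (F : ChainTo I) :
    hasseAlgUp E I = hasseMk E (upPath F) := (hasseMk_path_eq E _ F).1

theorem hasseAlgDown_eq {I : Finitary cs} (F : ChainTo I) :
    hasseAlgDown E I = hasseMk E (downPath F) := (hasseMk_path_eq E _ F).2

theorem hasseMk_hasseChi_eq (s : B) : hasseMk E (hasseChi cs s) =
    (q + 1) • (hasseAlgUp E (singletonSet cs s) * hasseAlgDown E (singletonSet cs s)) := by
  rw [hasseMk_hasseChi, hasseAlgUp_eq E (ChainTo.nil.cons (covers_singleton s)),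
    hasseAlgDown_eq E (ChainTo.nil.cons (covers_singleton s)), upPath_singleton,
    downPath_singleton]

/-- The braid system of the quotient of the path algebra of the Hasse quiver. -/
def hasseBraidSystem : BraidSystem cs (HasseAlgebra E) where
  e I := hasseMk E (hasseE I)
  up := hasseAlgUp E
  down := hasseAlgDown E
  e_mul_of_ne {I J} h := by
    rw [← map_mul, hasseE, hasseE, PathAlgebra.vertex_mul_of_ne, map_zero]
    exact fun h' => h (congrArg HasseQuiver.set h')
  sum_e := by
    rw [← map_sum, ← sum_hasseQuiver]
    exact map_one _
  up_mul_e I := by rw [hasseAlgUp, ← map_mul, upPath_mul_hasseE]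
  e_mul_down I := by rw [hasseAlgDown, ← map_mul, hasseE_mul_downPath]
  e_mul_up I := by rw [hasseAlgUp, ← map_mul, hasseE_mul_upPath]
  down_mul_e I := by rw [hasseAlgDown, ← map_mul, downPath_mul_hasseE]
  down_mul_up I := hasseMk_downPath_mul_upPath E _
  up_empty := hasseAlgUp_eq E .nil
  down_empty := hasseAlgDown_eq E .nil
  braid s t := by
    simp only [← hasseMk_hasseChi_eq]
    exact hasseMk_braid E s t

theorem hasseBraidSystem_chi (s : B) :
    (hasseBraidSystem E).chi s = hasseMk E (hasseChi cs s) := (hasseMk_hasseChi_eq E s).symm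

theorem hasseBraidSystem_hecke_xI {I : Finitary cs} (F : ChainTo I) :
    (hasseBraidSystem E).hecke (xI I) = (E I F).eval fun s => hasseMk E (hasseChi cs s) := by
  rw [← (E I F).eval_heckeT, Expression.map_eval]
  congr 1
  funext s
  rw [map_add, BraidSystem.hecke_heckeT, map_one, sub_add_cancel, hasseBraidSystem_chi]

/-- The extended braid relations cover only $|I|>1$. For singletons the equation is the definition
of $\chi_s$, and for the empty set both sides are $e_\emptyset$. -/
theorem poincare_smul_hasseAlgUp_mul_hasseAlgDown (I : Finitary cs) :
    poincare I • (hasseAlgUp E I * hasseAlgDown E I) =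
      hasseMk E (hasseE (emptySet cs)) * (hasseBraidSystem E).hecke (xI I) := by
  rcases lt_trichotomy I.1.card 1 with h | h | h
  · obtain rfl := emptySet_of_not_nonempty (I := I) (by simpa using h)
    rw [xI_emptySet, poincare_emptySet, one_smul, map_one, mul_one, hasseAlgUp_eq E .nil,
      hasseAlgDown_eq E .nil, upPath, downPath, ← map_mul, hasseE_mul_self]
  · obtain ⟨s, hs⟩ := Finset.card_eq_one.1 h
    obtain rfl : I = singletonSet cs s := Subtype.ext hs
    rw [xI_singletonSet, poincare_singletonSet, map_add, BraidSystem.hecke_heckeT, map_one,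
      sub_add_cancel]
    exact ((hasseBraidSystem E).e_mul_chi s).symm
  · obtain ⟨F⟩ := nonempty_chainTo I
    rw [hasseBraidSystem_hecke_xI E F, ← poincare_smul_hasseMk_up_mul_down E h F, hasseAlgUp_eq E F,
      hasseAlgDown_eq E F]

/-- The hook system of the quotient of the path algebra of the Hasse quiver. -/
def hasseHookSystem : HookSystem cs (invPoincare (cs := cs)) (HasseAlgebra E) :=
  (hasseBraidSystem E).toHookSystem fun I =>
    (smul_poincare_smul algebraMap_poincare_mul_invPoincare I _).symm.trans
      (congrArg _ (poincare_smul_hasseAlgUp_mul_hasseAlgDown E I))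

/-- Choose for $J$ a chain that passes through $I$; the part up to $I$ cancels. In this way the
arrows are recovered from `up` and `down`, which shows that the second composite fixes them. -/
theorem hasseAlgDown_mul_hasseAlgUp {I J : Finitary cs} (h : Covers I J) :
    hasseAlgDown E I * hasseAlgUp E J = hasseMk E (hasseUp h) := by
  obtain ⟨F⟩ := nonempty_chainTo I
  rw [hasseAlgDown_eq E F, hasseAlgUp_eq E (F.cons h), upPath, map_mul, ← mul_assoc,
    hasseMk_downPath_mul_upPath, ← map_mul, hasseE_mul_hasseUp]

theorem hasseAlgDown_mul_hasseAlgUp_of_covers {I J : Finitary cs} (h : Covers I J) :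
    hasseAlgDown E J * hasseAlgUp E I = hasseMk E (hasseDown h) := by
  obtain ⟨F⟩ := nonempty_chainTo I
  rw [hasseAlgUp_eq E F, hasseAlgDown_eq E (F.cons h), downPath, map_mul, mul_assoc,
    hasseMk_downPath_mul_upPath, ← map_mul, hasseDown_mul_hasseE]

/-- The quotient of the path algebra of the Hasse quiver is the base change of the Hecke endomorphism
algebra. -/
def hasseEquiv : HasseAlgebra E ≃ₐ[LocRing] LocHeckeEnd cs :=
  AlgEquiv.ofAlgHom (hasseHom E)
    ((hasseHookSystem E).psiHom algebraMap_poincare_mul_invPoincare)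
    ((hasseHookSystem E).comp_psiHom algebraMap_poincare_mul_invPoincare _
      ((hasseHom_mk E _).trans (hasseData_lift_hasseE _))
      (fun _ => (hasseHom_mk E _).trans (hasseData_lift_upPath _))
      fun _ => (hasseHom_mk E _).trans (hasseData_lift_downPath _))
    (by
      refine RingQuot.ringQuot_ext' LocRing _ _ (PathAlgebra.algHom_ext (fun a => ?_) ?_)
      · have h : hasseHom E (hasseMk E (PathAlgebra.vertex LocRing a)) = locProj LocRing a.set :=
          (hasseHom_mk E _).trans (hasseData_lift_hasseE _)
        exact (congrArg _ h).trans
          ((hasseHookSystem E).psiHom_locProj algebraMap_poincare_mul_invPoincare _)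
      · rintro ⟨a⟩ ⟨b⟩ f
        have h : hasseHom E (hasseMk E (PathAlgebra.arrow LocRing f)) = hasseArr invPoincare f :=
          (hasseHom_mk E _).trans (PathAlgebra.Data.lift_arrow _ _)
        have key (I J : Finitary cs) :
            (hasseHookSystem E).psiHom algebraMap_poincare_mul_invPoincare
              (locDown invPoincare I * locUp LocRing J) = hasseAlgDown E I * hasseAlgUp E J := by
          rw [map_mul, HookSystem.psiHom_locDown, HookSystem.psiHom_locUp]
          rfl
        refine (congrArg _ h).trans ?_
        change HasseArrow a b at f
        cases f with
        | up hc => exact (key _ _).trans (hasseAlgDown_mul_hasseAlgUp E hc)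
        | down hc => exact (key _ _).trans (hasseAlgDown_mul_hasseAlgUp_of_covers E hc))

end HeckeEndo

end

theorem theorem5p1 {B W : Type*} [Finite B] [Group W] {M : CoxeterMatrix B}
    (cs : CoxeterSystem M W) :
    (∀ (I : HeckeEndo.Finitary cs) (F : HeckeEndo.ChainTo I),
      Nonempty (HeckeEndo.Expression F)) ∧
    ∀ E : ∀ (I : HeckeEndo.Finitary cs) (F : HeckeEndo.ChainTo I), HeckeEndo.Expression F,
      Nonempty (HeckeEndo.LocHeckeEnd cs ≃ₐ[HeckeEndo.LocRing] HeckeEndo.StarAlgebra cs) ∧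
      Nonempty (HeckeEndo.StarAlgebra cs ≃ₐ[HeckeEndo.LocRing] HeckeEndo.HasseAlgebra E) :=
  -- The first component shows that a choice of expressions exists, so the quantification over `E`
  -- is not vacuous. The two quotients are compared through $RE_q(W)$.
  ⟨fun _ F => HeckeEndo.nonempty_expression F, fun E =>
    ⟨⟨(HeckeEndo.starEquiv cs).symm⟩,
      ⟨(HeckeEndo.starEquiv cs).trans (HeckeEndo.hasseEquiv E).symm⟩⟩⟩
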